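/- **Setting.** Fix $D\ge 3$ colours. For a *degree* $k=(k_1,\dots,k_D)\in\mathbb N^D$, an element of degree $k$ is thought of as having, for each colour $c$, $k_c$ pairs (labelled by shades $1\le s\le k_c$), each consisting of one input and one output of colour $c$. *Melonic graphs.* A graph $\mathsf g$ of elements $h_1,\dots,h_q$ joins, for every colour $c$, the outputs of colour $c$ of the elements bijectively to their inputs of colour $c$; it is thus given by $D$ permutations $\mathsf g_c$, where $\mathsf g_c$ acts on the pairs of colour $c$ of all the elements. The cycles of $\mathsf g_c$ are the cycles of colour $c$ of $\mathsf g$. The graph $\mathsf g$ is *connected melonic* if either $q=1$ and every output is joined to its paired input, or $q\ge2$ and there is an element all of whose outputs but one are joined to their paired inputs, the remaining output not being joined to its paired input, such that deleting this element and joining the two pending half-edges gives a connected melonic graph of the $q-1$ other elements. A *tree* of degree $k'$ is a connected melonic graph from which exactly one edge is removed in every cycle of every colour $c$, the removed edges of colour $c$ being labelled by $1,\dots,k'_c$. *Tensorial probability space.* This is a family of complex vector spaces $\mathcal A_k$ indexed by degrees ($\mathcal A_k=0$ for the degrees that do not occur), with: a multilinear product $\prod_i\mathcal A_{k_i}\to\mathcal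 A_{k'}$ for every tree of degree $k'$ of elements of degrees $k_i$ (the free output and input at the two ends of the removed edge labelled $s$ of colour $c$ form the pair $s$ of colour $c$ of the product), independent of the names of the elements, associative (multiplying products along a tree is the same as multiplying along the composed tree), and equal to the identity map for one element with unchanged labels; identities $1_k\in\mathcal A_k$ such that products of identities are identities and such that the product of an element $x$ with an identity, on the left or on the right, only depends on which label of the result each pair of $x$ ends up in; and a linear trace $\phi$ on each $\mathcal A_k$, such that $\phi$ of a product depends only on the elements and on the graph obtained from the tree by restoring the removed edges, and $\phi(x_1\cdots x_p\cdot 1_k)=\phi(1_k\cdot x_1\cdots x_p)=\phi(x_1)\cdots\phi(x_p)$ when each $x_i$ is multiplied directly with $1_k$, all on the same side. For a connected melonic graph $\mathsf g$ of $\vec h$, $\phi_{\mathsf g}(\vec h)$ is $\phi$ of the product of the $h_\ell$ along any tree obtained from $\mathsf g$ by removing one edge per cycle. Write $1_D=1_{(1,\dots,1)}$. *Pre-generators.* Let $(t_a,\bar t_a)_{a}$ be a family of pairs of pre-generators: for all indices $a,b$ an element $t_a\otimes\bar t_b\in\mathcal A_{(1,\dots,1)}$ is given. Let $\mathcal A_D[t_a,\bar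 t_a;1_D]$ be the family of subspaces (one in each degree) spanned by the products, along all trees, of finitely many elements of $\{t_a\otimes \bar t_a, 1_D\}$. *Cumulants.* For a permutation of $n$ objects with $\#\nu$ cycles let $|\nu|=n-\#\nu$; let $\mathsf M(\nu)=\prod_{p}(-1)^{p-1}C_{p-1}$ over the cycle lengths $p$ of $\nu$, with $C_p$ the Catalan numbers; write $\tau\preceq\sigma$ if $|\tau|+|\tau\sigma^{-1}|=|\sigma|$. For $D$-tuples of permutations $\preceq$ is meant for each component, and $\mathsf M(\boldsymbol\nu)=\prod_c\mathsf M(\nu_c)$. For a connected melonic graph $\mathsf g$ of $\vec h$, $$\varkappa_{\mathsf g}(\vec h)=\sum_{\mathsf f\preceq\mathsf g}\ \Bigl(\prod_{\mathsf f'}\phi_{\mathsf f'}(\vec h|_{\mathsf f'})\Bigr)\,\mathsf M(\mathsf f\mathsf g^{-1}),$$ the product being over the connected components $\mathsf f'$ of $\mathsf f$. A $D$-tuple $\boldsymbol\sigma=(\sigma_1,\dots,\sigma_D)\in S_n^D$ is viewed as the bipartite graph with white and black vertices $1,\dots,n$ and an edge of colour $c$ from the white vertex $i$ to the black vertex $\sigma_c(i)$.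 It is *purely connected and melonic with canonical pairing the identity* if $n=1$, or if $n\ge2$ and for some label $v$ and colour $c_0$ one has $\sigma_c(v)=v$ exactly for $c\neq c_0$, and deleting the two vertices $v$ and joining the two pending edges of colour $c_0$ gives a graph of the same kind on the $n-1$ other labels. For $x_i=t_{a_i}$ and $x'_i=\bar t_{b_i}$, let $\varphi_{\boldsymbol\sigma}(\vec x,\vec{x}')=\phi_{\boldsymbol\sigma}(x_1\otimes x'_1,\dots,x_n\otimes x'_n)$, $\boldsymbol\sigma$ being viewed as a graph of $n$ elements of degree $(1,\dots,1)$, and $$\kappa_{\boldsymbol\sigma}(\vec x,\vec x')=\sum_{\boldsymbol\tau\preceq\boldsymbol\sigma}\Bigl(\prod_{\boldsymbol\tau'}\varphi_{\boldsymbol\tau'}(\vec x|_{\boldsymbol\tau'},\vec x'|_{\boldsymbol\tau'})\Bigr)\mathsf M(\boldsymbol\sigma\boldsymbol\tau^{-1}),$$ the product being over the connected components of $\boldsymbol\tau$, white and black vertices with the same label being identified. *Almost alternating.* If $h_\ell\in\mathcal A_D[t_{a_\ell},\bar t_{a_\ell};1_D]$ for $1\le \ell\le q$, then $(\mathsf g,\vec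 h)$ is almost alternating if at least one edge of $\mathsf g$ joins elements $h_\ell,h_{\ell'}$ with $a_\ell\ne a_{\ell'}$, and at most one edge joins two elements $h_\ell,h_{\ell'}$ with $\ell\neq\ell'$ and $a_\ell=a_{\ell'}$. **Theorem (pure tensor freeness).** The following statements are equivalent: 1. For any $n\ge2$, any $\boldsymbol\sigma\in S_n^D$ purely connected and melonic with canonical pairing the identity, and any indices $a_1,\dots,a_n$, if $x_i=t_{a_i}$ and $x'_i=\bar t_{a_i}$ for all $i$, then $\kappa_{\boldsymbol\sigma}(\vec x,\vec x')=0$ whenever $a_i\ne a_j$ for some $i,j$. 2. For any $q\ge2$, any indices $a_1,\dots,a_q$, any $h_\ell\in\mathcal A_D[t_{a_\ell},\bar t_{a_\ell};1_D]$ $(1\le\ell\le q)$ and any connected melonic graph $\mathsf g$ of $\vec h$, $\varkappa_{\mathsf g}(\vec h)=0$ whenever $a_\ell\neq a_{\ell'}$ for some $\ell,\ell'$. 3. For any $q\ge2$, any indices $a_1,\dots,a_q$, any $h_\ell\in\mathcal A_D[t_{a_\ell},\bar t_{a_\ell};1_D]$ $(1\le\ell\le q)$ and any connected melonic graph $\mathsf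 g$ of $\vec h$, $\phi_{\mathsf g}(\vec h)=0$ whenever $(\mathsf g,\vec h)$ is almost alternating and $\phi(h_\ell)=0$ for all $\ell$. Moreover, the following three statements, which also involve the generators $t_a\otimes\bar t_b$ with $a\ne b$, are equivalent (in all of them $n\ge1$, $\boldsymbol\sigma\in S_n^D$ is any purely connected and melonic tuple with canonical pairing the identity, and $x_i=t_{a_i}$, $x'_i=\bar t_{b_i}$ for any indices $a_i,b_i$): * (1') $\kappa_{\boldsymbol\sigma}(\vec x,\vec x')=0$ whenever $a_i\ne a_j$ or $b_i\neq b_j$ or $a_i\neq b_j$ for some $i,j$; * (2') statement 2 holds, and $\kappa_{\boldsymbol\sigma}(\vec x,\vec x')=0$ whenever $a_i\ne b_i$ for some $i$; * (3') statement 3 holds, and $\varphi_{\boldsymbol\sigma}(\vec x,\vec x')=0$ whenever $a_i\neq b_i$ for some $i$. -/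

import Mathlib

open Equiv

/-! ## Permutations: cycles, non-crossing order, Moebius function -/

namespace TensorFree

/-- The number `#σ` of cycles of a permutation, fixed points included. -/
noncomputable def numCycles {X : Type} (σ : Perm X) : ℕ :=
  Nat.card (Quotient (Perm.SameCycle.setoid σ))

/-- The length `|σ| = n - #σ`, the minimal number of transpositions with product `σ`. -/
noncomputable def permLength {X : Type} (σ : Perm X) : ℕ :=
  Nat.card X - numCycles σ

/-- `τ ⪯ σ`: the permutation `τ` lies on a geodesic from the identity to `σ`, that is,
`|τ| + |τ σ⁻¹| = |σ|` (`τ` restricts to a non-crossing permutation on every cycle of `σ`). -/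
def NCLe {X : Type} (τ σ : Perm X) : Prop :=
  permLength τ + permLength (τ * σ⁻¹) = permLength σ

open scoped Classical in
/-- The Moebius function of non-crossing partitions: the product of `(-1)^(p-1) C_(p-1)` over the
cycles of `ν`, where `p` is the length of the cycle and `C` is the Catalan number.
Fixed points contribute `C_0 = 1`, so they may be left out. -/
noncomputable def moebiusNC {X : Type} [Fintype X] (ν : Perm X) : ℂ :=
  (ν.cycleType.map fun p => (-1 : ℂ) ^ (p - 1) * (catalan (p - 1) : ℂ)).prod

/-! ## Graphs of paired elements -/

/-- A degree `k = (k_1, …, k_D)`: an element of degree `k` has `k_c` paired inputs and outputs of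
colour `c`; the pairs of colour `c` are labelled by their shade in `Fin (k c)`. -/
abbrev Deg (D : ℕ) : Type := Fin D → ℕ

/-- The degree `(1, …, 1)`. -/
abbrev unitDeg (D : ℕ) : Deg D := fun _ => 1

/-- A graph of paired elements indexed by `ι`, the element number `i` having degree `k i`:
for each colour `c` a permutation of the pairs (element, shade).  `g c ⟨i, r⟩ = ⟨j, s⟩` means that
an edge of colour `c` joins the output of shade `r` of element `i` to the input of shade `s` of
element `j`.  The cycles of `g c` are the cycles that alternate edges of colour `c` and paired
inputs and outputs. -/
abbrev Graph {D : ℕ} {ι : Type} (k : ι → Deg D) : Type :=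
  ∀ c : Fin D, Perm (Σ i : ι, Fin (k i c))

/-- Forget that an element of the index type differs from `v`. -/
def unremove {D : ℕ} {ι : Type} {k : ι → Deg D} {v : ι} {c : Fin D}
    (x : Σ i : {i : ι // i ≠ v}, Fin (k i.1 c)) : Σ i : ι, Fin (k i c) :=
  ⟨x.1.1, x.2⟩

/-- Connected melonic graphs of paired elements.  With a single element, every output is joined to
the input it is paired with.  With more elements, there is an element `v` all of whose outputs are
joined to their paired inputs, except for the pair of one colour `c₀` and one shade `r₀`; and after
deleting `v` and reconnecting the two pending half-edges one gets a connected melonic graph `g'`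
of the remaining elements. -/
inductive IsMelonic {D : ℕ} : ∀ {ι : Type} {k : ι → Deg D}, Graph k → Prop
  | single {ι : Type} [Unique ι] (k : ι → Deg D) : IsMelonic (k := k) (fun _ => 1)
  | insert {ι : Type} {k : ι → Deg D} (g : Graph k) (v : ι) (c₀ : Fin D) (r₀ : Fin (k v c₀))
      (hself : ∀ (c : Fin D) (r : Fin (k v c)),
        (⟨c, r⟩ : Σ c, Fin (k v c)) ≠ ⟨c₀, r₀⟩ → g c ⟨v, r⟩ = ⟨v, r⟩)
      (hopen : g c₀ ⟨v, r₀⟩ ≠ ⟨v, r₀⟩)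
      (g' : Graph fun i : {i : ι // i ≠ v} => k i.1)
      (hkeep : ∀ c x, (g c (unremove x)).1 ≠ v → unremove (g' c x) = g c (unremove x))
      (hjoin : ∀ c x, (g c (unremove x)).1 = v →
        unremove (g' c x) = g c (g c (unremove x)))
      (hg' : IsMelonic g') : IsMelonic g

/-- The connected components of a graph, as an equivalence relation on the elements. -/
def conn {D : ℕ} {ι : Type} {k : ι → Deg D} (g : Graph k) : Setoid ι :=
  Relation.EqvGen.setoid fun i j =>
    ∃ (c : Fin D) (r : Fin (k i c)) (s : Fin (k j c)), g c ⟨i, r⟩ = ⟨j, s⟩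

theorem conn_edge {D : ℕ} {ι : Type} {k : ι → Deg D} (g : Graph k)
    (b : Quotient (conn g)) (c : Fin D) (x : Σ i : ι, Fin (k i c)) :
    Quotient.mk (conn g) (g c x).1 = b ↔ Quotient.mk (conn g) x.1 = b := by
  have h : Quotient.mk (conn g) x.1 = Quotient.mk (conn g) (g c x).1 :=
    Quotient.sound (Relation.EqvGen.rel _ _ ⟨c, x.2, (g c x).2, rfl⟩)
  rw [h]

/-- The connected component `b` of a graph, as a graph of the elements that it contains. -/
def component {D : ℕ} {ι : Type} {k : ι → Deg D} (g : Graph k) (b : Quotient (conn g)) :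
    Graph fun i : {i : ι // Quotient.mk (conn g) i = b} => k i.1 :=
  fun c => (Equiv.subtypeSigmaEquiv (fun i => Fin (k i c))
    (fun i => Quotient.mk (conn g) i = b)).permCongr ((g c).subtypePerm (conn_edge g b c))

/-! ## Trees: iterated multiplications -/

/-- A tree, that is, the shape of a multiplication of elements of degrees `k i`, the result having
degree `k'`.  It consists of a connected melonic graph together with one removed edge for each
cycle of each colour.  The removed edge labelled by the shade `r` of colour `c` starts at the output
`cut c r`.  In the result, the pair of colour `c` and shade `r` consists of the output `cut c r`
and of the input at the other end of the removed edge. -/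
structure Tree {D : ℕ} {ι : Type} (k : ι → Deg D) (k' : Deg D) where
  /-- the graph obtained by joining the paired outputs and inputs of the result -/
  graph : Graph k
  melonic : IsMelonic graph
  /-- the removed edges -/
  cut : ∀ c : Fin D, Fin (k' c) → Σ i : ι, Fin (k i c)
  cut_spec : ∀ (c : Fin D) (x : Σ i : ι, Fin (k i c)), ∃! r, (graph c).SameCycle (cut c r) x

/-- The output `cut c r` remains free in the result, i.e. the edge that leaves it is removed. -/
def Tree.IsCut {D : ℕ} {ι : Type} {k : ι → Deg D} {k' : Deg D} (T : Tree k k') (c : Fin D)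
    (x : Σ i : ι, Fin (k i c)) : Prop :=
  ∃ r, T.cut c r = x

/-- A pair of colour `c` of the element `j` inside the group number `i`, as a pair of the whole
family. -/
def ungroup {D : ℕ} {ι : Type} {κ : ι → Type} {K : ∀ i, κ i → Deg D} {c : Fin D} (i : ι)
    (y : Σ j : κ i, Fin (K i j c)) : Σ x : (Σ i, κ i), Fin (K x.1 x.2 c) :=
  ⟨⟨i, y.1⟩, y.2⟩

/-- `U` is the tree obtained from `T` by replacing each of its elements `i` by the tree `S i`. -/
structure IsGraft {D : ℕ} {ι : Type} {κ : ι → Type} {K : ∀ i, κ i → Deg D} {k : ι → Deg D}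
    {k' : Deg D} (T : Tree k k') (S : ∀ i, Tree (K i) (k i))
    (U : Tree (fun x : Σ i, κ i => K x.1 x.2) k') : Prop where
  inner : ∀ (c : Fin D) (i : ι) (y : Σ j : κ i, Fin (K i j c)),
    ¬ (S i).IsCut c y → U.graph c (ungroup i y) = ungroup i ((S i).graph c y)
  outer : ∀ (c : Fin D) (i j : ι) (r : Fin (k i c)) (s : Fin (k j c)),
    T.graph c ⟨i, r⟩ = ⟨j, s⟩ →
      U.graph c (ungroup i ((S i).cut c r)) = ungroup j ((S j).graph c ((S j).cut c s))
  cut : ∀ (c : Fin D) (r : Fin (k' c)),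
    U.cut c r = ungroup (T.cut c r).1 ((S (T.cut c r).1).cut c (T.cut c r).2)

/-- `T'` is the tree `T` with its elements renamed along `e`. -/
structure IsRenaming {D : ℕ} {ι ι' : Type} (e : ι ≃ ι') {k : ι' → Deg D} {k' : Deg D}
    (T : Tree (fun i => k (e i)) k') (T' : Tree k k') : Prop where
  graph : ∀ (c : Fin D) (x : Σ i : ι, Fin (k (e i) c)),
    T'.graph c ⟨e x.1, x.2⟩ = ⟨e (T.graph c x).1, (T.graph c x).2⟩
  cut : ∀ (c : Fin D) (r : Fin (k' c)), T'.cut c r = ⟨e (T.cut c r).1, (T.cut c r).2⟩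

end TensorFree

open TensorFree

/-! ## Tensorial probability spaces -/

/-- A tensorial probability space with `D` colours: vector spaces `A k` of elements of degree `k`,
associative multiplication, identities `1_k` and a trace `φ`.

Associativity says that the result of multiplying several elements only depends on the resulting
tree.  The multiplication is therefore given here by one multilinear map per tree; the product
`x ·_(c; s, s') y`, which multiplies the input `(c, s)` of `x` with the output `(c, s')` of `y`, is
the one for the tree with two elements and the single edge from the output `(c, s')` of `y` to the
input `(c, s)` of `x`.  A zero space `A k` stands for the degrees that do not occur; `1_k` has a
meaning in the other ones. -/
structure TensorialProbabilitySpace (D : ℕ) where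
  /-- the elements of degree `k` -/
  A : Deg D → Type*
  [addCommGroup : ∀ k, AddCommGroup (A k)]
  [module : ∀ k, Module ℂ (A k)]
  /-- the product of a family of elements along a tree -/
  mul : ∀ {ι : Type} {k : ι → Deg D} {k' : Deg D}, Tree k k' →
    MultilinearMap ℂ (fun i => A (k i)) (A k')
  /-- the product of one element is that element, if its shades keep their labels -/
  mul_single : ∀ {k : Deg D} (T : Tree (fun _ : Unit => k) k),
    (∀ c r, T.cut c r = ⟨(), r⟩) → ∀ h : Unit → A k, mul T h = h ()
  /-- the names of the elements in a tree do not matter -/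
  mul_rename : ∀ {ι ι' : Type} (e : ι ≃ ι') {k : ι' → Deg D} {k' : Deg D}
    (T : Tree (fun i => k (e i)) k') (T' : Tree k k'), IsRenaming e T T' →
    ∀ h : ∀ i, A (k i), mul T' h = mul T fun i => h (e i)
  /-- associativity -/
  mul_graft : ∀ {ι : Type} {κ : ι → Type} {K : ∀ i, κ i → Deg D} {k : ι → Deg D} {k' : Deg D}
    (T : Tree k k') (S : ∀ i, Tree (K i) (k i))
    (U : Tree (fun x : Σ i, κ i => K x.1 x.2) k'), IsGraft T S U →
    ∀ h : ∀ x : Σ i, κ i, A (K x.1 x.2), mul U h = mul T fun i => mul (S i) fun j => h ⟨i, j⟩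
  /-- the identity `1_k` -/
  one : ∀ k, A k
  /-- a product of identities is an identity -/
  mul_one : ∀ {ι : Type} {k : ι → Deg D} {k' : Deg D} (T : Tree k k'),
    (∀ i, Nontrivial (A (k i))) → mul T (fun i => one (k i)) = one k'
  /-- multiplying `x = h true` with an identity on the left or on the right, and along any shades,
  gives the same result, as long as each pair of `x` ends up in the pair of the result with the
  same label -/
  one_mul : ∀ {k : Bool → Deg D} {k' : Deg D} (T T' : Tree k k'),
    (∀ c r s, (T.graph c).SameCycle (T.cut c r) ⟨true, s⟩ ↔
      (T'.graph c).SameCycle (T'.cut c r) ⟨true, s⟩) →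
    ∀ h : ∀ i, A (k i), h false = one (k false) → mul T h = mul T' h
  /-- the trace -/
  φ : ∀ k, A k →ₗ[ℂ] ℂ
  /-- the trace property `φ (x ·_(c; s, s') y) = φ (y ·_(c; s', s) x)`, for products of any number of
  elements: which edge of each cycle of the completed graph is missing in the tree is immaterial -/
  trace_mul : ∀ {ι : Type} {k : ι → Deg D} {k' k'' : Deg D} (T : Tree k k') (T' : Tree k k''),
    T.graph = T'.graph → ∀ h : ∀ i, A (k i), φ k' (mul T h) = φ k'' (mul T' h)
  /-- `φ (1_k · x_1 ⋯ x_p) = φ (x_1 ⋯ x_p · 1_k) = φ (x_1) ⋯ φ (x_p)` whenever every `x_i` is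
  multiplied with `1_k`, all of them from the right or all of them from the left;
  the index of `1_k` is `none` -/
  trace_one_mul : ∀ {ι : Type} [Fintype ι] {k : Option ι → Deg D} {k' : Deg D} (T : Tree k k'),
    Nontrivial (A (k none)) →
    ((∀ i : ι, ∃ (c : Fin D) (r : Fin (k (some i) c)) (s : Fin (k none c)),
        T.graph c ⟨some i, r⟩ = ⟨none, s⟩ ∧ ¬ T.IsCut c ⟨some i, r⟩) ∨
      (∀ i : ι, ∃ (c : Fin D) (r : Fin (k (some i) c)) (s : Fin (k none c)),
        T.graph c ⟨none, s⟩ = ⟨some i, r⟩ ∧ ¬ T.IsCut c ⟨none, s⟩)) →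
    ∀ h : ∀ i, A (k i), h none = one (k none) →
      φ k' (mul T h) = ∏ i : ι, φ (k (some i)) (h (some i))

attribute [instance] TensorialProbabilitySpace.addCommGroup TensorialProbabilitySpace.module

namespace TensorialProbabilitySpace

variable {D : ℕ} (𝒜 : TensorialProbabilitySpace D)

/-! ## Moments and free cumulants of melonic graphs of elements -/

open scoped Classical in
/-- The moment `φ_g(h)` of a connected melonic graph `g` of the elements `h i`: the trace of any
product of the `h i` whose tree is `g` with one edge removed per cycle. -/
noncomputable def moment {ι : Type} {k : ι → Deg D} (g : Graph k) (h : ∀ i, 𝒜.A (k i)) : ℂ :=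
  if H : ∃ (k' : Deg D) (T : Tree k k'), T.graph = g then
    𝒜.φ H.choose (𝒜.mul H.choose_spec.choose h)
  else 0

open scoped Classical in
/-- The multiplicative extension `φ_(Π(g), g)(h)`: the product of the moments of the connected
components of `g`. -/
noncomputable def momentProd {ι : Type} [Fintype ι] {k : ι → Deg D} (g : Graph k)
    (h : ∀ i, 𝒜.A (k i)) : ℂ :=
  ∏ b : Quotient (conn g), 𝒜.moment (component g b) fun i => h i.1

open scoped Classical in
/-- The free cumulant `ϰ_g(h) = ∑_(f ⪯ g) φ_(Π(f), f)(h) M(f, g)` of a connected melonic graph `g`. -/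
noncomputable def cumulant {ι : Type} [Fintype ι] {k : ι → Deg D} (g : Graph k)
    (h : ∀ i, 𝒜.A (k i)) : ℂ :=
  ∑ f : Graph k with ∀ c, NCLe (f c) (g c),
    𝒜.momentProd f h * ∏ c, moebiusNC (f c * (g c)⁻¹)

/-- `A_(D,k)[s]`: the linear combinations of the elements of degree `k` that are products of
finitely many elements of a set `s` of generators of degree `(1, …, 1)`. -/
def generated (s : Set (𝒜.A (unitDeg D))) (k : Deg D) : Submodule ℂ (𝒜.A k) :=
  Submodule.span ℂ {z | ∃ (n : ℕ) (T : Tree (fun _ : Fin n => unitDeg D) k)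
    (w : Fin n → 𝒜.A (unitDeg D)), (∀ i, w i ∈ s) ∧ 𝒜.mul T w = z}

end TensorialProbabilitySpace

namespace TensorFree

/-- `(g, h)` is almost alternating, where `h i` belongs to the subspace generated by the pair of
pre-generators with index `a i`: at least one edge links elements with different pre-generators,
and at most one edge links two different elements with the same pre-generators. -/
def AlmostAlternating {D : ℕ} {ι α : Type*} {k : ι → Deg D}
    (g : ∀ c : Fin D, Perm (Σ i : ι, Fin (k i c))) (a : ι → α) : Prop :=
  (∃ (c : Fin D) (x : Σ i : ι, Fin (k i c)), a x.1 ≠ a (g c x).1) ∧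
  {e : Σ c : Fin D, Σ i : ι, Fin (k i c) |
    e.2.1 ≠ (g e.1 e.2).1 ∧ a e.2.1 = a (g e.1 e.2).1}.Subsingleton

/-! ## Pure trace-invariants -/

/-- `σ ∈ S_n^D` (on a set `ι` of labels) is purely connected and melonic, and its canonical pairing
is the identity.  Here `σ c i = j` means that an edge of colour `c` joins the white vertex `i` to
the black vertex `j`.  With more than two vertices, there is a pair formed by the white vertex `v`
and the black vertex `v`, linked by all colours but one, `c₀`; and after deleting this pair and
reconnecting the two pending edges of colour `c₀` one gets an invariant `σ'` of the same kind. -/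
inductive IsPureMelonic {D : ℕ} : ∀ {ι : Type}, (Fin D → Perm ι) → Prop
  | single {ι : Type} [Unique ι] (σ : Fin D → Perm ι) : IsPureMelonic σ
  | insert {ι : Type} (σ : Fin D → Perm ι) (v : ι) (c₀ : Fin D)
      (hself : ∀ c, c ≠ c₀ → σ c v = v) (hopen : σ c₀ v ≠ v)
      (σ' : Fin D → Perm {i : ι // i ≠ v})
      (hkeep : ∀ c (x : {i : ι // i ≠ v}), σ c x.1 ≠ v → (σ' c x).1 = σ c x.1)
      (hjoin : ∀ c (x : {i : ι // i ≠ v}), σ c x.1 = v → (σ' c x).1 = σ c v)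
      (hσ' : IsPureMelonic σ') : IsPureMelonic σ

/-- The connected components of `τ ∈ S_n^D`, the white and the black vertex with the same label
being identified. -/
def pureConn {D : ℕ} {ι : Type} (τ : Fin D → Perm ι) : Setoid ι :=
  Relation.EqvGen.setoid fun i j => ∃ c : Fin D, τ c i = j

theorem pureConn_edge {D : ℕ} {ι : Type} (τ : Fin D → Perm ι) (b : Quotient (pureConn τ))
    (c : Fin D) (i : ι) :
    Quotient.mk (pureConn τ) (τ c i) = b ↔ Quotient.mk (pureConn τ) i = b := by
  have h : Quotient.mk (pureConn τ) i = Quotient.mk (pureConn τ) (τ c i) :=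
    Quotient.sound (Relation.EqvGen.rel _ _ ⟨c, rfl⟩)
  rw [h]

/-- The connected component `b` of `τ`. -/
def pureComponent {D : ℕ} {ι : Type} (τ : Fin D → Perm ι) (b : Quotient (pureConn τ)) :
    Fin D → Perm {i : ι // Quotient.mk (pureConn τ) i = b} :=
  fun c => (τ c).subtypePerm (pureConn_edge τ b c)

/-- `σ ∈ S_n^D` as a graph of `n` elements of degree `(1, …, 1)`. -/
def pureGraph {D : ℕ} {ι : Type} (σ : Fin D → Perm ι) : Graph fun _ : ι => unitDeg D :=
  fun c => (Equiv.sigmaUnique ι fun _ => Fin 1).symm.permCongr (σ c)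

end TensorFree

namespace TensorialProbabilitySpace

variable {D : ℕ} (𝒜 : TensorialProbabilitySpace D) {α : Type*}

/-- The moment `φ_σ(x, x')` for `x i = t_(a i)` and `x' i = t̄_(b i)`, where `gen a b` is the
generator `t_a ⊗ t̄_b`. -/
noncomputable def pureMoment (gen : α → α → 𝒜.A (unitDeg D)) {ι : Type} (σ : Fin D → Perm ι)
    (a b : ι → α) : ℂ :=
  𝒜.moment (pureGraph σ) fun i => gen (a i) (b i)

open scoped Classical in
/-- The multiplicative extension `φ_(Π(τ), τ)(x, x')`. -/
noncomputable def pureMomentProd (gen : α → α → 𝒜.A (unitDeg D)) {ι : Type} [Fintype ι]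
    (τ : Fin D → Perm ι) (a b : ι → α) : ℂ :=
  ∏ B : Quotient (pureConn τ),
    𝒜.pureMoment gen (pureComponent τ B) (fun i => a i.1) (fun i => b i.1)

open scoped Classical in
/-- The free cumulant `κ_σ(x, x') = ∑_(τ ⪯ σ) φ_(Π(τ), τ)(x, x') M(σ τ⁻¹)` of a purely connected
melonic `σ` with canonical pairing the identity. -/
noncomputable def pureCumulant (gen : α → α → 𝒜.A (unitDeg D)) {ι : Type} [Fintype ι]
    (σ : Fin D → Perm ι) (a b : ι → α) : ℂ :=
  ∑ τ : Fin D → Perm ι with ∀ c, NCLe (τ c) (σ c),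
    𝒜.pureMomentProd gen τ a b * ∏ c, moebiusNC (σ c * (τ c)⁻¹)

/-- The subspace `A_(D,k)[t_a, t̄_a; 1_D]` generated by `t_a ⊗ t̄_a` and `1_D`. -/
def pureSubspace (gen : α → α → 𝒜.A (unitDeg D)) (a : α) (k : Deg D) : Submodule ℂ (𝒜.A k) :=
  𝒜.generated {gen a a, 𝒜.one (unitDeg D)} k

end TensorialProbabilitySpace

namespace TensorFree

/-! Melonicity is a matter of counting. Let `|σ|` be the distance from `σ` to the identity in the
Cayley graph of all transpositions. Every graph `g` on finitely many elements satisfies #components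
+ ∑_c |g_c| ≥ #elements (`card_le_numComp_add`). Forests are the case of equality, and connected
forests are exactly the connected melonic graphs (`IsMelonic.isTreeLike`, `IsTreeLike.isMelonic`).
Equality passes to every `f ⪯ g` (`IsForest.of_le`), so all graphs that occur in the cumulant of a
melonic graph split into melonic components. Moments, Möbius function and cumulants are
multiplicative over disjoint unions (`cumulant_glue`), and moments are sums of cumulants by Möbius
inversion (`momentProd_eq_sum`), which rests on the Catalan recurrence.

The main tool is the formula for cumulants of products. Replacing the elements of `g` by trees `S`
is an order embedding `f ↦ graft f S`, and the cumulant of the products along `g` is a combination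
of cumulants of the factors along the `u ⪯ graft g S` (`cumulant_graft_eq_sum`). Give every factor
the label of its product. If `u` joins only equal labels and has a nonzero coefficient, then `g`
joins only equal labels (`isMono_of_sum_ne_zero`). Hence, if `g` mixes labels and the cumulants of
all proper mixed `u` vanish, only the top term is left (`cumulant_graft_of_not_isMono`). A second
tool is that a cumulant of at least two elements, one of them an identity, is zero
(`cumulant_eq_zero_of_one`).

1 ⇔ 2: by multilinearity the elements may be taken to be products of generators and identities; the
product formula then reduces mixed cumulants to those of the generators.

2 ⇒ 3: the moment of `g` is the sum of the cumulants of the `f ⪯ g`. A mixed `f` contributes zero.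
An unmixed one leaves some element isolated, by a count in which the single tolerated edge between
equal labels is just affordable (`exists_isolated_of_isMono`), so it contains a factor `φ(h_l) = 0`.

3 ⇒ 2: induction on the number of elements. If an edge joins distinct elements with equal labels,
multiply them together along it; the product formula identifies the cumulant with one of a smaller
graph. If there is no such edge, center the elements, which leaves the cumulant unchanged. All
cumulants strictly below `g` vanish, so the cumulant is the moment of an alternating graph of
centered elements.

For mismatched generators, the component that contains the mismatch kills every term, in the moments
as well as in the cumulants. -/

theorem perm_apply_inv {X : Type*} (σ : Perm X) (x : X) : σ (σ⁻¹ x) = x := σ.apply_symm_apply x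

theorem perm_inv_apply {X : Type*} (σ : Perm X) (x : X) : σ⁻¹ (σ x) = x := σ.symm_apply_apply x

theorem swap_self_eq_one {X : Type*} [DecidableEq X] (x : X) : (swap x x : Perm X) = 1 :=
  swap_self x

set_option linter.unusedSectionVars false

/-! ### Length of permutations and multiplication by transpositions. -/

section PermLength

variable {X : Type} [Finite X]

theorem numCycles_le (σ : Perm X) : numCycles σ ≤ Nat.card X :=
  Nat.card_le_card_of_surjective _ (Quotient.mk_surjective (s := Perm.SameCycle.setoid σ))

theorem permLength_add_numCycles (σ : Perm X) : permLength σ + numCycles σ = Nat.card X :=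
  Nat.sub_add_cancel (numCycles_le σ)

theorem numCycles_congr {X' : Type} {σ : Perm X} {τ : Perm X'} (e : X ≃ X')
    (h : ∀ x y, σ.SameCycle x y ↔ τ.SameCycle (e x) (e y)) : numCycles σ = numCycles τ :=
  Nat.card_congr (Quotient.congr e h)

theorem numCycles_eq_of_sameCycle {σ τ : Perm X} (h : ∀ x y, σ.SameCycle x y ↔ τ.SameCycle x y) :
    numCycles σ = numCycles τ := numCycles_congr (Equiv.refl X) h

theorem SameCycle.map_eq {X β : Type*} {σ : Perm X} (φ : X → β) (h : ∀ x, φ (σ x) = φ x) {x y : X}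
    (hxy : σ.SameCycle x y) : φ x = φ y := by
  have hinv : ∀ x, φ (σ⁻¹ x) = φ x := fun x => by
    rw [← h (σ⁻¹ x), perm_apply_inv]
  obtain ⟨i, rfl⟩ := hxy
  induction i using Int.induction_on with
  | zero => rfl
  | succ n ih => rw [add_comm, zpow_add, Perm.mul_apply, zpow_one, h, ← ih]
  | pred n ih => rw [sub_eq_add_neg, add_comm, zpow_add, Perm.mul_apply, zpow_neg_one, hinv, ← ih]

theorem SameCycle.mono {X X' : Type*} {σ : Perm X} {τ : Perm X'} (e : X → X')
    (h : ∀ x, τ.SameCycle (e x) (e (σ x))) {x y : X} (hxy : σ.SameCycle x y) :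
    τ.SameCycle (e x) (e y) :=
  Quotient.exact (s := Perm.SameCycle.setoid τ)
    (SameCycle.map_eq (fun z => Quotient.mk (Perm.SameCycle.setoid τ) (e z))
      (fun z => (Quotient.sound (s := Perm.SameCycle.setoid τ) (h z)).symm) hxy)

theorem permLength_permCongr {X' : Type} (e : X ≃ X') (σ : Perm X) :
    permLength (e.permCongr σ) = permLength σ := by
  have hX' : Finite X' := Finite.of_equiv X e
  have key : ∀ x y, σ.SameCycle x y ↔ (e.permCongr σ).SameCycle (e x) (e y) := by
    intro x y
    constructor
    · intro h
      refine SameCycle.mono e (fun z => ?_) h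
      have : e (σ z) = e.permCongr σ (e z) := by simp
      rw [this, Perm.sameCycle_apply_right]
    · intro h
      have := SameCycle.mono (τ := σ) e.symm (fun z => ?_) h
      · simpa using this
      · have : e.symm (e.permCongr σ z) = σ (e.symm z) := by simp
        rw [this, Perm.sameCycle_apply_right]
  rw [permLength, permLength, ← numCycles_congr e key, Nat.card_congr e]

theorem permLength_inv (σ : Perm X) : permLength σ⁻¹ = permLength σ := by
  rw [permLength, permLength, numCycles_eq_of_sameCycle fun x y => Perm.sameCycle_inv]

theorem permLength_conj (σ τ : Perm X) : permLength (τ * σ * τ⁻¹) = permLength σ := by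
  rw [← permLength_permCongr τ σ]
  congr 1

theorem permLength_mul_comm (σ τ : Perm X) : permLength (σ * τ) = permLength (τ * σ) := by
  rw [← permLength_conj (τ * σ) σ]
  congr 1
  group

theorem permLength_one : permLength (1 : Perm X) = 0 := by
  have : numCycles (1 : Perm X) = Nat.card X := by
    refine (Nat.card_congr (Equiv.ofBijective _
      ⟨fun x y h => ?_, Quotient.mk_surjective (s := Perm.SameCycle.setoid (1 : Perm X))⟩)).symm
    exact Perm.sameCycle_one.1 (Quotient.exact h)
  have h2 := permLength_add_numCycles (1 : Perm X)
  omega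

variable [DecidableEq X]

/-- From `x` the product jumps to `σ y` and then follows the `σ`-cycle of `y`, which never meets
`x`, until it reaches `y`. -/
theorem sameCycle_mul_swap {σ : Perm X} {x y : X} (h : ¬ σ.SameCycle x y) :
    (σ * swap x y).SameCycle x y := by
  have key : ∀ m : ℕ, (σ * swap x y).SameCycle x ((σ ^ (m + 1)) y) := by
    intro m
    induction m with
    | zero =>
      have : (σ ^ (0 + 1)) y = (σ * swap x y) x := by simp
      rw [this, Perm.sameCycle_apply_right]
    | succ m ih =>
      rw [pow_succ', Perm.mul_apply]
      by_cases hy : (σ ^ (m + 1)) y = y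
      · have : σ ((σ ^ (m + 1)) y) = (σ * swap x y) x := by simp [hy]
        rw [this, Perm.sameCycle_apply_right]
      · have hx : (σ ^ (m + 1)) y ≠ x := fun hx =>
          h (Perm.SameCycle.symm ⟨((m + 1 : ℕ) : ℤ), by rw [zpow_natCast]; exact hx⟩)
        have : σ ((σ ^ (m + 1)) y) = (σ * swap x y) ((σ ^ (m + 1)) y) := by
          rw [Perm.mul_apply, swap_apply_of_ne_of_ne hx hy]
        rw [this, Perm.sameCycle_apply_right]
        exact ih
  have h1 := key (orderOf σ - 1)
  have : orderOf σ - 1 + 1 = orderOf σ := Nat.sub_add_cancel (orderOf_pos σ)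
  rwa [this, pow_orderOf_eq_one, Perm.one_apply] at h1

theorem SameCycle.mul_swap {σ : Perm X} {x y : X} (h : ¬ σ.SameCycle x y) {a b : X}
    (hab : σ.SameCycle a b) : (σ * swap x y).SameCycle a b := by
  have hs := sameCycle_mul_swap h
  refine SameCycle.mono id (fun z => ?_) hab
  simp only [id]
  by_cases hx : z = x
  · subst hx
    have : σ z = (σ * swap z y) y := by simp
    rw [this, Perm.sameCycle_apply_right]; exact hs
  by_cases hy : z = y
  · subst hy
    have : σ z = (σ * swap x z) x := by simp
    rw [this, Perm.sameCycle_apply_right]; exact hs.symm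
  have : σ z = (σ * swap x y) z := by rw [Perm.mul_apply, swap_apply_of_ne_of_ne hx hy]
  rw [this, Perm.sameCycle_apply_right]

/-- Identifying two classes of an equivalence relation removes exactly one class. -/
theorem card_quotient_of_merge {ι : Type} [Finite ι] (r s : Setoid ι) (i j : ι) (hij : ¬ r i j)
    (h : ∀ a b, s a b ↔ r a b ∨ (r a i ∧ r j b) ∨ (r a j ∧ r i b)) :
    Nat.card (Quotient s) + 1 = Nat.card (Quotient r) := by
  classical
  have hrs : ∀ a b, r a b → s a b := fun a b hab => (h a b).2 (Or.inl hab)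
  let F : {q : Quotient r // q ≠ Quotient.mk r i} → Quotient s := fun q =>
    Quotient.map' (s₁ := r) (s₂ := s) id (fun a b hab => hrs a b hab) q.1
  have hF : Function.Bijective F := by
    constructor
    · rintro ⟨q1, h1⟩ ⟨q2, h2⟩ h12
      induction q1 using Quotient.inductionOn with | _ a
      induction q2 using Quotient.inductionOn with | _ b
      have hab : s a b := Quotient.exact h12
      rcases (h a b).1 hab with hab | ⟨hai, _⟩ | ⟨_, hib⟩
      · exact Subtype.ext (Quotient.sound hab)
      · exact absurd (Quotient.sound hai) h1
      · exact absurd (Quotient.sound (r.symm hib)) h2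
    · intro q
      induction q using Quotient.inductionOn with | _ a
      by_cases ha : r a i
      · refine ⟨⟨Quotient.mk r j, fun hj => hij (r.symm (Quotient.exact hj))⟩, ?_⟩
        exact Quotient.sound ((h j a).2 (Or.inr (Or.inr ⟨r.refl j, r.symm ha⟩)))
      · exact ⟨⟨Quotient.mk r a, fun hq => ha (Quotient.exact hq)⟩, rfl⟩
  have : Fintype (Quotient r) := Fintype.ofFinite _
  rw [← Nat.card_congr (Equiv.ofBijective F hF), Nat.card_eq_fintype_card,
    Nat.card_eq_fintype_card, Fintype.card_subtype_compl, Fintype.card_subtype_eq]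
  have : 0 < Fintype.card (Quotient r) := Fintype.card_pos_iff.2 ⟨Quotient.mk r i⟩
  omega

theorem permLength_mul_swap_of_not_sameCycle {σ : Perm X} {x y : X} (h : ¬ σ.SameCycle x y) :
    permLength (σ * swap x y) = permLength σ + 1 := by
  have h1 : numCycles (σ * swap x y) + 1 = numCycles σ := by
    refine card_quotient_of_merge _ _ x y h fun a b => ?_
    change (σ * swap x y).SameCycle a b ↔ σ.SameCycle a b ∨ (σ.SameCycle a x ∧ σ.SameCycle y b) ∨
      (σ.SameCycle a y ∧ σ.SameCycle x b)
    constructor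
    -- An invariant of the product: the `σ`-cycle of a point, the cycle of `x` being renamed to that
    -- of `y`.
    · let φ : X → Quotient (Perm.SameCycle.setoid σ) := fun a =>
        open scoped Classical in
        if σ.SameCycle a x then Quotient.mk _ y else Quotient.mk _ a
      intro hab
      have hφ : φ a = φ b := by
        refine SameCycle.map_eq φ (fun z => ?_) hab
        have hσ : ∀ z, φ (σ z) = φ z := by
          intro z
          by_cases hz : σ.SameCycle z x
          · have hz' : σ.SameCycle (σ z) x := Perm.sameCycle_apply_left.2 hz
            simp only [φ, if_pos hz, if_pos hz']
          · have hz' : ¬ σ.SameCycle (σ z) x := fun h' => hz (Perm.sameCycle_apply_left.1 h')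
            simp only [φ, if_neg hz, if_neg hz']
            exact Quotient.sound (s := Perm.SameCycle.setoid σ)
              (show σ.SameCycle _ _ from Perm.sameCycle_apply_left.2 (Perm.SameCycle.refl σ z))
        rw [Perm.mul_apply, hσ]
        have hxy : φ x = φ y := by
          simp only [φ, if_pos (Perm.SameCycle.refl σ x), if_neg fun h' => h (Perm.SameCycle.symm h')]
        rcases eq_or_ne z x with rfl | hx
        · rw [swap_apply_left, hxy]
        rcases eq_or_ne z y with rfl | hy
        · rw [swap_apply_right, hxy]
        rw [swap_apply_of_ne_of_ne hx hy]
      simp only [φ] at hφ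
      split_ifs at hφ with ha hb hb
      · exact Or.inl (ha.trans hb.symm)
      · exact Or.inr (Or.inl ⟨ha, Quotient.exact hφ⟩)
      · exact Or.inr (Or.inr ⟨Quotient.exact hφ, hb.symm⟩)
      · exact Or.inl (Quotient.exact hφ)
    · have hs := sameCycle_mul_swap h
      rintro (hab | ⟨h1, h2⟩ | ⟨h1, h2⟩)
      · exact SameCycle.mul_swap h hab
      · exact ((SameCycle.mul_swap h h1).trans hs).trans (SameCycle.mul_swap h h2)
      · exact ((SameCycle.mul_swap h h1).trans hs.symm).trans (SameCycle.mul_swap h h2)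
  have h2 := permLength_add_numCycles σ
  have h3 := permLength_add_numCycles (σ * swap x y)
  omega

theorem exists_first_pow {σ : Perm X} {x y : X} (hxy : x ≠ y) (h : σ.SameCycle x y) :
    ∃ j : ℕ, 0 < j ∧ (σ ^ j) x = y ∧ (∀ i, 0 < i → i < j → (σ ^ i) x ≠ y) ∧
      ∀ i, 0 < i → i ≤ j → (σ ^ i) x ≠ x := by
  classical
  obtain ⟨n, hn⟩ := h.exists_nat_pow_eq
  have hex : ∃ n : ℕ, (σ ^ n) x = y := ⟨n, hn⟩
  have hj := Nat.find_spec hex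
  have hmin : ∀ i, i < Nat.find hex → (σ ^ i) x ≠ y := fun i hi => Nat.find_min hex hi
  refine ⟨Nat.find hex, Nat.pos_of_ne_zero fun h0 => ?_, hj, fun i _ hi => hmin i hi,
    fun i h0 hi hx => ?_⟩
  · rw [h0] at hj; exact hxy (by simpa using hj)
  · refine hmin (Nat.find hex - i) (by omega) ?_
    have : σ ^ (Nat.find hex) = σ ^ (Nat.find hex - i) * σ ^ i := by
      rw [← pow_add]; congr 1; omega
    rw [this, Perm.mul_apply, hx] at hj
    exact hj

/-- The arc from `σ x` to `y` is stable under the product, which sends `y` back to `σ x`, and this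
arc does not contain `x`. -/
theorem not_sameCycle_mul_swap {σ : Perm X} {x y : X} (hxy : x ≠ y) (h : σ.SameCycle x y) :
    ¬ (σ * swap x y).SameCycle x y := by
  obtain ⟨j, hj0, hj, hy, hx⟩ := exists_first_pow hxy h
  intro hs
  let P : X → Prop := fun z => ∃ i, 0 < i ∧ i ≤ j ∧ (σ ^ i) x = z
  have hP : ∀ m : ℕ, P (((σ * swap x y) ^ m) y) := by
    intro m
    induction m with
    | zero => exact ⟨j, hj0, le_rfl, hj⟩
    | succ m ih =>
      obtain ⟨i, h0, hi, hz⟩ := ih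
      rw [pow_succ', Perm.mul_apply, ← hz]
      rcases hi.lt_or_eq with hlt | rfl
      · refine ⟨i + 1, by omega, hlt, ?_⟩
        rw [Perm.mul_apply, swap_apply_of_ne_of_ne (hx i h0 hi) (hy i h0 hlt), pow_succ',
          Perm.mul_apply]
      · exact ⟨1, one_pos, hj0, by rw [hj]; simp⟩
  obtain ⟨m, hm⟩ := hs.symm.exists_nat_pow_eq
  obtain ⟨i, h0, hi, hz⟩ := hP m
  exact hx i h0 hi (hz.trans hm)

theorem permLength_mul_swap_of_sameCycle {σ : Perm X} {x y : X} (hxy : x ≠ y)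
    (h : σ.SameCycle x y) : permLength (σ * swap x y) + 1 = permLength σ := by
  have := permLength_mul_swap_of_not_sameCycle (not_sameCycle_mul_swap hxy h)
  rw [mul_assoc, swap_mul_self, mul_one] at this
  exact this.symm

theorem permLength_mul_swap_le (σ : Perm X) (x y : X) :
    permLength (σ * swap x y) ≤ permLength σ + 1 := by
  rcases eq_or_ne x y with rfl | hxy
  · rw [swap_self_eq_one, mul_one]; omega
  by_cases h : σ.SameCycle x y
  · have := permLength_mul_swap_of_sameCycle hxy h; omega
  · exact (permLength_mul_swap_of_not_sameCycle h).le

/-- Turning a point into a fixed point, by skipping it in its cycle. -/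
def skip (σ : Perm X) (x : X) : Perm X := σ * swap x (σ⁻¹ x)

theorem skip_self (σ : Perm X) (x : X) : skip σ x x = x := by simp [skip]

theorem skip_apply (σ : Perm X) (x y : X) (hy : y ≠ x) :
    skip σ x y = if σ y = x then σ x else σ y := by
  split_ifs with h
  · have : y = σ⁻¹ x := by rw [← h, perm_inv_apply]
    subst this; simp [skip]
  · have : y ≠ σ⁻¹ x := fun h' => h (by rw [h', perm_apply_inv])
    rw [skip, Perm.mul_apply, swap_apply_of_ne_of_ne hy this]

theorem sameCycle_inv_self (σ : Perm X) (x : X) : σ.SameCycle x (σ⁻¹ x) :=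
  ⟨-1, by simp⟩

theorem permLength_skip {σ : Perm X} {x : X} (hx : σ x ≠ x) :
    permLength (skip σ x) + 1 = permLength σ :=
  permLength_mul_swap_of_sameCycle (fun h => hx (by rw [h, perm_apply_inv, ← h]))
    (sameCycle_inv_self σ x)

omit [DecidableEq X] in
theorem permLength_eq_zero {σ : Perm X} : permLength σ = 0 ↔ σ = 1 := by
  classical
  refine ⟨fun h => Equiv.ext fun x => ?_, fun h => h ▸ permLength_one⟩
  by_contra hx
  have := permLength_skip hx
  omega

omit [DecidableEq X] in
/-- Induction on permutations by removing one moved point after the other. -/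
theorem perm_skip_induction [DecidableEq X] {P : Perm X → Prop} (one : P 1)
    (step : ∀ σ x, σ x ≠ x → P (skip σ x) → P σ) (σ : Perm X) : P σ := by
  induction hn : permLength σ generalizing σ with
  | zero => rw [permLength_eq_zero.1 hn]; exact one
  | succ n ih =>
    have : σ ≠ 1 := fun h => by rw [h, permLength_one] at hn; omega
    obtain ⟨x, hx⟩ : ∃ x, σ x ≠ x := by
      by_contra! h; exact this (Equiv.ext h)
    exact step σ x hx (ih _ (by have := permLength_skip hx; omega))

theorem eq_skip_mul (σ : Perm X) (x : X) : σ = skip σ x * swap x (σ⁻¹ x) := by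
  rw [skip, mul_assoc, swap_mul_self, mul_one]

omit [DecidableEq X] in
-- `τ` is a product of `|τ|` transpositions, each of which raises the length by at most one. Thus
-- `|σ τ⁻¹|` is a distance, and `NCLe` is the geodesic order based at the identity.
theorem permLength_mul_le (σ τ : Perm X) : permLength (σ * τ) ≤ permLength σ + permLength τ := by
  classical
  induction τ using perm_skip_induction with
  | one => simp
  | step τ x hx ih =>
    have h1 := permLength_skip hx
    have h2 := permLength_mul_swap_le (σ * skip τ x) x (τ⁻¹ x)
    rw [mul_assoc, ← eq_skip_mul] at h2
    omega

omit [DecidableEq X] in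
theorem permLength_mul_inv_comm (σ τ : Perm X) : permLength (σ * τ⁻¹) = permLength (τ * σ⁻¹) := by
  rw [← permLength_inv, mul_inv_rev, inv_inv]

theorem permLength_swap_le (x y : X) : permLength (swap x y) ≤ 1 := by
  simpa [permLength_one] using permLength_mul_swap_le 1 x y

end PermLength

/-! ### The geodesic order. -/

section NCLe

variable {X : Type} [Finite X]

/-- The opposite inequality is the triangle inequality, so only this one ever needs checking. -/
theorem nCLe_of_le {σ τ : Perm X} (h : permLength τ + permLength (τ * σ⁻¹) ≤ permLength σ) :
    NCLe τ σ := by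
  refine le_antisymm h ?_
  have h1 := permLength_mul_le (σ * τ⁻¹) τ
  rw [inv_mul_cancel_right, permLength_mul_inv_comm] at h1
  omega

theorem NCLe.refl (σ : Perm X) : NCLe σ σ := by
  simp [NCLe, permLength_one]

theorem NCLe.one_le (σ : Perm X) : NCLe 1 σ := by
  simp [NCLe, permLength_one, permLength_inv]

theorem NCLe.length_lt {σ τ : Perm X} (h : NCLe τ σ) (hne : τ ≠ σ) :
    permLength τ < permLength σ := by
  have : permLength (τ * σ⁻¹) ≠ 0 := fun h0 => hne (by
    rw [permLength_eq_zero] at h0; exact mul_inv_eq_one.1 h0)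
  unfold NCLe at h; omega

theorem permLength_triangle (ρ σ τ : Perm X) :
    permLength (ρ * τ⁻¹) ≤ permLength (ρ * σ⁻¹) + permLength (σ * τ⁻¹) := by
  have := permLength_mul_le (ρ * σ⁻¹) (σ * τ⁻¹)
  rwa [mul_assoc, inv_mul_cancel_left] at this

theorem NCLe.trans {ρ σ τ : Perm X} (h1 : NCLe ρ σ) (h2 : NCLe σ τ) : NCLe ρ τ := by
  have := permLength_triangle ρ σ τ
  unfold NCLe at h1 h2
  exact nCLe_of_le (by omega)

/-- Both sides say that `1, ρ, σ, τ` lie in this order on a geodesic. So `σ ↦ σ τ⁻¹` is an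
order-reversing identification of the interval from `ρ` to `τ` with the permutations below `ρ τ⁻¹`.
-/
theorem nCLe_interval_left {ρ σ τ : Perm X} :
    (NCLe ρ σ ∧ NCLe σ τ) ↔ NCLe ρ τ ∧ NCLe (σ * τ⁻¹) (ρ * τ⁻¹) := by
  have e : σ * τ⁻¹ * (ρ * τ⁻¹)⁻¹ = σ * ρ⁻¹ := by group
  have h0 := permLength_mul_inv_comm σ ρ
  have h1 := permLength_mul_le (σ * ρ⁻¹) ρ
  have h2 := permLength_mul_le (τ * σ⁻¹) σ
  have h3 := permLength_triangle ρ σ τ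
  rw [inv_mul_cancel_right] at h1 h2
  have h4 := permLength_mul_inv_comm τ σ
  constructor
  · rintro ⟨ha, hb⟩
    refine ⟨ha.trans hb, nCLe_of_le ?_⟩
    rw [e]; unfold NCLe at ha hb; 
    have h5 := permLength_mul_le (τ * ρ⁻¹) ρ
    rw [inv_mul_cancel_right] at h5
    have h6 := permLength_mul_inv_comm τ ρ
    omega
  · rintro ⟨ha, hb⟩
    unfold NCLe at ha hb; rw [e] at hb
    exact ⟨nCLe_of_le (by omega), nCLe_of_le (by omega)⟩

/-- The order-preserving counterpart, by `σ ↦ ρ σ⁻¹`; it comes from the previous one by taking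
complements, up to a conjugation that does not affect lengths. -/
theorem nCLe_interval_right {ρ σ τ : Perm X} :
    (NCLe ρ σ ∧ NCLe σ τ) ↔ NCLe ρ τ ∧ NCLe (ρ * σ⁻¹) (ρ * τ⁻¹) := by
  rw [nCLe_interval_left]
  have e1 : σ * τ⁻¹ * (ρ * τ⁻¹)⁻¹ = σ * ρ⁻¹ := by group
  have e2 : ρ * σ⁻¹ * (ρ * τ⁻¹)⁻¹ = ρ * (σ⁻¹ * τ) * ρ⁻¹ := by group
  have e3 : permLength (σ⁻¹ * τ) = permLength (σ * τ⁻¹) := by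
    rw [permLength_mul_comm, permLength_mul_inv_comm]
  have e4 := permLength_mul_inv_comm σ ρ
  simp only [NCLe, e1, e2, permLength_conj, e3]
  constructor <;> rintro ⟨ha, hb⟩ <;> exact ⟨ha, by omega⟩

variable [DecidableEq X]

theorem swap_nCLe {σ : Perm X} {x y : X} (h : σ.SameCycle x y) : NCLe (swap x y) σ := by
  rcases eq_or_ne x y with rfl | hxy
  · rw [swap_self]; exact NCLe.one_le σ
  · have h1 := permLength_mul_swap_of_sameCycle hxy h
    have h2 := permLength_swap_le x y
    have h3 := permLength_mul_inv_comm σ (swap x y)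
    rw [swap_inv] at h3
    exact nCLe_of_le (by omega)

theorem swap_nCLe_iff {σ : Perm X} {x y : X} : NCLe (swap x y) σ ↔ σ.SameCycle x y := by
  refine ⟨fun h => ?_, swap_nCLe⟩
  by_contra hs
  have h1 := permLength_mul_swap_of_not_sameCycle hs
  have h3 := permLength_mul_inv_comm σ (swap x y)
  rw [swap_inv] at h3
  unfold NCLe at h
  omega

omit [DecidableEq X] in
-- A transposition is below `σ` exactly when its two points share a cycle of `σ`, so transitivity of
-- the order transports pairs from cycles of `τ` to cycles of `σ`.
theorem NCLe.sameCycle {σ τ : Perm X} (h : NCLe τ σ) {x y : X} (hxy : τ.SameCycle x y) :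
    σ.SameCycle x y := by
  classical
  exact swap_nCLe_iff.1 ((swap_nCLe hxy).trans h)

omit [DecidableEq X] in
theorem NCLe.apply_eq_self {σ τ : Perm X} (h : NCLe τ σ) {x : X} (hx : σ x = x) : τ x = x :=
  ((h.sameCycle (Perm.sameCycle_apply_right.2 (Perm.SameCycle.refl τ x))).eq_of_left hx).symm

theorem mul_swap_nCLe {σ : Perm X} {x y : X} (h : σ.SameCycle x y) : NCLe (σ * swap x y) σ := by
  rcases eq_or_ne x y with rfl | hxy
  · rw [swap_self_eq_one, mul_one]; exact NCLe.refl σ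
  have h1 := permLength_mul_swap_of_sameCycle hxy h
  have h2 := permLength_swap_le x y
  rw [← permLength_conj _ σ] at h2
  exact nCLe_of_le (by omega)

theorem skip_nCLe (σ : Perm X) (x : X) : NCLe (skip σ x) σ :=
  mul_swap_nCLe (sameCycle_inv_self σ x)

/-- If `τ y = σ x`, then `τ` is obtained from `τ (x y)`, which agrees with `σ` at `x`, by splitting
a cycle. -/
theorem NCLe.mul_swap {σ τ : Perm X} (h : NCLe τ σ) {x y : X} (hxy : τ y = σ x) :
    NCLe (τ * swap x y) σ ∧ (τ * swap x y).SameCycle x y := by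
  rcases eq_or_ne x y with rfl | hne
  · rw [swap_self_eq_one, mul_one]; exact ⟨h, Perm.SameCycle.refl τ x⟩
  have h1 : permLength (τ * swap x y * σ⁻¹) + 1 = permLength (τ * σ⁻¹) := by
    have e : τ * swap x y * σ⁻¹ = τ * σ⁻¹ * swap (σ x) (σ y) := by
      rw [swap_apply_apply]; group
    rw [e]
    refine permLength_mul_swap_of_sameCycle (fun h' => hne (σ.injective h')) ?_
    exact Perm.SameCycle.symm ⟨1, by simp [hxy]⟩
  have h2 := permLength_mul_swap_le τ x y
  unfold NCLe at h
  refine ⟨nCLe_of_le (by omega), ?_⟩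
  refine sameCycle_mul_swap fun hs => ?_
  have h3 := permLength_mul_swap_of_sameCycle hne hs
  have h4 := permLength_mul_le (σ * (τ * swap x y)⁻¹) (τ * swap x y)
  rw [inv_mul_cancel_right, permLength_mul_inv_comm] at h4
  omega

/-- If `τ` fixes `x`, then `τ σ⁻¹` sends `σ x` to `x`. Passing from `σ` to `skip σ x` multiplies it
by that transposition and shortens it by one, exactly as much as `σ` itself is shortened. -/
theorem nCLe_skip_iff {σ τ : Perm X} {x : X} : NCLe τ (skip σ x) ↔ NCLe τ σ ∧ τ x = x := by
  refine ⟨fun h => ⟨h.trans (skip_nCLe σ x), h.apply_eq_self (skip_self σ x)⟩, ?_⟩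
  rintro ⟨h, hx⟩
  by_cases hσ : σ x = x
  · have : skip σ x = σ := by
      have : σ⁻¹ x = x := by rw [Perm.inv_eq_iff_eq, hσ]
      rw [skip, this, swap_self_eq_one, mul_one]
    rwa [this]
  have h1 := permLength_skip hσ
  have h2 : permLength (τ * (skip σ x)⁻¹) + 1 = permLength (τ * σ⁻¹) := by
    have e : τ * (skip σ x)⁻¹ = τ * σ⁻¹ * swap (σ x) x := by
      rw [skip, mul_inv_rev, swap_inv]
      have : swap (σ x) x = σ * swap x (σ⁻¹ x) * σ⁻¹ := by
        rw [← swap_apply_apply, perm_apply_inv]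
      rw [this]; group
    rw [e]
    exact permLength_mul_swap_of_sameCycle hσ ⟨1, by simp [hx]⟩
  unfold NCLe at h
  exact nCLe_of_le (by omega)

end NCLe

/-! ### Number of moved points against length. -/

section Support

variable {X : Type} [Fintype X] [DecidableEq X]

theorem support_skip_subset (σ : Perm X) (x : X) :
    σ.support ⊆ insert x (insert (σ⁻¹ x) (skip σ x).support) := by
  intro y hy
  simp only [Finset.mem_insert, Perm.mem_support] at *
  by_contra! h
  have h' := h.2.2
  rw [skip, Perm.mul_apply, swap_apply_of_ne_of_ne h.1 h.2.1] at h'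
  exact hy h'

/-- Skipping a moved point stops at most that point and its predecessor from being moved. This bound
is what makes the pigeonhole arguments for leaves and isolated elements work. -/
theorem card_support_le (σ : Perm X) : σ.support.card ≤ 2 * permLength σ := by
  induction σ using perm_skip_induction with
  | one => simp
  | step σ x hx ih =>
    have h1 := permLength_skip hx
    have h2 := Finset.card_le_card (support_skip_subset σ x)
    have h3 := Finset.card_insert_le x (insert (σ⁻¹ x) (skip σ x).support)
    have h4 := Finset.card_insert_le (σ⁻¹ x) (skip σ x).support
    omega

theorem permLength_lt_card_support {σ : Perm X} (h : σ ≠ 1) :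
    permLength σ < σ.support.card := by
  induction σ using perm_skip_induction with
  | one => exact absurd rfl h
  | step σ x hx ih =>
    have h1 := permLength_skip hx
    have h2 : (skip σ x).support ⊆ σ.support.erase x := by
      intro y hy
      rw [Perm.mem_support] at hy
      have hyx : y ≠ x := fun h' => hy (h' ▸ skip_self σ x)
      rw [Finset.mem_erase, Perm.mem_support]
      refine ⟨hyx, fun h' => hy ?_⟩
      rw [skip_apply _ _ _ hyx, h', if_neg hyx]
    have h3 := Finset.card_le_card h2
    rw [Finset.card_erase_of_mem (Perm.mem_support.2 hx)] at h3
    by_cases h1' : skip σ x = 1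
    · rw [h1', permLength_one] at h1
      have := Perm.two_le_card_support_of_ne_one h
      omega
    · have := ih h1'
      omega

end Support

end TensorFree

namespace TensorFree

set_option linter.unusedSectionVars false

/-! ### The Möbius function on non-crossing permutations. -/

section Moebius

/-- The value of the Moebius function of non-crossing partitions on a cycle of length `p`. -/
noncomputable def cycleMoebius (p : ℕ) : ℂ := (-1 : ℂ) ^ (p - 1) * (catalan (p - 1) : ℂ)

variable {X : Type} [Fintype X]

theorem moebiusNC_eq [DecidableEq X] (σ : Perm X) :
    moebiusNC σ = (σ.cycleType.map cycleMoebius).prod := by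
  unfold moebiusNC
  congr!

theorem moebiusNC_one : moebiusNC (1 : Perm X) = 1 := by
  classical
  simp [moebiusNC_eq]

theorem moebiusNC_inv (σ : Perm X) : moebiusNC σ⁻¹ = moebiusNC σ := by
  classical
  rw [moebiusNC_eq, moebiusNC_eq, Perm.cycleType_inv]

theorem moebiusNC_mul_of_disjoint {σ τ : Perm X} (h : σ.Disjoint τ) :
    moebiusNC (σ * τ) = moebiusNC σ * moebiusNC τ := by
  classical
  rw [moebiusNC_eq, moebiusNC_eq, moebiusNC_eq, h.cycleType_mul, Multiset.map_add,
    Multiset.prod_add]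

theorem moebiusNC_viaEmbedding {X' : Type} [Fintype X'] (σ : Perm X) (e : X ↪ X') :
    moebiusNC (σ.viaEmbedding e) = moebiusNC σ := by
  classical
  rw [moebiusNC_eq, moebiusNC_eq]
  congr 2
  rw [Perm.viaEmbedding]
  convert Perm.cycleType_extendDomain (Equiv.ofInjective e.1 e.2)

theorem moebiusNC_permCongr {X' : Type} [Fintype X'] (σ : Perm X) (e : X ≃ X') :
    moebiusNC (e.permCongr σ) = moebiusNC σ := by
  rw [← moebiusNC_viaEmbedding σ e.toEmbedding]
  congr 1
  ext x
  obtain ⟨y, rfl⟩ := e.surjective x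
  have := Perm.viaEmbedding_apply σ e.toEmbedding y
  rw [Equiv.coe_toEmbedding] at this
  rw [this]
  simp

theorem moebiusNC_sumCongr {X' : Type} [Fintype X'] (σ : Perm X) (τ : Perm X') :
    moebiusNC (Perm.sumCongr σ τ) = moebiusNC σ * moebiusNC τ := by
  have h1 : Perm.sumCongr σ τ = σ.viaEmbedding ⟨Sum.inl, Sum.inl_injective⟩ *
      τ.viaEmbedding ⟨Sum.inr, Sum.inr_injective⟩ := by
    ext x
    rcases x with x | x
    · rw [Perm.mul_apply, Perm.viaEmbedding_apply_of_notMem _ _ (Sum.inl x) (by simp)]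
      exact (Perm.viaEmbedding_apply σ ⟨Sum.inl, Sum.inl_injective⟩ x).symm
    · have := (Perm.viaEmbedding_apply τ (⟨Sum.inr, Sum.inr_injective⟩ : X' ↪ X ⊕ X') x)
      simp only [Function.Embedding.coeFn_mk] at this
      rw [Perm.mul_apply, this, Perm.viaEmbedding_apply_of_notMem _ _ _ (by simp)]
      rfl
  rw [h1, moebiusNC_mul_of_disjoint, moebiusNC_viaEmbedding, moebiusNC_viaEmbedding]
  intro x
  rcases x with x | x
  · exact Or.inr (Perm.viaEmbedding_apply_of_notMem _ _ _ (by simp))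
  · exact Or.inl (Perm.viaEmbedding_apply_of_notMem _ _ _ (by simp))

section Cycles

open scoped Classical in
/-- Removal of the cycle of a point. -/
noncomputable def peel (w : Perm X) (y : X) : Perm X := w * (w.cycleOf y)⁻¹

open scoped Classical in
theorem peel_apply (w : Perm X) (y z : X) :
    peel w y z = if w.SameCycle y z then z else w z := by
  rw [peel, Perm.mul_apply, Perm.cycleOf_inv, Perm.cycleOf_apply]
  simp only [Perm.sameCycle_inv]
  split_ifs
  · exact perm_apply_inv w z
  · rfl

/-- A finite sequence of distinct points that is a cycle of `w`. -/
structure IsOrbit (w : Perm X) (n : ℕ) (a : ℕ → X) : Prop where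
  pos : 0 < n
  inj : ∀ i k, i < n → k < n → a i = a k → i = k
  step : ∀ i, i + 1 < n → w (a i) = a (i + 1)
  last : w (a (n - 1)) = a 0

theorem IsOrbit.sameCycle_iff {w : Perm X} {n : ℕ} {a : ℕ → X} (h : IsOrbit w n a) (z : X) :
    w.SameCycle (a 0) z ↔ ∃ i < n, a i = z := by
  constructor
  · intro hz
    obtain ⟨m, rfl⟩ := hz.exists_nat_pow_eq
    clear hz
    induction m with
    | zero => exact ⟨0, h.pos, rfl⟩
    | succ m ih =>
      obtain ⟨i, hi, hz⟩ := ih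
      rw [pow_succ', Perm.mul_apply, ← hz]
      by_cases hi' : i + 1 < n
      · exact ⟨i + 1, hi', (h.step i hi').symm⟩
      · have : i = n - 1 := by omega
        subst this
        exact ⟨0, h.pos, h.last.symm⟩
  · rintro ⟨i, hi, rfl⟩
    induction i with
    | zero => exact Perm.SameCycle.refl _ _
    | succ i ih =>
      rw [← h.step i hi, Perm.sameCycle_apply_right]
      exact ih (by omega)

open scoped Classical in
-- Splits off the factor of an explicitly listed cycle. Fixed points are covered because the value
-- at length one is `1`.
theorem IsOrbit.moebiusNC_eq {w : Perm X} {n : ℕ} {a : ℕ → X} (h : IsOrbit w n a) :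
    moebiusNC w = moebiusNC (peel w (a 0)) * cycleMoebius n := by
  rw [peel]
  by_cases hfix : w (a 0) = a 0
  · have hn : n = 1 := by
      by_contra hn
      have := h.pos
      have h1 := h.step 0 (by omega)
      have := h.inj 1 0 (by omega) (by omega) (h1 ▸ hfix)
      omega
    rw [(Perm.cycleOf_eq_one_iff w).2 hfix, hn]
    simp [cycleMoebius]
  · have hmem := Perm.cycleOf_mem_cycleFactorsFinset_iff.2 (Perm.mem_support.2 hfix)
    have hd := Perm.disjoint_mul_inv_of_mem_cycleFactorsFinset hmem
    have h1 := moebiusNC_mul_of_disjoint hd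
    rw [inv_mul_cancel_right] at h1
    have h2 : (w.cycleOf (a 0)).support = (Finset.range n).image a := by
      ext z
      rw [Perm.mem_support_cycleOf_iff' hfix, h.sameCycle_iff]
      simp
    have h3 : moebiusNC (w.cycleOf (a 0)) = cycleMoebius n := by
      rw [TensorFree.moebiusNC_eq, (Perm.isCycle_cycleOf w hfix).cycleType, h2,
        Finset.card_image_of_injOn, Finset.card_range]
      · simp
      · intro i hi k hk
        exact h.inj i k (by simpa using hi) (by simpa using hk)
    rw [h1, h3]

theorem isCycle_pow_apply_eq_iff {c : Perm X} [DecidableEq X] (hc : c.IsCycle) {x : X}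
    (hx : c x ≠ x) {i k : ℕ} (hik : i ≤ k) :
    (c ^ i) x = (c ^ k) x ↔ c.support.card ∣ k - i := by
  have h1 : c ^ k = c ^ i * c ^ (k - i) := by rw [← pow_add]; congr 1; omega
  rw [h1, Perm.mul_apply, (c ^ i).injective.eq_iff, eq_comm, ← hc.pow_eq_one_iff' hx,
    ← orderOf_dvd_iff_pow_eq_one, hc.orderOf]

/-- With `p` the length of `c`, the transposition cuts the cycle into the arcs `c x, …, c^j x` and
`c^(j+1) x, …, c^p x = x`. Both are exhibited as orbits, and nothing is left once they are peeled
off. -/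
theorem moebiusNC_cycle_mul_swap [DecidableEq X] {c : Perm X} (hc : c.IsCycle) {x : X}
    (hx : c x ≠ x) {j : ℕ} (h0 : 0 < j) (hj : j < c.support.card) :
    moebiusNC (c * swap x ((c ^ j) x)) =
      cycleMoebius j * cycleMoebius (c.support.card - j) := by
  classical
  set p := c.support.card with hp
  have hpx : (c ^ p) x = x := by rw [hp, ← hc.orderOf, pow_orderOf_eq_one, Perm.one_apply]
  have hinj : ∀ i k, 1 ≤ i → i ≤ p → 1 ≤ k → k ≤ p → (c ^ i) x = (c ^ k) x → i = k := by
    have key : ∀ i k, 1 ≤ i → i ≤ k → k ≤ p → (c ^ i) x = (c ^ k) x → i = k := by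
      intro i k h1 hik hk h
      rw [isCycle_pow_apply_eq_iff hc hx hik] at h
      rcases Nat.eq_zero_or_pos (k - i) with h' | h'
      · omega
      · have := Nat.le_of_dvd h' h
        omega
    intro i k h1 h2 h3 h4 h
    rcases le_total i k with hik | hik
    · exact key i k h1 hik h4 h
    · exact (key k i h3 hik h2 h.symm).symm
  set w := c * swap x ((c ^ j) x) with hw
  have hstep : ∀ i, 1 ≤ i → i < p → i ≠ j → w ((c ^ i) x) = (c ^ (i + 1)) x := by
    intro i h1 h2 h3
    rw [hw, Perm.mul_apply, swap_apply_of_ne_of_ne, pow_succ', Perm.mul_apply]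
    · intro h
      rw [← hpx, ← Perm.mul_apply, ← pow_add] at h
      rw [pow_add, Perm.mul_apply, hpx] at h
      exact absurd (hinj i p h1 h2.le (by omega) le_rfl (h.trans hpx.symm)) (by omega)
    · intro h
      exact h3 (hinj i j h1 h2.le h0 hj.le h)
  have hwy : w ((c ^ j) x) = c x := by simp [hw]
  have hwx : w x = (c ^ (j + 1)) x := by
    rw [hw, Perm.mul_apply, swap_apply_left, pow_succ', Perm.mul_apply]
  have hA : IsOrbit w j (fun i => (c ^ (i + 1)) x) := by
    refine ⟨h0, fun i k hi hk h => ?_, fun i hi => ?_, ?_⟩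
    · have := hinj (i + 1) (k + 1) (by omega) (by omega) (by omega) (by omega) h
      omega
    · exact hstep (i + 1) (by omega) (by omega) (by omega)
    · have : j - 1 + 1 = j := by omega
      simp only [this, hwy]
      simp
  set w' := peel w ((c ^ (0 + 1)) x) with hw'
  have hw'_apply : ∀ i, j < i → i ≤ p → w' ((c ^ i) x) = w ((c ^ i) x) := by
    intro i h1 h2
    rw [hw', peel_apply, if_neg]
    intro h
    obtain ⟨k, hk, hki⟩ := (hA.sameCycle_iff _).1 h
    have := hinj (k + 1) i (by omega) (by omega) (by omega) h2 hki
    omega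
  have hB : IsOrbit w' (p - j) (fun i => (c ^ (j + 1 + i)) x) := by
    refine ⟨by omega, fun i k hi hk h => ?_, fun i hi => ?_, ?_⟩
    · have := hinj (j + 1 + i) (j + 1 + k) (by omega) (by omega) (by omega) (by omega) h
      omega
    · rw [hw'_apply _ (by omega) (by omega), hstep _ (by omega) (by omega) (by omega), add_assoc]
    · have : j + 1 + (p - j - 1) = p := by omega
      simp only [this]
      rw [hw'_apply _ (by omega) le_rfl, hpx, hwx, add_zero]
  have h1 := hA.moebiusNC_eq
  have h2 := hB.moebiusNC_eq
  have h3 : peel w' ((c ^ (j + 1 + 0)) x) = 1 := by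
    ext z
    rw [peel_apply, Perm.one_apply]
    split_ifs with hz
    · rfl
    · rw [hw', peel_apply]
      split_ifs with hz'
      · rfl
      · by_cases hcz : c z = z
        · rw [hw, Perm.mul_apply, swap_apply_of_ne_of_ne, hcz]
          · rintro rfl; exact hx hcz
          · rintro rfl
            refine hx ?_
            rwa [← Perm.mul_apply, ← pow_succ', pow_succ, Perm.mul_apply,
              (c ^ j).injective.eq_iff] at hcz
        · exfalso
          obtain ⟨m, rfl⟩ := (hc.sameCycle hx hcz).exists_nat_pow_eq
          have hper : (c ^ m) x = (c ^ (m % p)) x := by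
            rw [eq_comm, isCycle_pow_apply_eq_iff hc hx (Nat.mod_le m p)]
            exact Nat.dvd_sub_mod m
          have hlt := Nat.mod_lt m (show 0 < p by omega)
          rcases Nat.eq_zero_or_pos (m % p) with hm | hm
          · rw [hper, hm] at hz
            refine hz ((hB.sameCycle_iff _).2 ⟨p - j - 1, by omega, ?_⟩)
            have : j + 1 + (p - j - 1) = p := by omega
            simp only [this, hpx]; simp
          · rcases le_or_gt (m % p) j with hle | hgt
            · rw [hper] at hz'
              refine hz' ((hA.sameCycle_iff _).2 ⟨m % p - 1, by omega, ?_⟩)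
              have : m % p - 1 + 1 = m % p := by omega
              simp only [this]
            · rw [hper] at hz
              refine hz ((hB.sameCycle_iff _).2 ⟨m % p - (j + 1), by omega, ?_⟩)
              have : j + 1 + (m % p - (j + 1)) = m % p := by omega
              simp only [this]
  rw [h1, ← hw', h2, h3, moebiusNC_one, one_mul, mul_comm]

/-- The recurrence of the Catalan numbers: the products carry the sign `(-1)^(p-2)`, opposite to
that of the single cycle. -/
theorem sum_cycleMoebius {p : ℕ} (hp : 2 ≤ p) :
    cycleMoebius p + ∑ j ∈ Finset.Ico 1 p, cycleMoebius j * cycleMoebius (p - j) = 0 := by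
  obtain ⟨n, rfl⟩ : ∃ n, p = n + 2 := ⟨p - 2, by omega⟩
  have h1 : ∑ j ∈ Finset.Ico 1 (n + 2), cycleMoebius j * cycleMoebius (n + 2 - j) =
      (-1) ^ n * (catalan (n + 1) : ℂ) := by
    rw [Finset.sum_Ico_eq_sum_range, catalan_succ', Finset.Nat.sum_antidiagonal_eq_sum_range_succ
      (fun a b => catalan a * catalan b), Nat.cast_sum, Finset.mul_sum]
    refine Finset.sum_congr rfl fun i hi => ?_
    have hi : i ≤ n := by simpa [Nat.lt_succ_iff] using hi
    have e1 : 1 + i - 1 = i := by omega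
    have e2 : n + 2 - (1 + i) - 1 = n - i := by omega
    have e3 : (-1 : ℂ) ^ n = (-1) ^ i * (-1) ^ (n - i) := by rw [← pow_add]; congr 1; omega
    rw [cycleMoebius, cycleMoebius, e1, e2, e3]
    push_cast
    ring
  rw [h1, cycleMoebius]
  have : n + 2 - 1 = n + 1 := by omega
  rw [this, pow_succ]
  ring

open scoped Classical in
/-- The sum of the Moebius function over all ways to split the cycle of `x` is zero. -/
theorem sum_moebiusNC_mul_swap {σ : Perm X} {x : X} (hx : σ x ≠ x) :
    ∑ y : X with σ.SameCycle x y, moebiusNC (σ * swap x y) = 0 := by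
  set c := σ.cycleOf x with hc
  have hcyc : c.IsCycle := Perm.isCycle_cycleOf σ hx
  have hcx : c x ≠ x := by rw [hc, Perm.cycleOf_apply_self]; exact hx
  have hmem := Perm.cycleOf_mem_cycleFactorsFinset_iff.2 (Perm.mem_support.2 hx)
  have hd := Perm.disjoint_mul_inv_of_mem_cycleFactorsFinset hmem
  have hsupp : ∀ y, σ.SameCycle x y ↔ y ∈ c.support := fun y =>
    (Perm.mem_support_cycleOf_iff' hx).symm
  have h1 : ∀ y, σ.SameCycle x y →
      moebiusNC (σ * swap x y) = moebiusNC (σ * c⁻¹) * moebiusNC (c * swap x y) := by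
    intro y hy
    rw [← moebiusNC_mul_of_disjoint]
    · congr 1; group
    · intro z
      rcases hd z with h | h
      · exact Or.inl h
      · right
        have hz : z ∉ c.support := by simpa using h
        rw [Perm.mul_apply, swap_apply_of_ne_of_ne]
        · exact h
        · rintro rfl; exact hz ((hsupp z).1 (Perm.SameCycle.refl σ z))
        · rintro rfl; exact hz ((hsupp z).1 hy)
  rw [Finset.sum_congr rfl fun y hy => h1 y (by simpa using hy), ← Finset.mul_sum]
  convert mul_zero _
  set p := c.support.card with hp
  have hp2 : 2 ≤ p := hcyc.two_le_card_support
  have h2 : ({y : X | σ.SameCycle x y} : Finset X) =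
      (Finset.range p).image fun j => (c ^ j) x := by
    ext y
    simp only [Finset.mem_filter, Finset.mem_univ, true_and, Finset.mem_image, Finset.mem_range]
    constructor
    · intro hy
      obtain ⟨m, hm⟩ := (hcyc.sameCycle hcx (Perm.mem_support.1 ((hsupp y).1 hy))).exists_nat_pow_eq
      refine ⟨m % p, Nat.mod_lt m (by omega), ?_⟩
      rw [← hm, isCycle_pow_apply_eq_iff hcyc hcx (Nat.mod_le m p)]
      exact Nat.dvd_sub_mod m
    · rintro ⟨j, _, rfl⟩
      rw [hsupp, Perm.pow_apply_mem_support, Perm.mem_support]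
      exact hcx
  -- The index `j = 0`, that is `y = x`, leaves the cycle whole and gives the isolated term of the
  -- recurrence.
  rw [h2, Finset.sum_image, Finset.range_eq_Ico, Finset.sum_eq_sum_Ico_succ_bot (by omega)]
  · rw [← sum_cycleMoebius hp2]
    congr 1
    · rw [pow_zero, Perm.one_apply, swap_self_eq_one, mul_one, moebiusNC_eq, hcyc.cycleType]
      simp [hp]
    · refine Finset.sum_congr rfl fun j hj => ?_
      rw [Finset.mem_Ico] at hj
      exact moebiusNC_cycle_mul_swap hcyc hcx (by omega) (by omega)
  · intro i hi k hk h
    simp only [Finset.coe_range, Set.mem_Iio] at hi hk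
    rcases le_total i k with hik | hik
    · rw [isCycle_pow_apply_eq_iff hcyc hcx hik] at h
      rcases Nat.eq_zero_or_pos (k - i) with h' | h'
      · omega
      · have := Nat.le_of_dvd h' h; omega
    · rw [eq_comm, isCycle_pow_apply_eq_iff hcyc hcx hik] at h
      rcases Nat.eq_zero_or_pos (i - k) with h' | h'
      · omega
      · have := Nat.le_of_dvd h' h; omega

end Cycles

open scoped Classical in
-- Choose `x` moved by `σ`. Each `τ` below `σ` is uniquely `ρ * swap x y` with `ρ` below `σ`, `ρ x =
-- σ x`, and `y` in the `ρ`-cycle of `x`. For fixed `ρ` the sum over `y` is zero by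
-- `sum_moebiusNC_mul_swap`.
theorem sum_moebiusNC (σ : Perm X) :
    ∑ τ : Perm X with NCLe τ σ, moebiusNC τ = if σ = 1 then 1 else 0 := by
  split_ifs with h
  · subst h
    rw [Finset.sum_eq_single 1]
    · exact moebiusNC_one
    · intro τ hτ hne
      have h1 := NCLe.length_lt (by simpa using hτ : NCLe τ 1) hne
      rw [permLength_one] at h1
      omega
    · intro h1
      exact absurd (by simpa using NCLe.refl 1) h1
  · obtain ⟨x, hx⟩ : ∃ x, σ x ≠ x := by
      by_contra! h'; exact h (Equiv.ext h')
    have key : ∑ τ : Perm X with NCLe τ σ, moebiusNC τ =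
        ∑ q ∈ ({ρ : Perm X | NCLe ρ σ ∧ ρ x = σ x} : Finset (Perm X)).sigma
          (fun ρ => ({y : X | ρ.SameCycle x y} : Finset X)), moebiusNC (q.1 * swap x q.2) := by
      refine Finset.sum_bij' (fun τ _ => ⟨τ * swap x (τ⁻¹ (σ x)), τ⁻¹ (σ x)⟩)
        (fun q _ => q.1 * swap x q.2) ?_ ?_ ?_ ?_ ?_
      · intro τ hτ
        have hτ : NCLe τ σ := by simpa using hτ
        have h1 := hτ.mul_swap (perm_apply_inv τ (σ x))
        simp only [Finset.mem_sigma, Finset.mem_filter, Finset.mem_univ, true_and]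
        refine ⟨⟨h1.1, ?_⟩, h1.2⟩
        rw [Perm.mul_apply, swap_apply_left, perm_apply_inv]
      · rintro ⟨ρ, y⟩ hq
        simp only [Finset.mem_sigma, Finset.mem_filter, Finset.mem_univ, true_and] at hq ⊢
        exact (mul_swap_nCLe hq.2).trans hq.1.1
      · intro τ _
        rw [mul_assoc, swap_mul_self, mul_one]
      · rintro ⟨ρ, y⟩ hq
        simp only [Finset.mem_sigma, Finset.mem_filter, Finset.mem_univ, true_and] at hq
        have h1 : (ρ * swap x y)⁻¹ (σ x) = y := by
          rw [Perm.inv_eq_iff_eq, Perm.mul_apply, swap_apply_right, hq.1.2]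
        simp only [h1, mul_assoc, swap_mul_self, mul_one]
      · intro τ _
        rw [mul_assoc, swap_mul_self, mul_one]
    rw [key, Finset.sum_sigma]
    refine Finset.sum_eq_zero fun ρ hρ => ?_
    simp only [Finset.mem_filter, Finset.mem_univ, true_and] at hρ
    exact sum_moebiusNC_mul_swap (by rw [hρ.2]; exact hx)

open scoped Classical in
/-- If the sum of the Moebius function over the permutations below `σ` that fix `E` pointwise does
not vanish, then every labelling that `σ` preserves on `E` is preserved by `σ`. -/
theorem label_eq_of_sum_moebiusNC_ne_zero {α : Type*} (a : X → α) (E : Finset X) (σ : Perm X)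
    (hE : ∀ x ∈ E, a (σ x) = a x)
    (h : ∑ τ : Perm X with NCLe τ σ ∧ ∀ x ∈ E, τ x = x, moebiusNC τ ≠ 0) (x : X) :
    a (σ x) = a x := by
  induction E using Finset.induction_on generalizing σ x with
  | empty =>
    simp only [Finset.notMem_empty, false_imp_iff, implies_true, and_true] at h
    rw [sum_moebiusNC] at h
    have : σ = 1 := by by_contra h'; exact h (if_neg h')
    rw [this, Perm.one_apply]
  | insert y E hy ih =>
    -- The permutations below `σ` that fix `y` are those below `skip σ y`, so `y` can be dropped
    -- from the constraints. Labels on `E` are still preserved, since skipping `y` bridges two steps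
    -- that preserve them.
    have key : ∀ z, a (skip σ y z) = a z := by
      refine ih (skip σ y) (fun z hz => ?_) ?_
      · have hzy : z ≠ y := fun h' => hy (h' ▸ hz)
        rw [skip_apply _ _ _ hzy]
        have h1 := hE z (Finset.mem_insert_of_mem hz)
        split_ifs with h2
        · rw [hE y (Finset.mem_insert_self y E), ← h2, h1]
        · exact h1
      · simp only [nCLe_skip_iff, and_assoc]
        simpa only [Finset.forall_mem_insert] using h
    have hy' := hE y (Finset.mem_insert_self y E)
    rcases eq_or_ne x y with rfl | hxy
    · exact hy'
    have h1 := key x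
    rw [skip_apply _ _ _ hxy] at h1
    split_ifs at h1 with h2
    · rw [h2, ← h1, hy']
    · exact h1

end Moebius

end TensorFree

namespace TensorFree

set_option linter.unusedSectionVars false

/-! ### Length under embeddings and disjoint sums. -/

section Transport

variable {X X' : Type} [Finite X] [Finite X']

theorem skip_eq_of_forall [DecidableEq X] {σ τ : Perm X} {x : X} (h0 : τ x = x)
    (h : ∀ y, y ≠ x → τ y = if σ y = x then σ x else σ y) : τ = skip σ x := by
  ext y
  rcases eq_or_ne y x with rfl | hy
  · rw [h0, skip_self]
  · rw [h y hy, skip_apply _ _ _ hy]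

theorem permLength_viaEmbedding (σ : Perm X) (e : X ↪ X') :
    permLength (σ.viaEmbedding e) = permLength σ := by
  classical
  induction σ using perm_skip_induction with
  | one =>
    have : (1 : Perm X).viaEmbedding e = 1 := map_one (Perm.viaEmbeddingHom e)
    rw [this, permLength_one, permLength_one]
  | step σ x hx ih =>
    have h1 : (skip σ x).viaEmbedding e = skip (σ.viaEmbedding e) (e x) := by
      refine skip_eq_of_forall ?_ fun y hy => ?_
      · rw [Perm.viaEmbedding_apply, skip_self]
      · by_cases hr : y ∈ Set.range e
        · obtain ⟨z, rfl⟩ := hr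
          have hz : z ≠ x := fun h => hy (h ▸ rfl)
          simp only [Perm.viaEmbedding_apply, skip_apply _ _ _ hz, e.injective.eq_iff]
          split_ifs <;> rfl
        · rw [Perm.viaEmbedding_apply_of_notMem _ _ _ hr, Perm.viaEmbedding_apply_of_notMem _ _ _ hr,
            if_neg hy]
    rw [← permLength_skip hx, ← ih, h1, permLength_skip]
    rw [Perm.viaEmbedding_apply]
    exact fun h => hx (e.injective h)

theorem permLength_sumCongr (σ : Perm X) (τ : Perm X') :
    permLength (Perm.sumCongr σ τ) = permLength σ + permLength τ := by
  classical
  induction σ using perm_skip_induction with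
  | one =>
    rw [permLength_one, zero_add, ← permLength_viaEmbedding τ (⟨Sum.inr, Sum.inr_injective⟩ : X' ↪ X ⊕ X')]
    congr 1
    ext x
    rcases x with x | x
    · rw [Perm.viaEmbedding_apply_of_notMem _ _ _ (by simp)]; rfl
    · exact (Perm.viaEmbedding_apply τ (⟨Sum.inr, Sum.inr_injective⟩ : X' ↪ X ⊕ X') x).symm
  | step σ x hx ih =>
    have h1 : Perm.sumCongr (skip σ x) τ = skip (Perm.sumCongr σ τ) (Sum.inl x) := by
      refine skip_eq_of_forall ?_ fun y hy => ?_
      · simp [skip_self]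
      · rcases y with y | y
        · have hy : y ≠ x := fun h => hy (h ▸ rfl)
          simp only [Perm.sumCongr_apply, Sum.map_inl, skip_apply _ _ _ hy, Sum.inl.injEq]
          split_ifs <;> rfl
        · simp
    rw [← permLength_skip hx, add_right_comm, ← ih, h1, permLength_skip]
    simpa using hx

theorem exists_viaEmbedding_eq (e : X ↪ X') (w : Perm X') (h : ∀ y, y ∉ Set.range e → w y = y) :
    ∃ σ : Perm X, σ.viaEmbedding e = w := by
  have hr : ∀ x, w (e x) ∈ Set.range e := by
    intro x
    by_contra hx
    exact hx ⟨x, (w.injective (h _ hx)).symm⟩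
  choose s hs using hr
  have hinj : Function.Injective s := fun x y hxy => by
    have := hs x
    rw [hxy, hs y] at this
    exact (e.injective (w.injective this)).symm
  refine ⟨Equiv.ofBijective s (Finite.injective_iff_bijective.1 hinj), ?_⟩
  ext y
  by_cases hy : y ∈ Set.range e
  · obtain ⟨x, rfl⟩ := hy
    rw [Perm.viaEmbedding_apply, ← hs x]
    rfl
  · rw [Perm.viaEmbedding_apply_of_notMem _ _ _ hy, h y hy]

end Transport

/-! ### The counting inequality and forests. -/

section Graphs

variable {D : ℕ} {ι : Type} {k : ι → Deg D}

theorem conn_apply (g : Graph k) (c : Fin D) (x : Σ i, Fin (k i c)) : conn g x.1 (g c x).1 :=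
  Relation.EqvGen.rel _ _ ⟨c, x.2, (g c x).2, rfl⟩

theorem conn_map_eq {β : Type*} {g : Graph k} (φ : ι → β) (h : ∀ c x, φ (g c x).1 = φ x.1)
    {i j : ι} (hij : conn g i j) : φ i = φ j := by
  induction hij with
  | rel i j hij =>
    obtain ⟨c, r, s, hg⟩ := hij
    have := h c ⟨i, r⟩
    rw [hg] at this
    exact this.symm
  | refl => rfl
  | symm _ _ _ ih => exact ih.symm
  | trans _ _ _ _ _ ih1 ih2 => exact ih1.trans ih2

theorem conn_mono {ι' : Type} {k' : ι' → Deg D} {g : Graph k} {g' : Graph k'} (e : ι → ι')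
    (h : ∀ c x, conn g' (e x.1) (e (g c x).1)) {i j : ι} (hij : conn g i j) :
    conn g' (e i) (e j) :=
  Quotient.exact (conn_map_eq (fun i => Quotient.mk (conn g') (e i))
    (fun c x => (Quotient.sound (h c x)).symm) hij)

theorem conn_of_sameCycle {g : Graph k} {c : Fin D} {x y : Σ i, Fin (k i c)}
    (h : (g c).SameCycle x y) : conn g x.1 y.1 :=
  Quotient.exact (SameCycle.map_eq (fun z => Quotient.mk (conn g) z.1)
    (fun z => (Quotient.sound (conn_apply g c z)).symm) h)

/-- The total length of the permutations of a graph. -/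
noncomputable def graphLength (g : Graph k) : ℕ := ∑ c, permLength (g c)

/-- The number of connected components. -/
noncomputable def numComp (g : Graph k) : ℕ := Nat.card (Quotient (conn g))

/-- The order on graphs that refine each other on every cycle. -/
def GraphLe (f g : Graph k) : Prop := ∀ c, NCLe (f c) (g c)

/-- A graph whose components are melonic, characterized by counting. -/
def IsForest (g : Graph k) : Prop := numComp g + graphLength g = Nat.card ι

/-- Counting characterization of connected melonic graphs. -/
structure IsTreeLike (g : Graph k) : Prop where
  nonempty : Nonempty ι
  conn : ∀ i j, conn g i j
  length : graphLength g + 1 = Nat.card ι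

theorem IsTreeLike.finite {g : Graph k} (h : IsTreeLike g) : Finite ι :=
  Nat.finite_of_card_ne_zero (by rw [← h.length]; omega)

variable [Finite ι]

theorem GraphLe.conn {f g : Graph k} (h : GraphLe f g) {i j : ι} (hij : conn f i j) :
    conn g i j :=
  conn_mono id (fun c x => conn_of_sameCycle ((h c).sameCycle
    (Perm.sameCycle_apply_right.2 (Perm.SameCycle.refl (f c) x)))) hij

theorem GraphLe.trans {e f g : Graph k} (h1 : GraphLe e f) (h2 : GraphLe f g) : GraphLe e g :=
  fun c => (h1 c).trans (h2 c)

theorem GraphLe.refl (g : Graph k) : GraphLe g g := fun c => NCLe.refl (g c)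

theorem graphLength_eq_zero {g : Graph k} : graphLength g = 0 ↔ g = fun _ => 1 := by
  simp only [graphLength, Finset.sum_eq_zero_iff, Finset.mem_univ, true_imp_iff,
    permLength_eq_zero, funext_iff]

theorem GraphLe.length_add {f g : Graph k} (h : GraphLe f g) :
    graphLength f + graphLength (fun c => f c * (g c)⁻¹) = graphLength g := by
  rw [graphLength, graphLength, ← Finset.sum_add_distrib]
  exact Finset.sum_congr rfl fun c _ => h c

theorem GraphLe.length_lt {f g : Graph k} (h : GraphLe f g) (hne : f ≠ g) :
    graphLength f < graphLength g := by
  have h1 := h.length_add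
  have h2 : graphLength (fun c => f c * (g c)⁻¹) ≠ 0 := fun h0 => hne (funext fun c =>
    mul_inv_eq_one.1 (congrFun (graphLength_eq_zero.1 h0) c))
  omega

/-- Identifying the components of `x.1` and `y.1` in `f` gives an invariant of `f'`. One extra
value, the class of `x.1`, then recovers all components of `f`. -/
theorem numComp_le_of_swap [∀ c, DecidableEq (Σ i, Fin (k i c))] {f f' : Graph k} (c : Fin D)
    (x y : Σ i, Fin (k i c)) (hc : f' c = f c * swap x y) (h : ∀ c', c' ≠ c → f' c' = f c') :
    numComp f ≤ numComp f' + 1 := by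
  classical
  let φ : ι → Quotient (conn f) := fun a =>
    if conn f a x.1 then Quotient.mk _ y.1 else Quotient.mk _ a
  have hf : ∀ c z, φ (f c z).1 = φ z.1 := by
    intro c z
    have hz := conn_apply f c z
    by_cases h1 : conn f z.1 x.1
    · have h2 : conn f (f c z).1 x.1 := ((conn f).symm hz).trans _ _ _ h1
      simp only [φ, if_pos h1, if_pos h2]
    · have h2 : ¬ conn f (f c z).1 x.1 := fun h2 => h1 (hz.trans _ _ _ h2)
      simp only [φ, if_neg h1, if_neg h2]
      exact (Quotient.sound hz).symm
  have hxy : φ x.1 = φ y.1 := by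
    simp only [φ, if_pos ((conn f).refl x.1)]
    split_ifs <;> rfl
  have hf' : ∀ c z, φ (f' c z).1 = φ z.1 := by
    intro c' z
    rcases eq_or_ne c' c with rfl | hcc
    · rw [hc, Perm.mul_apply, hf]
      rcases eq_or_ne z x with rfl | hx
      · rw [swap_apply_left, hxy]
      rcases eq_or_ne z y with rfl | hy
      · rw [swap_apply_right, hxy]
      rw [swap_apply_of_ne_of_ne hx hy]
    · rw [h c' hcc, hf]
  let F : Option (Quotient (conn f')) → Quotient (conn f) := fun q =>
    q.elim (Quotient.mk _ x.1) (Quotient.lift φ fun a b hab => conn_map_eq φ hf' hab)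
  have hF : Function.Surjective F := by
    intro q
    induction q using Quotient.inductionOn with | _ a
    by_cases ha : conn f a x.1
    · exact ⟨none, Quotient.sound ((conn f).symm ha)⟩
    · exact ⟨some (Quotient.mk _ a), by simp only [F, Option.elim, Quotient.lift_mk, φ, if_neg ha]⟩
  have := Nat.card_le_card_of_surjective F hF
  rwa [Finite.card_option] at this

theorem graphLength_update [DecidableEq (Fin D)] (g : Graph k) (c : Fin D)
    (σ : Perm (Σ i, Fin (k i c))) :
    graphLength (Function.update g c σ) + permLength (g c) = graphLength g + permLength σ := by
  rw [graphLength, graphLength, ← Finset.add_sum_erase _ _ (Finset.mem_univ c),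
    ← Finset.add_sum_erase Finset.univ _ (Finset.mem_univ c), Function.update_self]
  have : ∑ c' ∈ Finset.univ.erase c, permLength (Function.update g c σ c') =
      ∑ c' ∈ Finset.univ.erase c, permLength (g c') :=
    Finset.sum_congr rfl fun c' hc' => by
      rw [Function.update_of_ne (Finset.ne_of_mem_erase hc')]
  omega

/-- Walk from `f` to `g` by transpositions along a shortest path in each colour; each step loses at
most one component. -/
theorem numComp_le (f g : Graph k) :
    numComp f ≤ numComp g + graphLength (fun c => f c * (g c)⁻¹) := by
  classical
  induction hn : graphLength (fun c => f c * (g c)⁻¹) generalizing f with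
  | zero =>
    have : f = g := funext fun c => mul_inv_eq_one.1 (congrFun (graphLength_eq_zero.1 hn) c)
    rw [this]; omega
  | succ n ih =>
    obtain ⟨c, x, hx⟩ : ∃ c x, (f c * (g c)⁻¹) x ≠ x := by
      by_contra! h
      have : (fun c => f c * (g c)⁻¹) = fun _ => 1 := funext fun c => Equiv.ext (h c)
      rw [graphLength_eq_zero.2 this] at hn
      omega
    have hlen := permLength_skip hx
    set w := f c * (g c)⁻¹ with hw
    let f' : Graph k := Function.update f c (skip w x * g c)
    have h1 : numComp f ≤ numComp f' + 1 := by
      refine numComp_le_of_swap c ((g c)⁻¹ x) ((g c)⁻¹ (w⁻¹ x)) ?_ fun c' hc' => ?_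
      · simp only [f', Function.update_self]
        rw [swap_apply_apply, skip, hw]; group
      · simp only [f', Function.update_of_ne hc']
    have h2 : (fun c => f' c * (g c)⁻¹) =
        Function.update (fun c => f c * (g c)⁻¹) c (skip w x) := by
      funext c'
      rcases eq_or_ne c' c with rfl | hc'
      · simp only [f', Function.update_self, mul_inv_cancel_right]
      · simp only [f', Function.update_of_ne hc']
    have h3 := graphLength_update (fun c => f c * (g c)⁻¹) c (skip w x)
    rw [← h2] at h3
    simp only [← hw] at h3 hn
    have h4 := ih f' (by omega)
    omega

theorem numComp_one : numComp (fun _ => 1 : Graph k) = Nat.card ι := by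
  refine (Nat.card_congr (Equiv.ofBijective (fun i => Quotient.mk _ i)
    ⟨fun i j hij => ?_, Quotient.mk_surjective⟩)).symm
  exact conn_map_eq id (fun _ _ => rfl) (Quotient.exact hij)

/-- The comparison with the graph without edges between distinct pairs; `IsForest` is the case of
equality. -/
theorem card_le_numComp_add (g : Graph k) : Nat.card ι ≤ numComp g + graphLength g := by
  have h := numComp_le (fun _ => 1) g
  rw [numComp_one] at h
  have : graphLength (fun c => 1 * (g c)⁻¹) = graphLength g :=
    Finset.sum_congr rfl fun c _ => by simp only [one_mul, permLength_inv]
  rwa [this] at h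

/-- On a geodesic from the identity through `f` to `g`, the total loss of components equals the
total length only if this is already true up to `f`. -/
theorem IsForest.of_le {f g : Graph k} (hg : IsForest g) (h : GraphLe f g) : IsForest f := by
  have h1 := numComp_le f g
  have h2 := h.length_add
  have h3 := card_le_numComp_add f
  unfold IsForest at *
  omega

theorem numComp_eq_one [Nonempty ι] {g : Graph k} (h : ∀ i j, conn g i j) : numComp g = 1 := by
  rw [numComp, Nat.card_eq_one_iff_unique]
  exact ⟨⟨fun a b => Quotient.inductionOn₂ a b fun i j => Quotient.sound (h i j)⟩,
    ⟨Quotient.mk _ (Classical.arbitrary ι)⟩⟩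

theorem IsTreeLike.isForest {g : Graph k} (h : IsTreeLike g) : IsForest g := by
  have := h.nonempty
  have h1 := numComp_eq_one h.conn
  have h2 := h.length
  unfold IsForest
  omega

theorem IsForest.isTreeLike [Nonempty ι] {g : Graph k} (h : IsForest g) (hc : ∀ i j, TensorFree.conn g i j) :
    IsTreeLike g := by
  have h1 := numComp_eq_one hc
  unfold IsForest at h
  exact ⟨inferInstance, hc, by omega⟩

/-- In a forest, an element meets a cycle at most once. -/
theorem IsForest.eq_of_sameCycle {g : Graph k} (hg : IsForest g) {c : Fin D}
    {x y : Σ i, Fin (k i c)} (h : (g c).SameCycle x y) (hxy : x.1 = y.1) : x = y := by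
  classical
  by_contra hne
  have h1 := permLength_mul_swap_of_sameCycle hne h
  have h2 := graphLength_update g c (g c * swap x y)
  have h3 := card_le_numComp_add (Function.update g c (g c * swap x y))
  -- Splitting the cycle between two pairs of the same element creates no new component, since that
  -- element still ties both parts together. The length drops by one, against the counting
  -- inequality.
  have h4 : numComp (Function.update g c (g c * swap x y)) ≤ numComp g := by
    refine Nat.card_le_card_of_surjective (Quotient.map' id fun i j hij => ?_) ?_
    · refine conn_mono id (fun c' z => ?_) hij
      rcases eq_or_ne c' c with rfl | hc'
      · have hz : z.1 = (swap x y z).1 := by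
          rcases eq_or_ne z x with rfl | hx
          · rw [swap_apply_left, hxy]
          rcases eq_or_ne z y with rfl | hy
          · rw [swap_apply_right, hxy]
          rw [swap_apply_of_ne_of_ne hx hy]
        have h5 := conn_apply (Function.update g c' (g c' * swap x y)) c' (swap x y z)
        have h6 : Function.update g c' (g c' * swap x y) c' (swap x y z) = g c' z := by
          rw [Function.update_self, ← Perm.mul_apply, mul_assoc, swap_mul_self, mul_one]
        rwa [h6, ← hz] at h5
      · have h5 := conn_apply (Function.update g c (g c * swap x y)) c' z
        have h6 : Function.update g c (g c * swap x y) c' = g c' := Function.update_of_ne hc' _ _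
        rwa [h6] at h5
    · rintro ⟨i⟩
      exact ⟨Quotient.mk _ i, rfl⟩
  unfold IsForest at hg
  omega

end Graphs

end TensorFree

namespace TensorFree

set_option linter.unusedSectionVars false

/-! ### Relabelled subgraphs. -/

section Copies

variable {D : ℕ} {ι ι' : Type} {k : ι → Deg D}

/-- The map on pairs that a map on elements induces. -/
def pairMap (e : ι' → ι) {c : Fin D} (x : Σ i : ι', Fin (k (e i) c)) : Σ i : ι, Fin (k i c) :=
  ⟨e x.1, x.2⟩

theorem pairMap_injective {e : ι' → ι} (he : Function.Injective e) (c : Fin D) :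
    Function.Injective (pairMap (k := k) e (c := c)) := by
  rintro ⟨i, r⟩ ⟨j, s⟩ h
  simp only [pairMap, Sigma.mk.injEq] at h
  obtain ⟨h1, h2⟩ := h
  obtain rfl := he h1
  rw [eq_of_heq h2]

theorem mem_range_pairMap {e : ι' → ι} {c : Fin D} {x : Σ i : ι, Fin (k i c)} :
    x ∈ Set.range (pairMap (k := k) e (c := c)) ↔ x.1 ∈ Set.range e := by
  constructor
  · rintro ⟨y, rfl⟩
    exact ⟨y.1, rfl⟩
  · obtain ⟨i, r⟩ := x
    rintro ⟨j, rfl⟩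
    exact ⟨⟨j, r⟩, rfl⟩

theorem pairMap_bijective {e : ι' → ι} (he : Function.Bijective e) (c : Fin D) :
    Function.Bijective (pairMap (k := k) e (c := c)) :=
  ⟨pairMap_injective he.1 c, fun x => mem_range_pairMap.2 (he.2 x.1)⟩

/-- The graph `f'` is a copy of the part of `f` that consists of the elements `e i`. -/
def IsCopy (e : ι' → ι) (f' : Graph fun i => k (e i)) (f : Graph k) : Prop :=
  ∀ c x, f c (pairMap e x) = pairMap e (f' c x)

theorem IsCopy.comp {ι'' : Type} {e : ι' → ι} {e' : ι'' → ι'} {f'' : Graph fun i => k (e (e' i))}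
    {f' : Graph fun i => k (e i)} {f : Graph k} (h : IsCopy (k := k) e f' f)
    (h' : IsCopy (k := fun i => k (e i)) e' f'' f') :
    IsCopy (k := k) (fun i => e (e' i)) f'' f := fun c x =>
  (h c (pairMap (k := fun i => k (e i)) e' x)).trans (congrArg (pairMap e) (h' c x))

theorem IsCopy.of_comp {ι'' : Type} {e : ι' → ι} (he : Function.Injective e) {e' : ι'' → ι'}
    {f'' : Graph fun i => k (e (e' i))}
    {f' : Graph fun i => k (e i)} {f : Graph k} (h : IsCopy (k := k) e f' f)
    (h'' : IsCopy (k := k) (fun i => e (e' i)) f'' f) :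
    IsCopy (k := fun i => k (e i)) e' f'' f' := fun c x =>
  pairMap_injective he c ((h c (pairMap (k := fun i => k (e i)) e' x)).symm.trans (h'' c x))

theorem IsCopy.fst_mem_range {e : ι' → ι}
    {f' : Graph fun i => k (e i)} {f : Graph k} (h : IsCopy (k := k) e f' f) (c : Fin D)
    (x : Σ i, Fin (k i c)) : (f c x).1 ∈ Set.range e ↔ x.1 ∈ Set.range e := by
  rw [← mem_range_pairMap, ← mem_range_pairMap]
  constructor
  · rintro ⟨y, hy⟩
    obtain ⟨z, rfl⟩ := (f' c).surjective y
    exact ⟨z, (f c).injective ((h c z).trans hy)⟩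
  · rintro ⟨y, rfl⟩
    exact ⟨f' c y, (h c y).symm⟩

theorem IsCopy.conn_iff {e : ι' → ι} (he : Function.Injective e)
    {f' : Graph fun i => k (e i)} {f : Graph k} (h : IsCopy (k := k) e f' f) {i j : ι'} :
    conn f' i j ↔ conn f (e i) (e j) := by
  classical
  constructor
  · refine conn_mono e fun c x => ?_
    have := conn_apply f c (pairMap e x)
    rwa [h c x] at this
  · intro hij
    let φ : ι → Option (Quotient (conn f')) := fun i =>
      if hi : i ∈ Set.range e then some (Quotient.mk _ hi.choose) else none
    have hφ : ∀ i, φ (e i) = some (Quotient.mk _ i) := fun i => by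
      have hi : e i ∈ Set.range e := ⟨i, rfl⟩
      simp only [φ, dif_pos hi]
      rw [he hi.choose_spec]
    have h1 : φ (e i) = φ (e j) := by
      refine conn_map_eq φ (fun c x => ?_) hij
      by_cases hx : x.1 ∈ Set.range e
      · obtain ⟨y, rfl⟩ := mem_range_pairMap.2 hx
        rw [h c y]
        change φ (e _) = φ (e _)
        rw [hφ, hφ]
        exact congrArg some (Quotient.sound (conn_apply f' c y)).symm
      · have hx' := mt (h.fst_mem_range c x).1 hx
        simp only [φ, dif_neg hx, dif_neg hx']
    rw [hφ, hφ] at h1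
    exact Quotient.exact (Option.some_injective _ h1)

theorem IsCopy.eq_viaEmbedding {e : ι' → ι} (he : Function.Injective e)
    {f' : Graph fun i => k (e i)} {f : Graph k} (h : IsCopy (k := k) e f' f)
    (hfix : ∀ c x, x.1 ∉ Set.range e → f c x = x) (c : Fin D) :
    f c = (f' c).viaEmbedding ⟨pairMap (k := k) e, pairMap_injective he c⟩ := by
  ext1 x
  by_cases hx : x.1 ∈ Set.range e
  · obtain ⟨y, rfl⟩ := mem_range_pairMap.2 hx
    rw [h c y]
    exact (Perm.viaEmbedding_apply (f' c) ⟨pairMap (k := k) e, pairMap_injective he c⟩ y).symm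
  · rw [hfix c x hx, Perm.viaEmbedding_apply_of_notMem]
    exact fun hx' => hx (mem_range_pairMap.1 hx')

theorem IsCopy.graphLength_eq [Finite ι] {e : ι' → ι} (he : Function.Injective e)
    {f' : Graph fun i => k (e i)} {f : Graph k} (h : IsCopy (k := k) e f' f)
    (hfix : ∀ c x, x.1 ∉ Set.range e → f c x = x) : graphLength f' = graphLength f := by
  have := Finite.of_injective e he
  refine Finset.sum_congr rfl fun c _ => ?_
  rw [h.eq_viaEmbedding he hfix c, permLength_viaEmbedding]

theorem IsCopy.isTreeLike_iff {e : ι' → ι} (he : Function.Bijective e)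
    {f' : Graph fun i => k (e i)} {f : Graph k} (h : IsCopy (k := k) e f' f) :
    IsTreeLike f' ↔ IsTreeLike f := by
  have hcard := Nat.card_congr (Equiv.ofBijective e he)
  have hfix : ∀ c x, x.1 ∉ Set.range e → f c x = x := fun c x hx => absurd (he.2 x.1) hx
  constructor
  · intro hf
    have := hf.finite
    have : Finite ι := Finite.of_surjective e he.2
    refine ⟨hf.nonempty.map e, fun i j => ?_, ?_⟩
    · obtain ⟨i, rfl⟩ := he.2 i
      obtain ⟨j, rfl⟩ := he.2 j
      exact (h.conn_iff he.1).1 (hf.conn i j)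
    · rw [← h.graphLength_eq he.1 hfix, ← hcard, hf.length]
  · intro hf
    have := hf.finite
    have : Finite ι' := Finite.of_injective e he.1
    refine ⟨hf.nonempty.map (Equiv.ofBijective e he).symm,
      fun i j => (h.conn_iff he.1).2 (hf.conn _ _), ?_⟩
    rw [h.graphLength_eq he.1 hfix, hcard, hf.length]

/-- The part of a graph consisting of a set of elements that is a union of components. -/
def restrict (g : Graph k) (p : ι → Prop) (hp : ∀ c x, p (g c x).1 ↔ p x.1) :
    Graph fun i : {i // p i} => k i.1 :=
  fun c => (Equiv.subtypeSigmaEquiv (fun i => Fin (k i c)) p).permCongr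
    ((g c).subtypePerm (hp c))

theorem isCopy_restrict (g : Graph k) (p : ι → Prop) (hp : ∀ c x, p (g c x).1 ↔ p x.1) :
    IsCopy (k := k) Subtype.val (restrict g p hp) g := fun _ _ => rfl

theorem IsCopy.unique {e : ι' → ι} (he : Function.Injective e)
    {f f' : Graph fun i => k (e i)} {g : Graph k} (h : IsCopy (k := k) e f g)
    (h' : IsCopy (k := k) e f' g) : f = f' :=
  funext fun c => Equiv.ext fun x => pairMap_injective he c ((h c x).symm.trans (h' c x))

end Copies

/-! ### Disjoint unions and components. -/

section Glue

variable {D : ℕ} {ι : Type} {k : ι → Deg D}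

/-- The pairs are those of the elements in `p` and those of the other elements. -/
noncomputable def splitEquiv (k : ι → Deg D) (p : ι → Prop) (c : Fin D) :
    (Σ i : {i // p i}, Fin (k i.1 c)) ⊕ (Σ i : {i // ¬ p i}, Fin (k i.1 c)) ≃
      Σ i, Fin (k i c) :=
  Equiv.ofBijective (Sum.elim (pairMap (k := k) Subtype.val) (pairMap (k := k) Subtype.val)) (by
    constructor
    · rintro (x | x) (y | y) h
      · exact congrArg _ (pairMap_injective Subtype.val_injective c h)
      · exact absurd x.1.2 (by rw [show x.1.1 = y.1.1 from congrArg Sigma.fst h]; exact y.1.2)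
      · exact absurd y.1.2 (by rw [← show x.1.1 = y.1.1 from congrArg Sigma.fst h]; exact x.1.2)
      · exact congrArg _ (pairMap_injective Subtype.val_injective c h)
    · rintro ⟨i, r⟩
      by_cases hi : p i
      · exact ⟨Sum.inl ⟨⟨i, hi⟩, r⟩, rfl⟩
      · exact ⟨Sum.inr ⟨⟨i, hi⟩, r⟩, rfl⟩)

/-- The disjoint union of two graphs. -/
noncomputable def glue (p : ι → Prop) (f₁ : Graph fun i : {i // p i} => k i.1)
    (f₂ : Graph fun i : {i // ¬ p i} => k i.1) : Graph k :=
  fun c => (splitEquiv k p c).permCongr (Perm.sumCongr (f₁ c) (f₂ c))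

variable {p : ι → Prop} {f₁ g₁ : Graph fun i : {i // p i} => k i.1}
  {f₂ g₂ : Graph fun i : {i // ¬ p i} => k i.1}

theorem isCopy_glue_left (f₁ : Graph fun i : {i // p i} => k i.1)
    (f₂ : Graph fun i : {i // ¬ p i} => k i.1) :
    IsCopy (k := k) Subtype.val f₁ (glue p f₁ f₂) := by
  intro c x
  have h : (splitEquiv k p c).symm (pairMap (k := k) Subtype.val x) = Sum.inl x := by
    rw [Equiv.symm_apply_eq]; rfl
  rw [glue, Equiv.permCongr_apply, h]
  rfl

theorem isCopy_glue_right (f₁ : Graph fun i : {i // p i} => k i.1)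
    (f₂ : Graph fun i : {i // ¬ p i} => k i.1) :
    IsCopy (k := k) Subtype.val f₂ (glue p f₁ f₂) := by
  intro c x
  have h : (splitEquiv k p c).symm (pairMap (k := k) Subtype.val x) = Sum.inr x := by
    rw [Equiv.symm_apply_eq]; rfl
  rw [glue, Equiv.permCongr_apply, h]
  rfl

theorem eq_glue_of_isCopy {f : Graph k} (h₁ : IsCopy (k := k) Subtype.val f₁ f)
    (h₂ : IsCopy (k := k) Subtype.val f₂ f) : f = glue p f₁ f₂ := by
  funext c
  ext1 x
  obtain ⟨y | y, rfl⟩ := (splitEquiv k p c).surjective x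
  · exact (h₁ c y).trans (isCopy_glue_left f₁ f₂ c y).symm
  · exact (h₂ c y).trans (isCopy_glue_right f₁ f₂ c y).symm

theorem glue_restrict (g : Graph k) (hp : ∀ c x, p (g c x).1 ↔ p x.1) :
    glue p (restrict g p hp) (restrict g (fun i => ¬ p i) fun c x => not_congr (hp c x)) = g :=
  (eq_glue_of_isCopy (isCopy_restrict g p hp) (isCopy_restrict g _ _)).symm

theorem glue_mul_inv (c : Fin D) : glue p f₁ f₂ c * (glue p g₁ g₂ c)⁻¹ =
    (splitEquiv k p c).permCongr (Perm.sumCongr (f₁ c * (g₁ c)⁻¹) (f₂ c * (g₂ c)⁻¹)) := by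
  rw [← Perm.sumCongr_mul, ← Perm.sumCongr_inv]
  simp only [glue]
  rw [Equiv.permCongr_mul, mul_right_inj]
  rfl

theorem permLength_glue [Finite ι] (c : Fin D) :
    permLength (glue p f₁ f₂ c) = permLength (f₁ c) + permLength (f₂ c) := by
  rw [glue, permLength_permCongr, permLength_sumCongr]

theorem permLength_glue_mul_inv [Finite ι] (c : Fin D) :
    permLength (glue p f₁ f₂ c * (glue p g₁ g₂ c)⁻¹) =
      permLength (f₁ c * (g₁ c)⁻¹) + permLength (f₂ c * (g₂ c)⁻¹) := by
  rw [glue_mul_inv, permLength_permCongr, permLength_sumCongr]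

theorem moebiusNC_glue_mul_inv [Fintype ι] [Fintype {i // p i}] [Fintype {i // ¬ p i}]
    (c : Fin D) :
    moebiusNC (glue p f₁ f₂ c * (glue p g₁ g₂ c)⁻¹) =
      moebiusNC (f₁ c * (g₁ c)⁻¹) * moebiusNC (f₂ c * (g₂ c)⁻¹) := by
  rw [glue_mul_inv, moebiusNC_permCongr, moebiusNC_sumCongr]

/-- Lengths add over the two parts, and each part obeys the triangle inequality, so equality for the
union forces equality for both. -/
theorem graphLe_glue [Finite ι] :
    GraphLe (glue p f₁ f₂) (glue p g₁ g₂) ↔ GraphLe f₁ g₁ ∧ GraphLe f₂ g₂ := by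
  constructor
  · intro h
    have key : ∀ c, NCLe (f₁ c) (g₁ c) ∧ NCLe (f₂ c) (g₂ c) := fun c => by
      have h0 := h c
      rw [NCLe, permLength_glue_mul_inv, permLength_glue, permLength_glue] at h0
      have h1 := permLength_mul_le (g₁ c * (f₁ c)⁻¹) (f₁ c)
      have h2 := permLength_mul_le (g₂ c * (f₂ c)⁻¹) (f₂ c)
      rw [inv_mul_cancel_right, permLength_mul_inv_comm] at h1 h2
      exact ⟨nCLe_of_le (by omega), nCLe_of_le (by omega)⟩
    exact ⟨fun c => (key c).1, fun c => (key c).2⟩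
  · rintro ⟨h1, h2⟩ c
    have h1 := h1 c
    have h2 := h2 c
    rw [NCLe] at h1 h2 ⊢
    rw [permLength_glue_mul_inv, permLength_glue, permLength_glue]
    omega

theorem glue_injective {f₁' : Graph fun i : {i // p i} => k i.1}
    {f₂' : Graph fun i : {i // ¬ p i} => k i.1} (h : glue p f₁ f₂ = glue p f₁' f₂') :
    f₁ = f₁' ∧ f₂ = f₂' := by
  have hl := isCopy_glue_left f₁' f₂'
  have hr := isCopy_glue_right f₁' f₂'
  rw [← h] at hl hr
  exact ⟨(isCopy_glue_left f₁ f₂).unique Subtype.val_injective hl,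
    (isCopy_glue_right f₁ f₂).unique Subtype.val_injective hr⟩

theorem conn_invariant {g : Graph k} (hp : ∀ c x, p (g c x).1 ↔ p x.1) {i j : ι}
    (h : conn g i j) : p i ↔ p j :=
  iff_of_eq (conn_map_eq p (fun c x => propext (hp c x)) h)

/-- The components of a disjoint union. -/
theorem conn_glue_bijective [Finite ι] (f₁ : Graph fun i : {i // p i} => k i.1)
    (f₂ : Graph fun i : {i // ¬ p i} => k i.1) :
    Function.Bijective (Sum.elim
      (Quotient.map (sa := conn f₁) (sb := conn (glue p f₁ f₂)) Subtype.val
        fun _ _ h => ((isCopy_glue_left f₁ f₂).conn_iff Subtype.val_injective).1 h)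
      (Quotient.map (sa := conn f₂) (sb := conn (glue p f₁ f₂)) Subtype.val
        fun _ _ h => ((isCopy_glue_right f₁ f₂).conn_iff Subtype.val_injective).1 h)) := by
  have hp : ∀ c x, p (glue p f₁ f₂ c x).1 ↔ p x.1 := by
    intro c x
    have := (isCopy_glue_left f₁ f₂).fst_mem_range c x
    simpa using this
  constructor
  · rintro (a | a) (b | b) h <;> obtain ⟨i, rfl⟩ := Quotient.exists_rep a <;>
      obtain ⟨j, rfl⟩ := Quotient.exists_rep b
    · have h : conn (glue p f₁ f₂) i.1 j.1 := Quotient.exact h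
      exact congrArg _ (Quotient.sound
        (((isCopy_glue_left f₁ f₂).conn_iff Subtype.val_injective).2 h))
    · have h : conn (glue p f₁ f₂) i.1 j.1 := Quotient.exact h
      exact absurd ((conn_invariant hp h).1 i.2) j.2
    · have h : conn (glue p f₁ f₂) i.1 j.1 := Quotient.exact h
      exact absurd ((conn_invariant hp h).2 j.2) i.2
    · have h : conn (glue p f₁ f₂) i.1 j.1 := Quotient.exact h
      exact congrArg _ (Quotient.sound
        (((isCopy_glue_right f₁ f₂).conn_iff Subtype.val_injective).2 h))
  · rintro ⟨i⟩
    by_cases hi : p i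
    · exact ⟨Sum.inl (Quotient.mk _ ⟨i, hi⟩), rfl⟩
    · exact ⟨Sum.inr (Quotient.mk _ ⟨i, hi⟩), rfl⟩

theorem numComp_glue [Finite ι] : numComp (glue p f₁ f₂) = numComp f₁ + numComp f₂ := by
  rw [numComp, ← Nat.card_congr (Equiv.ofBijective _ (conn_glue_bijective f₁ f₂)), Nat.card_sum]
  rfl

/-- All three numbers are additive, so equality in the counting inequality for the union forces it
for both parts. -/
theorem IsForest.of_glue [Finite ι] (h : IsForest (glue p f₁ f₂)) :
    IsForest f₁ ∧ IsForest f₂ := by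
  have h1 := card_le_numComp_add f₁
  have h2 := card_le_numComp_add f₂
  have h3 : Nat.card {i // p i} + Nat.card {i // ¬ p i} = Nat.card ι := by
    classical
    rw [← Nat.card_sum, Nat.card_congr (Equiv.sumCompl p)]
  have h4 : graphLength (glue p f₁ f₂) = graphLength f₁ + graphLength f₂ := by
    simp only [graphLength, permLength_glue, Finset.sum_add_distrib]
  have h5 := numComp_glue (f₁ := f₁) (f₂ := f₂)
  unfold IsForest at *
  omega

theorem IsForest.restrict [Finite ι] {g : Graph k} (h : IsForest g)
    (hp : ∀ c x, p (g c x).1 ↔ p x.1) : IsForest (restrict g p hp) := by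
  rw [← glue_restrict g hp] at h
  exact h.of_glue.1

theorem IsForest.component [Finite ι] {g : Graph k} (h : IsForest g) (b : Quotient (conn g)) :
    IsTreeLike (component g b) := by
  have hne : Nonempty {i // Quotient.mk (conn g) i = b} := by
    obtain ⟨i⟩ := b
    exact ⟨⟨i, rfl⟩⟩
  refine IsForest.isTreeLike (h.restrict (conn_edge g b)) fun i j => ?_
  have := (isCopy_restrict g _ (conn_edge g b)).conn_iff Subtype.val_injective (i := i) (j := j)
  exact this.2 (Quotient.exact (i.2.trans j.2.symm))

end Glue

/-! ### Melonic graphs are the tree-like graphs. -/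

section Melonic

variable {D : ℕ} {ι : Type} {k : ι → Deg D}

theorem subtype_ne_card [Finite ι] (v : ι) : Nat.card {i // i ≠ v} + 1 = Nat.card ι := by
  classical
  have := Fintype.ofFinite ι
  rw [Nat.card_eq_fintype_card, Nat.card_eq_fintype_card, Fintype.card_subtype_compl,
    Fintype.card_subtype_eq]
  have : 0 < Fintype.card ι := Fintype.card_pos_iff.2 ⟨v⟩
  omega

/-- Inserting a leaf adds one element, increases the length by one, and preserves connectedness. -/
theorem IsMelonic.isTreeLike {g : Graph k} (h : IsMelonic g) : IsTreeLike g := by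
  classical
  induction h with
  | single k =>
    refine ⟨inferInstance, fun i j => ?_, ?_⟩
    · rw [Subsingleton.elim i j]
    · rw [graphLength_eq_zero.2 rfl, Nat.card_unique]
  | @insert ι k g v c₀ r₀ hself hopen g' hkeep hjoin _ ih =>
    have := ih.finite
    have : Finite ι := Finite.of_surjective
      (fun o : Option {i : ι // i ≠ v} => o.elim v Subtype.val) fun i => by
        by_cases hi : i = v
        · exact ⟨none, hi.symm⟩
        · exact ⟨some ⟨i, hi⟩, rfl⟩
    have hne : (g c₀ ⟨v, r₀⟩).1 ≠ v := by
      intro hv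
      obtain ⟨s, hs⟩ : ∃ s, g c₀ ⟨v, r₀⟩ = ⟨v, s⟩ := by
        refine ⟨hv ▸ (g c₀ ⟨v, r₀⟩).2, ?_⟩
        ext
        · exact hv
        · simp
      by_cases hsr : s = r₀
      · exact hopen (hs.trans (by rw [hsr]))
      · have h1 := hself c₀ s (by
          intro h'
          rw [Sigma.mk.inj_iff] at h'
          exact hsr (eq_of_heq h'.2))
        have h2 := (g c₀).injective (hs.trans h1.symm)
        rw [Sigma.mk.inj_iff] at h2
        exact hsr (eq_of_heq h2.2).symm
    have hconn : ∀ c (x : Σ i : {i : ι // i ≠ v}, Fin (k i.1 c)),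
        conn g x.1.1 (g' c x).1.1 := by
      intro c x
      have h1 := conn_apply g c (unremove x)
      by_cases hx : (g c (unremove x)).1 = v
      · have h2 := conn_apply g c (g c (unremove x))
        rw [← hjoin c x hx] at h2
        exact (conn g).trans h1 h2
      · rw [← hkeep c x hx] at h1
        exact h1
    refine ⟨⟨v⟩, ?_, ?_⟩
    · have key : ∀ i, conn g i (g c₀ ⟨v, r₀⟩).1 := by
        intro i
        by_cases hi : i = v
        · rw [hi]
          exact conn_apply g c₀ ⟨v, r₀⟩
        · exact conn_mono Subtype.val hconn (ih.conn ⟨i, hi⟩ ⟨_, hne⟩)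
      exact fun i j => (conn g).trans (key i) ((conn g).symm (key j))
    -- Skipping the open pair of the leaf leaves a copy of `g'` next to the isolated element `v`.
    · let h : Graph k := Function.update g c₀ (skip (g c₀) ⟨v, r₀⟩)
      have hfixv : ∀ c x, x.1 = v → h c x = x := by
        rintro c ⟨i, r⟩ rfl
        rcases eq_or_ne c c₀ with rfl | hc
        · simp only [h, Function.update_self]
          by_cases hr : r = r₀
          · rw [hr, skip_self]
          · have hself' := hself c r (by
              intro h'
              rw [Sigma.mk.inj_iff] at h'
              exact hr (eq_of_heq h'.2))
            have hne' : (⟨i, r⟩ : Σ i, Fin (k i c)) ≠ ⟨i, r₀⟩ := fun h' => hr (by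
              rw [Sigma.mk.inj_iff] at h'
              exact eq_of_heq h'.2)
            rw [skip_apply _ _ _ hne', hself', if_neg hne']
        · simp only [h, Function.update_of_ne hc]
          exact hself c r fun h' => hc (Sigma.mk.inj_iff.1 h').1
      have hcopy : IsCopy (k := k) Subtype.val g' h := by
        intro c x
        change h c (unremove x) = unremove (g' c x)
        by_cases hx : (g c (unremove x)).1 = v
        · rw [hjoin c x hx]
          have hgx : g c (unremove x) ≠ unremove x := fun h' => x.1.2 (by rw [h'] at hx; exact hx)
          rcases hy : g c (unremove x) with ⟨i, r⟩
          rw [hy] at hx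
          obtain rfl : i = v := hx
          by_cases hcr : (⟨c, r⟩ : Σ c, Fin (k i c)) = ⟨c₀, r₀⟩
          · rw [Sigma.mk.inj_iff] at hcr
            obtain ⟨rfl, hr⟩ := hcr
            obtain rfl := eq_of_heq hr
            simp only [h, Function.update_self]
            rw [skip_apply _ _ _ (fun h' => x.1.2 (congrArg Sigma.fst h')), if_pos hy]
          · exfalso
            have h1 := hself c r hcr
            rw [← hy] at h1
            exact hgx ((g c).injective h1)
        · rw [hkeep c x hx]
          rcases eq_or_ne c c₀ with rfl | hc
          · simp only [h, Function.update_self]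
            rw [skip_apply _ _ _ (fun h' => x.1.2 (congrArg Sigma.fst h')),
              if_neg fun h' => hx (by rw [h'])]
          · simp only [h, Function.update_of_ne hc]
      have h1 := hcopy.graphLength_eq Subtype.val_injective fun c x hx => hfixv c x (by
        by_contra hv; exact hx ⟨⟨x.1, hv⟩, rfl⟩)
      have h2 := graphLength_update g c₀ (skip (g c₀) ⟨v, r₀⟩)
      have h3 := permLength_skip hopen
      have h4 := ih.length
      have h5 := subtype_ne_card v
      change graphLength h + _ = _ at h2
      omega

/-- A tree-like graph with several elements has a leaf. -/
theorem IsTreeLike.exists_leaf {g : Graph k} (hg : IsTreeLike g) (hcard : 2 ≤ Nat.card ι) :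
    ∃ (v : ι) (c₀ : Fin D) (r₀ : Fin (k v c₀)), g c₀ ⟨v, r₀⟩ ≠ ⟨v, r₀⟩ ∧
      ∀ (c : Fin D) (r : Fin (k v c)),
        (⟨c, r⟩ : Σ c, Fin (k v c)) ≠ ⟨c₀, r₀⟩ → g c ⟨v, r⟩ = ⟨v, r⟩ := by
  classical
  have := hg.finite
  have := Fintype.ofFinite ι
  let S : Finset (Σ c, Σ i, Fin (k i c)) := Finset.univ.sigma fun c => (g c).support
  have hS : S.card ≤ 2 * graphLength g := by
    rw [Finset.card_sigma, graphLength, Finset.mul_sum]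
    exact Finset.sum_le_sum fun c _ => card_support_le (g c)
  -- At most `2 (n - 1)` pairs are moved in total, so one of the `n` elements has at most one moved
  -- pair; connectedness then provides one.
  obtain ⟨v, hv⟩ : ∃ v : ι, (S.filter fun z => z.2.1 = v).card < 2 := by
    by_contra! h
    have h1 : S.card = ∑ v : ι, (S.filter fun z => z.2.1 = v).card :=
      Finset.card_eq_sum_card_fiberwise fun _ _ => Finset.mem_coe.2 (Finset.mem_univ _)
    have h2 : Fintype.card ι * 2 ≤ S.card := by
      rw [h1, ← Finset.card_univ, ← smul_eq_mul]
      exact Finset.card_nsmul_le_sum _ _ _ fun v _ => h v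
    have h3 := hg.length
    rw [Nat.card_eq_fintype_card] at h3
    omega
  have hex : ∃ z ∈ S, z.2.1 = v := by
    by_contra! h
    have hfix : ∀ c x, x.1 = v → g c x = x := fun c x hx => by
      by_contra hgx
      exact h ⟨c, x⟩ (by simpa [S] using hgx) hx
    obtain ⟨w, hw⟩ : ∃ w, w ≠ v := by
      by_contra! h'
      have : Subsingleton ι := ⟨fun a b => (h' a).trans (h' b).symm⟩
      have := Finite.card_le_one_iff_subsingleton.2 this
      omega
    have := conn_map_eq (g := g) (fun i => i = v) (fun c x => ?_) (hg.conn w v)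
    · simp [hw] at this
    · by_cases hx : x.1 = v
      · rw [hfix c x hx]
      · simp only [hx, eq_iff_iff, iff_false]
        intro h'
        exact hx (by rw [(g c).injective (hfix c _ h')] at h'; exact h')
  obtain ⟨⟨c₀, i, r₀⟩, hz, rfl⟩ := hex
  refine ⟨i, c₀, r₀, by simpa [S] using hz, fun c r hcr => ?_⟩
  by_contra hgx
  have h1 := Finset.card_le_one.1 (Nat.lt_succ_iff.1 hv) ⟨c₀, i, r₀⟩ (by simpa [S] using hz) ⟨c, i, r⟩
    (by simpa [S] using hgx)
  apply hcr
  rw [Sigma.mk.inj_iff] at h1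
  obtain ⟨rfl, h1⟩ := h1
  rw [heq_iff_eq, Sigma.mk.inj_iff] at h1
  rw [eq_of_heq h1.2]

/-- Delete a leaf. Skipping its open pair lowers the length by one, and the rest stays connected
because paths through the leaf are short-circuited. -/
theorem IsTreeLike.isMelonic {g : Graph k} (hg : IsTreeLike g) : IsMelonic g := by
  classical
  induction hn : Nat.card ι generalizing ι with
  | zero => have := hg.length; omega
  | succ n ih =>
    have := hg.finite
    rcases Nat.eq_zero_or_pos n with rfl | hn0
    · obtain ⟨hu1, hu2⟩ := Nat.card_eq_one_iff_unique.1 hn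
      have hu : Unique ι := ⟨⟨Classical.choice hu2⟩, fun _ => Subsingleton.elim _ _⟩
      have h1 : g = fun _ => 1 := graphLength_eq_zero.1 (by have := hg.length; omega)
      rw [h1]
      exact IsMelonic.single k
    obtain ⟨v, c₀, r₀, hopen, hself⟩ := hg.exists_leaf (by omega)
    let h : Graph k := Function.update g c₀ (skip (g c₀) ⟨v, r₀⟩)
    have hfixv : ∀ c x, x.1 = v → h c x = x := by
      rintro c ⟨i, r⟩ rfl
      rcases eq_or_ne c c₀ with rfl | hc
      · simp only [h, Function.update_self]
        by_cases hr : r = r₀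
        · rw [hr, skip_self]
        · have hself' := hself c r (by
            intro h'
            rw [Sigma.mk.inj_iff] at h'
            exact hr (eq_of_heq h'.2))
          have hne' : (⟨i, r⟩ : Σ i, Fin (k i c)) ≠ ⟨i, r₀⟩ := fun h' => hr (by
            rw [Sigma.mk.inj_iff] at h'
            exact eq_of_heq h'.2)
          rw [skip_apply _ _ _ hne', hself', if_neg hne']
      · simp only [h, Function.update_of_ne hc]
        exact hself c r fun h' => hc (Sigma.mk.inj_iff.1 h').1
    have hp : ∀ c x, (h c x).1 ≠ v ↔ x.1 ≠ v := by
      intro c x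
      refine not_congr ⟨fun hx => ?_, fun hx => by rw [hfixv c x hx, hx]⟩
      have := (h c).injective (hfixv c _ hx)
      rw [this] at hx
      exact hx
    let g' := restrict h (fun i => i ≠ v) hp
    have hkeep : ∀ c x, (g c (unremove x)).1 ≠ v → unremove (g' c x) = g c (unremove x) := by
      intro c x hx
      change h c (unremove x) = _
      rcases eq_or_ne c c₀ with rfl | hc
      · simp only [h, Function.update_self]
        rw [skip_apply _ _ _ (fun h' => x.1.2 (congrArg Sigma.fst h')),
          if_neg fun h' => hx (by rw [h'])]
      · simp only [h, Function.update_of_ne hc]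
    have hmove : ∀ c x, x.1 ≠ v → (g c x).1 = v →
        (⟨c, g c x⟩ : Σ c, Σ i, Fin (k i c)) = ⟨c₀, ⟨v, r₀⟩⟩ := by
      intro c x hxv hx
      rcases hy : g c x with ⟨i, r⟩
      rw [hy] at hx
      obtain rfl : i = v := hx
      by_cases hcr : (⟨c, r⟩ : Σ c, Fin (k i c)) = ⟨c₀, r₀⟩
      · rw [Sigma.mk.inj_iff] at hcr
        obtain ⟨rfl, hr⟩ := hcr
        rw [eq_of_heq hr]
      · have h1 := hself c r hcr
        rw [← hy] at h1
        have h2 := (g c).injective h1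
        rw [hy] at h2
        exact absurd (congrArg Sigma.fst h2).symm hxv
    have hjoin : ∀ c x, (g c (unremove x)).1 = v →
        unremove (g' c x) = g c (g c (unremove x)) := by
      intro c x hx
      change h c (unremove x) = _
      have h1 := hmove c (unremove x) x.1.2 hx
      rw [Sigma.mk.inj_iff] at h1
      obtain ⟨rfl, h1⟩ := h1
      have h1 := eq_of_heq h1
      simp only [h, Function.update_self]
      rw [skip_apply _ _ _ (fun h' => x.1.2 (congrArg Sigma.fst h')), if_pos h1, h1]
    refine IsMelonic.insert g v c₀ r₀ hself hopen g' hkeep hjoin (ih ?_ ?_)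
    · have hcopy : IsCopy (k := k) Subtype.val g' h := isCopy_restrict h _ hp
      have h1 := hcopy.graphLength_eq Subtype.val_injective fun c x hx => hfixv c x (by
        by_contra hv; exact hx ⟨⟨x.1, hv⟩, rfl⟩)
      have h2 := graphLength_update g c₀ (skip (g c₀) ⟨v, r₀⟩)
      have h3 := permLength_skip hopen
      have h4 := hg.length
      have h5 := subtype_ne_card v
      change graphLength h + _ = _ at h2
      have hne : (g c₀ ⟨v, r₀⟩).1 ≠ v := by
        intro hv
        have := hg.isForest.eq_of_sameCycle (c := c₀) (x := ⟨v, r₀⟩) (y := g c₀ ⟨v, r₀⟩)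
          (Perm.sameCycle_apply_right.2 (Perm.SameCycle.refl _ _)) hv.symm
        exact hopen this.symm
      refine ⟨⟨⟨_, hne⟩⟩, fun i j => ?_, by omega⟩
      let φ : ι → Quotient (TensorFree.conn g') := fun i =>
        if hi : i = v then Quotient.mk _ ⟨_, hne⟩ else Quotient.mk _ ⟨i, hi⟩
      have hφ : φ i.1 = φ j.1 := by
        refine conn_map_eq φ (fun c x => ?_) (hg.conn i.1 j.1)
        have hvx : ∀ c x, x.1 = v → φ (g c x).1 = φ x.1 := by
          rintro c ⟨l, r⟩ rfl
          by_cases hcr : (⟨c, r⟩ : Σ c, Fin (k l c)) = ⟨c₀, r₀⟩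
          · rw [Sigma.mk.inj_iff] at hcr
            obtain ⟨rfl, hr⟩ := hcr
            obtain rfl := eq_of_heq hr
            simp only [φ, dif_neg hne, dif_pos]
          · rw [hself c r hcr]
        by_cases hx : x.1 = v
        · exact hvx c x hx
        · have h6 := conn_apply g' c ⟨⟨x.1, hx⟩, x.2⟩
          by_cases hgx : (g c x).1 = v
          · have h7 := hjoin c ⟨⟨x.1, hx⟩, x.2⟩ hgx
            rw [← hvx c (g c x) hgx]
            have h8 : (g' c ⟨⟨x.1, hx⟩, x.2⟩).1.1 = (g c (g c x)).1 := congrArg Sigma.fst h7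
            rw [← h8]
            simp only [φ, dif_neg hx, dif_neg (g' c ⟨⟨x.1, hx⟩, x.2⟩).1.2]
            exact (Quotient.sound h6).symm
          · have h7 := hkeep c ⟨⟨x.1, hx⟩, x.2⟩ hgx
            have h8 : (g' c ⟨⟨x.1, hx⟩, x.2⟩).1.1 = (g c x).1 := congrArg Sigma.fst h7
            rw [← h8]
            simp only [φ, dif_neg hx, dif_neg (g' c ⟨⟨x.1, hx⟩, x.2⟩).1.2]
            exact (Quotient.sound h6).symm
      simp only [φ, dif_neg i.2, dif_neg j.2] at hφ
      exact Quotient.exact hφ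
    · have := subtype_ne_card v
      omega

end Melonic

end TensorFree

namespace TensorFree

set_option linter.unusedSectionVars false

/-! ### Substituting cycles for the points of a permutation. -/

section Substitution

variable {X Y : Type} [Finite X] [Finite Y]

/-- The permutation `ρ` has exactly one cycle through each point of the image of `emb`, and no
other cycle; `cl y` is the point that belongs to the cycle of `y`. -/
structure IsTransversal (ρ : Perm Y) (emb : X ↪ Y) (cl : Y → X) : Prop where
  cl_apply : ∀ y, cl (ρ y) = cl y
  cl_emb : ∀ x, cl (emb x) = x
  sameCycle : ∀ y, ρ.SameCycle y (emb (cl y))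

variable {ρ : Perm Y} {emb : X ↪ Y} {cl : Y → X}

/-- The permutation of the points of the transversal that `σ` describes, composed with `ρ`. -/
noncomputable def substPerm (ρ : Perm Y) (emb : X ↪ Y) (σ : Perm X) : Perm Y :=
  ρ * σ.viaEmbedding emb

theorem substPerm_emb (σ : Perm X) (x : X) : substPerm ρ emb σ (emb x) = ρ (emb (σ x)) := by
  rw [substPerm, Perm.mul_apply, Perm.viaEmbedding_apply]

theorem substPerm_of_notMem (σ : Perm X) {y : Y} (hy : y ∉ Set.range emb) :
    substPerm ρ emb σ y = ρ y := by
  rw [substPerm, Perm.mul_apply, Perm.viaEmbedding_apply_of_notMem _ _ _ hy]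

theorem IsTransversal.subst_sameCycle (h : IsTransversal ρ emb cl) (σ : Perm X) (y : Y) :
    (substPerm ρ emb σ).SameCycle y (emb (cl y)) := by
  obtain ⟨n, hn⟩ := (h.sameCycle y).exists_nat_pow_eq
  induction n generalizing y with
  | zero =>
    rw [pow_zero, Perm.one_apply] at hn
    rw [← hn]
  | succ n ih =>
    by_cases hy : y ∈ Set.range emb
    · obtain ⟨x, rfl⟩ := hy
      rw [h.cl_emb]
    · rw [pow_succ, Perm.mul_apply, ← h.cl_apply] at hn
      have := ih (ρ y) hn
      rwa [← substPerm_of_notMem (ρ := ρ) σ hy, Perm.sameCycle_apply_left,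
        substPerm_of_notMem σ hy, h.cl_apply] at this

/-- The substituted permutation follows `ρ` until it reaches the marked point of the cycle, and only
there changes cycle as `σ` says. Its cycles are thus those of `σ` with every point inflated to a
`ρ`-cycle. -/
theorem IsTransversal.subst_sameCycle_iff (h : IsTransversal ρ emb cl) (σ : Perm X) (y y' : Y) :
    (substPerm ρ emb σ).SameCycle y y' ↔ σ.SameCycle (cl y) (cl y') := by
  constructor
  · intro hy
    refine Quotient.exact (s := Perm.SameCycle.setoid σ)
      (SameCycle.map_eq (fun z => Quotient.mk (Perm.SameCycle.setoid σ) (cl z)) (fun z => ?_) hy)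
    by_cases hz : z ∈ Set.range emb
    · obtain ⟨x, rfl⟩ := hz
      rw [substPerm_emb, h.cl_apply, h.cl_emb, h.cl_emb]
      exact Quotient.sound (s := Perm.SameCycle.setoid σ)
        (show σ.SameCycle _ _ from Perm.sameCycle_apply_left.2 (Perm.SameCycle.refl σ x))
    · rw [substPerm_of_notMem σ hz, h.cl_apply]
  · intro hx
    have h1 : (substPerm ρ emb σ).SameCycle (emb (cl y)) (emb (cl y')) := by
      refine SameCycle.mono emb (fun x => ?_) hx
      have := h.subst_sameCycle σ (substPerm ρ emb σ (emb x))
      rw [Perm.sameCycle_apply_left] at this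
      rwa [substPerm_emb, h.cl_apply, h.cl_emb] at this
    exact ((h.subst_sameCycle σ y).trans h1).trans (h.subst_sameCycle σ y').symm

theorem IsTransversal.permLength_subst (h : IsTransversal ρ emb cl) (σ : Perm X) :
    permLength (substPerm ρ emb σ) + Nat.card X = permLength σ + Nat.card Y := by
  have h1 : numCycles (substPerm ρ emb σ) = numCycles σ := by
    refine Nat.card_congr (Equiv.ofBijective
      (Quotient.map (sa := Perm.SameCycle.setoid (substPerm ρ emb σ))
        (sb := Perm.SameCycle.setoid σ) cl fun y y' hy => (h.subst_sameCycle_iff σ y y').1 hy)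
      ⟨fun a b hab => ?_, fun a => ?_⟩)
    · obtain ⟨y, rfl⟩ := Quotient.exists_rep a
      obtain ⟨y', rfl⟩ := Quotient.exists_rep b
      exact Quotient.sound (s := Perm.SameCycle.setoid _)
        ((h.subst_sameCycle_iff σ y y').2 (Quotient.exact (s := Perm.SameCycle.setoid σ) hab))
    · obtain ⟨x, rfl⟩ := Quotient.exists_rep a
      exact ⟨Quotient.mk _ (emb x), congrArg _ (h.cl_emb x)⟩
  have h2 := permLength_add_numCycles σ
  have h3 := permLength_add_numCycles (substPerm ρ emb σ)
  omega

theorem substPerm_mul_inv (σ τ : Perm X) : substPerm ρ emb σ * (substPerm ρ emb τ)⁻¹ =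
    ρ * (σ * τ⁻¹).viaEmbedding emb * ρ⁻¹ := by
  have : (σ * τ⁻¹).viaEmbedding emb = σ.viaEmbedding emb * (τ.viaEmbedding emb)⁻¹ := by
    have := map_mul (Perm.viaEmbeddingHom emb) σ τ⁻¹
    rwa [map_inv] at this
  rw [this, substPerm, substPerm]
  group

/-- Substitution shifts the lengths of `σ` and `τ` by the same constant, and the quotient of the two
results is conjugate to an extension of `σ τ⁻¹`. -/
theorem IsTransversal.subst_nCLe_iff (h : IsTransversal ρ emb cl) (σ τ : Perm X) :
    NCLe (substPerm ρ emb σ) (substPerm ρ emb τ) ↔ NCLe σ τ := by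
  have h1 := h.permLength_subst σ
  have h2 := h.permLength_subst τ
  rw [NCLe, NCLe, substPerm_mul_inv, permLength_conj, permLength_viaEmbedding]
  omega

end Substitution

/-! ### Trees with prescribed cuts. -/

section Trees

variable {D : ℕ}

theorem Tree.cut_injective {ι : Type} {k : ι → Deg D} {k' : Deg D} (T : Tree k k') (c : Fin D) :
    Function.Injective (T.cut c) := by
  intro r s h
  refine (T.cut_spec c (T.cut c r)).unique (Perm.SameCycle.refl _ _) ?_
  rw [h]

/-- Any choice of one point per cycle is a legitimate set of cuts; the freedom to prescribe it is
needed for contracting components and for isolating identities. -/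
theorem exists_tree {ι : Type} {k : ι → Deg D} {g : Graph k} (hg : IsMelonic g)
    (rep : ∀ c, Quotient (Perm.SameCycle.setoid (g c)) → Σ i, Fin (k i c))
    (hrep : ∀ c q, Quotient.mk _ (rep c q) = q) :
    ∃ (k' : Deg D) (T : Tree k k'), T.graph = g ∧ ∀ c x, T.IsCut c x ↔ ∃ q, rep c q = x := by
  have := hg.isTreeLike.finite
  let e : ∀ c, Quotient (Perm.SameCycle.setoid (g c)) ≃ Fin (numCycles (g c)) := fun c =>
    Finite.equivFin _
  refine ⟨fun c => numCycles (g c), ⟨g, hg, fun c r => rep c ((e c).symm r), fun c x => ?_⟩, rfl,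
    fun c x => ?_⟩
  · refine ⟨e c (Quotient.mk _ x), ?_, fun r hr => ?_⟩
    · refine Quotient.exact (s := Perm.SameCycle.setoid (g c)) ?_
      rw [hrep, Equiv.symm_apply_apply]
    · rw [← Equiv.symm_apply_eq, ← hrep c ((e c).symm r)]
      exact Quotient.sound (s := Perm.SameCycle.setoid (g c)) hr
  · constructor
    · rintro ⟨r, rfl⟩
      exact ⟨_, rfl⟩
    · rintro ⟨q, rfl⟩
      exact ⟨e c q, by simp⟩

theorem IsMelonic.exists_tree {ι : Type} {k : ι → Deg D} {g : Graph k} (hg : IsMelonic g) :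
    ∃ (k' : Deg D) (T : Tree k k'), T.graph = g := by
  obtain ⟨k', T, hT, -⟩ := TensorFree.exists_tree hg (fun _ => Quotient.out)
    fun _ q => Quotient.out_eq q
  exact ⟨k', T, hT⟩

theorem Tree.card_eq {ι : Type} [Finite ι] {k : ι → Deg D} {k' : Deg D} (T : Tree k k')
    (c : Fin D) : permLength (T.graph c) + k' c = Nat.card (Σ i, Fin (k i c)) := by
  have h1 : k' c = numCycles (T.graph c) := by
    have h2 : Function.Bijective fun r : Fin (k' c) =>
        Quotient.mk (Perm.SameCycle.setoid (T.graph c)) (T.cut c r) := by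
      constructor
      · intro r s hrs
        exact (T.cut_spec c (T.cut c s)).unique
          (Quotient.exact (s := Perm.SameCycle.setoid (T.graph c)) hrs) (Perm.SameCycle.refl _ _)
      · intro q
        obtain ⟨x, rfl⟩ := Quotient.exists_rep q
        obtain ⟨r, hr, -⟩ := T.cut_spec c x
        exact ⟨r, Quotient.sound (s := Perm.SameCycle.setoid (T.graph c)) hr⟩
    rw [numCycles, ← Nat.card_congr (Equiv.ofBijective _ h2), Nat.card_fin]
  rw [h1, permLength_add_numCycles]

theorem IsCopy.sameCycle_iff {ι ι' : Type} [Finite ι] {k : ι → Deg D} {e : ι' → ι}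
    (he : Function.Injective e) {f' : Graph fun i => k (e i)} {f : Graph k}
    (h : IsCopy (k := k) e f' f) {c : Fin D} (x y : Σ i, Fin (k (e i) c)) :
    (f' c).SameCycle x y ↔ (f c).SameCycle (pairMap e x) (pairMap e y) := by
  constructor
  · refine SameCycle.mono (pairMap (k := k) e) fun z => ?_
    rw [← h c z, Perm.sameCycle_apply_right]
  · intro hxy
    obtain ⟨n, hn⟩ := hxy.exists_nat_pow_eq
    have key : ∀ n : ℕ, (f c ^ n) (pairMap (k := k) e x) = pairMap e ((f' c ^ n) x) := by
      intro n
      induction n with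
      | zero => rfl
      | succ n ih => rw [pow_succ', pow_succ', Perm.mul_apply, Perm.mul_apply, ih, h]
    rw [key] at hn
    exact ⟨n, by rw [zpow_natCast]; exact pairMap_injective he c hn⟩

end Trees

/-! ### Grafting trees into a graph. -/

section Graft

variable {D : ℕ} {ι : Type} {κ : ι → Type} {K : ∀ i, κ i → Deg D} {k : ι → Deg D}

/-- The disjoint union of the graphs of a family of trees. -/
def innerPerm (S : ∀ i, Tree (K i) (k i)) (c : Fin D) :
    Perm (Σ x : Σ i, κ i, Fin (K x.1 x.2 c)) :=
  (Equiv.sigmaAssoc fun i (j : κ i) => Fin (K i j c)).symm.permCongr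
    (Perm.sigmaCongrRight fun i => (S i).graph c)

theorem innerPerm_apply (S : ∀ i, Tree (K i) (k i)) (c : Fin D) (i : ι)
    (y : Σ j : κ i, Fin (K i j c)) :
    innerPerm S c (ungroup i y) = ungroup i ((S i).graph c y) := rfl

theorem ungroup_injective (c : Fin D) (i : ι) :
    Function.Injective (ungroup i : (Σ j : κ i, Fin (K i j c)) → _) := by
  intro y y' h
  have h1 := congrArg (Equiv.sigmaAssoc fun i (j : κ i) => Fin (K i j c)) h
  have h2 : (⟨i, y⟩ : Σ i, Σ j : κ i, Fin (K i j c)) = ⟨i, y'⟩ := h1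
  rw [Sigma.mk.injEq] at h2
  exact eq_of_heq h2.2

theorem exists_ungroup {c : Fin D} (y : Σ x : Σ i, κ i, Fin (K x.1 x.2 c)) :
    ∃ i y', y = ungroup i y' := ⟨y.1.1, ⟨y.1.2, y.2⟩, rfl⟩

/-- The free outputs of a family of trees. -/
def cutEmb (S : ∀ i, Tree (K i) (k i)) (c : Fin D) :
    (Σ i, Fin (k i c)) ↪ Σ x : Σ i, κ i, Fin (K x.1 x.2 c) where
  toFun x := ungroup x.1 ((S x.1).cut c x.2)
  inj' := by
    rintro ⟨i, r⟩ ⟨j, s⟩ h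
    have h1 : i = j := congrArg (fun z => z.1.1) h
    obtain rfl := h1
    exact congrArg (Sigma.mk i) ((S i).cut_injective c (ungroup_injective c i h))

/-- The free output in the cycle of a pair. -/
noncomputable def cutOf (S : ∀ i, Tree (K i) (k i)) (c : Fin D)
    (y : Σ x : Σ i, κ i, Fin (K x.1 x.2 c)) : Σ i, Fin (k i c) :=
  ⟨y.1.1, ((S y.1.1).cut_spec c ⟨y.1.2, y.2⟩).exists.choose⟩

theorem cutOf_ungroup (S : ∀ i, Tree (K i) (k i)) (c : Fin D) (i : ι)
    (y : Σ j : κ i, Fin (K i j c)) (r : Fin (k i c))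
    (h : ((S i).graph c).SameCycle ((S i).cut c r) y) : cutOf S c (ungroup i y) = ⟨i, r⟩ := by
  have := ((S i).cut_spec c y).unique ((S i).cut_spec c y).exists.choose_spec h
  rw [← this]
  rfl

theorem isTransversal_innerPerm (S : ∀ i, Tree (K i) (k i)) (c : Fin D) :
    IsTransversal (innerPerm S c) (cutEmb S c) (cutOf S c) where
  cl_apply y := by
    obtain ⟨i, y, rfl⟩ := exists_ungroup y
    obtain ⟨r, hr, -⟩ := (S i).cut_spec c y
    rw [innerPerm_apply, cutOf_ungroup S c i y r hr, cutOf_ungroup S c i _ r]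
    rwa [Perm.sameCycle_apply_right]
  cl_emb x := cutOf_ungroup S c x.1 _ x.2 (Perm.SameCycle.refl _ _)
  sameCycle y := by
    obtain ⟨i, y, rfl⟩ := exists_ungroup y
    obtain ⟨r, hr, -⟩ := (S i).cut_spec c y
    rw [cutOf_ungroup S c i y r hr]
    refine SameCycle.mono (ungroup i) (fun z => ?_) hr.symm
    rw [← innerPerm_apply, Perm.sameCycle_apply_right]

/-- The graph obtained from `g` by replacing its elements by trees. -/
noncomputable def graft (g : Graph k) (S : ∀ i, Tree (K i) (k i)) :
    Graph fun x : Σ i, κ i => K x.1 x.2 :=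
  fun c => substPerm (innerPerm S c) (cutEmb S c) (g c)

variable [Finite ι] [∀ i, Finite (κ i)] (S : ∀ i, Tree (K i) (k i))

theorem conn_graft_iff (g : Graph k) (x y : Σ i, κ i) :
    conn (graft g S) x y ↔ conn g x.1 y.1 := by
  constructor
  · refine conn_mono Sigma.fst fun c y => ?_
    by_cases hy : y ∈ Set.range (cutEmb S c)
    · obtain ⟨x, rfl⟩ := hy
      rw [graft, substPerm_emb]
      exact conn_apply g c x
    · rw [graft, substPerm_of_notMem _ hy]
      exact (conn g).refl _
  · have h0 : ∀ i (j j' : κ i), conn (graft g S) ⟨i, j⟩ ⟨i, j'⟩ := by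
      intro i j j'
      refine conn_mono (g := (S i).graph) (fun j => (⟨i, j⟩ : Σ i, κ i)) (fun c y => ?_)
        ((S i).melonic.isTreeLike.conn j j')
      have h1 : (graft g S c).SameCycle (ungroup i y) (ungroup i ((S i).graph c y)) := by
        rw [graft, (isTransversal_innerPerm S c).subst_sameCycle_iff, ← innerPerm_apply,
          (isTransversal_innerPerm S c).cl_apply]
      exact conn_of_sameCycle h1
    have j₀ : ∀ i, κ i := fun i => Classical.choice (S i).melonic.isTreeLike.nonempty
    have h1 : ∀ i i', conn g i i' → conn (graft g S) ⟨i, j₀ i⟩ ⟨i', j₀ i'⟩ := fun i i' hi => by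
      refine conn_mono (g := g) (fun i => (⟨i, j₀ i⟩ : Σ i, κ i)) (fun c z => ?_) hi
      have h2 : (graft g S c).SameCycle (cutEmb S c z) (cutEmb S c (g c z)) := by
        rw [graft, (isTransversal_innerPerm S c).subst_sameCycle_iff,
          (isTransversal_innerPerm S c).cl_emb, (isTransversal_innerPerm S c).cl_emb,
          Perm.sameCycle_apply_right]
      exact (conn (graft g S)).trans (h0 _ _ _)
        ((conn (graft g S)).trans (conn_of_sameCycle h2) (h0 _ _ _))
    intro hxy
    exact (conn (graft g S)).trans (h0 _ _ _)
      ((conn (graft g S)).trans (h1 _ _ hxy) (h0 _ _ _))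

/-- Grafting preserves the number of elements minus the length: an inserted tree with `m` elements
contributes length `m - 1` and replaces a single element. -/
theorem graphLength_graft (g : Graph k) :
    graphLength (graft g S) + Nat.card ι = graphLength g + Nat.card (Σ i, κ i) := by
  have := Fintype.ofFinite ι
  have h1 : ∀ c, permLength (graft g S c) + Nat.card (Σ i, Fin (k i c)) =
      permLength (g c) + Nat.card (Σ x : Σ i, κ i, Fin (K x.1 x.2 c)) := fun c =>
    (isTransversal_innerPerm S c).permLength_subst (g c)
  have h2 : ∀ c, Nat.card (Σ i, Fin (k i c)) = ∑ i, k i c := fun c => by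
    rw [Nat.card_sigma]
    simp
  have h3 : ∀ c, Nat.card (Σ x : Σ i, κ i, Fin (K x.1 x.2 c)) =
      ∑ i, (permLength ((S i).graph c) + k i c) := fun c => by
    rw [Nat.card_congr (Equiv.sigmaAssoc fun i (j : κ i) => Fin (K i j c)), Nat.card_sigma]
    exact Finset.sum_congr rfl fun i _ => ((S i).card_eq c).symm
  have h4 : Nat.card (Σ i, κ i) = ∑ i, (graphLength (S i).graph + 1) := by
    rw [Nat.card_sigma]
    exact Finset.sum_congr rfl fun i _ => ((S i).melonic.isTreeLike.length).symm
  have h5 : ∀ c, permLength (graft g S c) =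
      permLength (g c) + ∑ i, permLength ((S i).graph c) := fun c => by
    have := h1 c
    rw [h2, h3, Finset.sum_add_distrib] at this
    omega
  have h6 : graphLength (graft g S) = graphLength g + ∑ i, graphLength (S i).graph := by
    simp only [graphLength, h5, Finset.sum_add_distrib]
    rw [Finset.sum_comm]
  rw [h4, h6, Finset.sum_add_distrib, Finset.sum_const, Finset.card_univ,
    Nat.card_eq_fintype_card, smul_eq_mul, mul_one]
  omega

theorem isTreeLike_graft_iff (g : Graph k) : IsTreeLike (graft g S) ↔ IsTreeLike g := by
  have h1 := graphLength_graft S g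
  have j₀ : ∀ i, κ i := fun i => Classical.choice (S i).melonic.isTreeLike.nonempty
  constructor
  · intro h
    refine ⟨h.nonempty.map Sigma.fst, fun i j => ?_, by have := h.length; omega⟩
    exact (conn_graft_iff S g ⟨i, j₀ i⟩ ⟨j, j₀ j⟩).1 (h.conn _ _)
  · intro h
    exact ⟨h.nonempty.map fun i => ⟨i, j₀ i⟩, fun x y => (conn_graft_iff S g x y).2 (h.conn _ _),
      by have := h.length; omega⟩

/-- The tree obtained from `T` by replacing its elements by trees. -/
noncomputable def graftTree {k' : Deg D} (T : Tree k k') :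
    Tree (fun x : Σ i, κ i => K x.1 x.2) k' where
  graph := graft T.graph S
  melonic := ((isTreeLike_graft_iff S T.graph).2 T.melonic.isTreeLike).isMelonic
  cut c r := cutEmb S c (T.cut c r)
  cut_spec c y := by
    simp only [graft, (isTransversal_innerPerm S c).subst_sameCycle_iff,
      (isTransversal_innerPerm S c).cl_emb]
    exact T.cut_spec c _

theorem isGraft_graftTree {k' : Deg D} (T : Tree k k') : IsGraft T S (graftTree S T) where
  inner c i y hy := by
    change graft T.graph S c _ = _
    rw [graft, substPerm_of_notMem, innerPerm_apply]
    rintro ⟨⟨j, r⟩, h⟩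
    have h1 : j = i := congrArg (fun z => z.1.1) h
    obtain rfl := h1
    exact hy ⟨r, ungroup_injective c j h⟩
  outer c i j r s h := by
    change substPerm (innerPerm S c) (cutEmb S c) (T.graph c) (cutEmb S c ⟨i, r⟩) = _
    rw [substPerm_emb, h]
    rfl
  cut _ _ := rfl

end Graft

theorem exists_renaming {ι ι' : Type} {k : ι → Deg D} {k' : Deg D} {e : ι' → ι}
    (he : Function.Bijective e) (T : Tree k k') {g' : Graph fun i => k (e i)}
    (hcopy : IsCopy (k := k) e g' T.graph) :
    ∃ T' : Tree (fun i => k (e i)) k', T'.graph = g' ∧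
      IsRenaming (Equiv.ofBijective e he) T' T := by
  have hg := T.melonic.isTreeLike
  have := hg.finite
  let E : ∀ c, (Σ i, Fin (k (e i) c)) ≃ Σ i, Fin (k i c) := fun c =>
    Equiv.ofBijective _ (pairMap_bijective (k := k) he c)
  have hE : ∀ c x, pairMap (k := k) e ((E c).symm x) = x := fun c x =>
    (E c).apply_symm_apply x
  let T' : Tree (fun i => k (e i)) k' :=
    { graph := g'
      melonic := ((hcopy.isTreeLike_iff he).2 hg).isMelonic
      cut := fun c r => (E c).symm (T.cut c r)
      cut_spec := fun c x => by
        simp only [hcopy.sameCycle_iff he.1, hE]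
        exact T.cut_spec c _ }
  exact ⟨T', rfl, fun c x => hcopy c x, fun c r => (hE c (T.cut c r)).symm⟩

end TensorFree

/-! ### Moments under renaming and grafting. -/

namespace TensorialProbabilitySpace

set_option linter.unusedSectionVars false

variable {D : ℕ} (𝒜 : TensorialProbabilitySpace D)

theorem moment_graph {ι : Type} {k : ι → Deg D} {k' : Deg D} (T : Tree k k')
    (h : ∀ i, 𝒜.A (k i)) : 𝒜.moment T.graph h = 𝒜.φ k' (𝒜.mul T h) := by
  have H : ∃ (k'' : Deg D) (T' : Tree k k''), T'.graph = T.graph := ⟨k', T, rfl⟩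
  rw [moment, dif_pos H]
  exact 𝒜.trace_mul _ _ H.choose_spec.choose_spec h

/-- The default value `0`; thanks to it the compatibility with copies and grafts holds for all
graphs, melonic or not. -/
theorem moment_of_not_isTreeLike {ι : Type} {k : ι → Deg D} {g : Graph k} (hg : ¬ IsTreeLike g)
    (h : ∀ i, 𝒜.A (k i)) : 𝒜.moment g h = 0 := by
  rw [moment, dif_neg]
  rintro ⟨k', T, rfl⟩
  exact hg T.melonic.isTreeLike

theorem moment_copy {ι ι' : Type} {k : ι → Deg D} {e : ι' → ι} (he : Function.Bijective e)
    {g' : Graph fun i => k (e i)} {g : Graph k} (hcopy : IsCopy (k := k) e g' g)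
    (h : ∀ i, 𝒜.A (k i)) : 𝒜.moment g' (fun i => h (e i)) = 𝒜.moment g h := by
  by_cases hg : IsTreeLike g
  · obtain ⟨k', T, rfl⟩ := hg.isMelonic.exists_tree
    obtain ⟨T', rfl, hren⟩ := exists_renaming he T hcopy
    rw [moment_graph 𝒜 T, 𝒜.mul_rename (Equiv.ofBijective e he) T' T hren h]
    exact 𝒜.moment_graph T' fun i => h (e i)
  · rw [moment_of_not_isTreeLike 𝒜 hg,
      moment_of_not_isTreeLike 𝒜 (fun hg' => hg ((hcopy.isTreeLike_iff he).1 hg'))]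

theorem moment_graft {ι : Type} {κ : ι → Type} {K : ∀ i, κ i → Deg D} {k : ι → Deg D} [Finite ι]
    [∀ i, Finite (κ i)] (S : ∀ i, Tree (K i) (k i)) (g : Graph k)
    (h : ∀ x : Σ i, κ i, 𝒜.A (K x.1 x.2)) :
    𝒜.moment (graft g S) h = 𝒜.moment g fun i => 𝒜.mul (S i) fun j => h ⟨i, j⟩ := by
  by_cases hg : IsTreeLike g
  · obtain ⟨k', T, rfl⟩ := hg.isMelonic.exists_tree
    rw [moment_graph, ← 𝒜.mul_graft T S _ (isGraft_graftTree S T) h]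
    exact 𝒜.moment_graph (graftTree S T) h
  · rw [moment_of_not_isTreeLike 𝒜 hg,
      moment_of_not_isTreeLike 𝒜 (fun hg' => hg ((isTreeLike_graft_iff S g).1 hg'))]

end TensorialProbabilitySpace

namespace TensorFree

set_option linter.unusedSectionVars false

/-! ### Möbius sums over graphs. -/

section MoebiusSums

variable {D : ℕ} {ι : Type} [Fintype ι] {k : ι → Deg D}

/-- The product of the Moebius functions over all colours. -/
noncomputable def graphMoebius (w : Graph k) : ℂ := ∏ c, moebiusNC (w c)

open scoped Classical in
theorem sum_graph_eq_prod (P : ∀ c, Perm (Σ i, Fin (k i c)) → Prop)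
    (F : ∀ c, Perm (Σ i, Fin (k i c)) → ℂ) :
    ∑ w : Graph k with ∀ c, P c (w c), ∏ c, F c (w c) =
      ∏ c, ∑ σ : Perm (Σ i, Fin (k i c)) with P c σ, F c σ := by
  rw [Finset.prod_univ_sum]
  refine Finset.sum_congr ?_ fun _ _ => rfl
  ext w
  simp

open scoped Classical in
theorem sum_graphMoebius (v : Graph k) :
    ∑ w : Graph k with GraphLe w v, graphMoebius w = if v = fun _ => 1 then 1 else 0 := by
  have h := sum_graph_eq_prod (k := k) (fun c σ => NCLe σ (v c)) fun c σ => moebiusNC σ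
  have h' : ∑ w : Graph k with GraphLe w v, graphMoebius w =
      ∏ c, ∑ σ : Perm (Σ i, Fin (k i c)) with NCLe σ (v c), moebiusNC σ := by
    rw [← h]
    refine Finset.sum_congr (Finset.ext fun w => ?_) fun _ _ => rfl
    rw [Finset.mem_filter, Finset.mem_filter]
    rfl
  have h1 : ∀ c, ∑ σ : Perm (Σ i, Fin (k i c)) with NCLe σ (v c), moebiusNC σ =
      if v c = 1 then 1 else 0 := fun c => by convert sum_moebiusNC (v c)
  rw [h']
  simp only [h1]
  split_ifs with hv
  · subst hv
    simp
  · obtain ⟨c, hc⟩ : ∃ c, v c ≠ 1 := by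
      by_contra! h'
      exact hv (funext h')
    exact Finset.prod_eq_zero (Finset.mem_univ c) (if_neg hc)

open scoped Classical in
-- In each colour, `f ↦ u f⁻¹` carries the interval from `u` to `g` onto everything below `u g⁻¹`,
-- where the sum is known.
theorem sum_interval_graphMoebius (u g : Graph k) :
    ∑ f : Graph k with GraphLe u f ∧ GraphLe f g, graphMoebius (fun c => u c * (f c)⁻¹) =
      if u = g then 1 else 0 := by
  by_cases hug : GraphLe u g
  · have h := sum_graphMoebius fun c => u c * (g c)⁻¹
    have h1 : (fun c => u c * (g c)⁻¹) = (fun _ => 1) ↔ u = g := by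
      simp only [funext_iff, mul_inv_eq_one]
    simp only [h1] at h
    rw [← h]
    refine Finset.sum_bij' (fun f _ => fun c => u c * (f c)⁻¹) (fun w _ => fun c => (w c)⁻¹ * u c)
      ?_ ?_ ?_ ?_ ?_
    · intro f hf
      simp only [Finset.mem_filter, Finset.mem_univ, true_and] at hf ⊢
      exact fun c => (nCLe_interval_right.1 ⟨hf.1 c, hf.2 c⟩).2
    · intro w hw
      simp only [Finset.mem_filter, Finset.mem_univ, true_and] at hw ⊢
      have key : ∀ c, NCLe (u c) ((w c)⁻¹ * u c) ∧ NCLe ((w c)⁻¹ * u c) (g c) := fun c => by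
        refine nCLe_interval_right.2 ⟨hug c, ?_⟩
        have : u c * ((w c)⁻¹ * u c)⁻¹ = w c := by group
        rw [this]
        exact hw c
      exact ⟨fun c => (key c).1, fun c => (key c).2⟩
    · intro f _
      funext c
      group
    · intro w _
      funext c
      group
    · intro f _
      rfl
  · rw [if_neg (fun h : u = g => hug (h ▸ GraphLe.refl u)), Finset.sum_eq_zero]
    intro f hf
    simp only [Finset.mem_filter, Finset.mem_univ, true_and] at hf
    exact absurd (hf.1.trans hf.2) hug

theorem GraphLe.antisymm {f g : Graph k} (h : GraphLe f g) (h' : GraphLe g f) : f = g := by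
  by_contra hne
  have h1 := h.length_lt hne
  have h2 := h'.length_lt (Ne.symm hne)
  omega

end MoebiusSums

/-! ### Labels and the coefficients of the product formula. -/

section GraftLabels

variable {X Y : Type} [Fintype X] [Fintype Y] {ρ : Perm Y} {emb : X ↪ Y} {cl : Y → X}

open scoped Classical in
-- Conjugate `u G⁻¹` by `ρ` to obtain `v`. The `σ` of the sum correspond, through `σ τ⁻¹`, to the
-- permutations below `v` that fix every point off the transversal. At such points `v` agrees with
-- `ρ⁻¹ u`, which preserves labels. Hence a nonzero sum forces `v` to preserve all labels, and `G`
-- with it, since `u` and `ρ` do.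
theorem IsTransversal.label_subst_eq (h : IsTransversal ρ emb cl) {α : Type*} (a : Y → α)
    (hρ : ∀ y, a (ρ y) = a y) (u : Perm Y) (hu : ∀ y, a (u y) = a y) (τ : Perm X)
    (hle : NCLe u (substPerm ρ emb τ))
    (hne : ∑ σ : Perm X with NCLe σ τ ∧ NCLe u (substPerm ρ emb σ), moebiusNC (σ * τ⁻¹) ≠ 0)
    (y : Y) : a (substPerm ρ emb τ y) = a y := by
  set G := substPerm ρ emb τ with hG
  have hinv : ∀ y, a (ρ⁻¹ y) = a y := fun y => by
    rw [← hρ (ρ⁻¹ y), perm_apply_inv]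
  let v : Perm Y := ρ⁻¹ * (u * G⁻¹) * ρ
  have key : ∀ y, a (v y) = a y := by
    refine label_eq_of_sum_moebiusNC_ne_zero a (Finset.univ.filter fun y => y ∉ Set.range emb) v
      (fun y hy => ?_) ?_
    · have hy : y ∉ Set.range emb := by simpa using hy
      have h1 : G⁻¹ (ρ y) = y := by
        rw [Perm.inv_eq_iff_eq, hG, substPerm_of_notMem τ hy]
      simp only [v, Perm.mul_apply]
      rw [hinv, h1, hu]
    · convert hne using 1
      symm
      refine Finset.sum_bij (fun σ _ => (σ * τ⁻¹).viaEmbedding emb) ?_ ?_ ?_ ?_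
      · intro σ hσ
        simp only [Finset.mem_filter, Finset.mem_univ, true_and] at hσ ⊢
        have h1 := (nCLe_interval_left.1 ⟨hσ.2, (h.subst_nCLe_iff σ τ).2 hσ.1⟩).2
        rw [substPerm_mul_inv] at h1
        refine ⟨?_, fun x hx => Perm.viaEmbedding_apply_of_notMem _ _ _ hx⟩
        unfold NCLe at h1 ⊢
        rw [permLength_conj] at h1
        have e1 : (σ * τ⁻¹).viaEmbedding emb * v⁻¹ =
            ρ⁻¹ * (ρ * (σ * τ⁻¹).viaEmbedding emb * ρ⁻¹ * (u * G⁻¹)⁻¹) * ρ⁻¹⁻¹ := by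
          simp only [v]; group
        have e2 : v = ρ⁻¹ * (u * G⁻¹) * ρ⁻¹⁻¹ := by simp only [v]; group
        rw [e1, permLength_conj, e2, permLength_conj]
        exact h1
      · intro σ _ σ' _ hσ
        have := Perm.viaEmbeddingHom_injective emb hσ
        exact mul_right_cancel this
      · intro W hW
        simp only [Finset.mem_filter, Finset.mem_univ, true_and] at hW
        obtain ⟨w, rfl⟩ := exists_viaEmbedding_eq emb W hW.2
        refine ⟨w * τ, ?_, by rw [mul_inv_cancel_right]⟩
        simp only [Finset.mem_filter, Finset.mem_univ, true_and]
        have h1 : NCLe (substPerm ρ emb (w * τ) * G⁻¹) (u * G⁻¹) := by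
          rw [hG, substPerm_mul_inv, mul_inv_cancel_right, ← hG]
          have h2 := hW.1
          unfold NCLe at h2 ⊢
          have e1 : w.viaEmbedding emb * v⁻¹ =
              ρ⁻¹ * (ρ * w.viaEmbedding emb * ρ⁻¹ * (u * G⁻¹)⁻¹) * ρ⁻¹⁻¹ := by
            simp only [v]; group
          have e2 : v = ρ⁻¹ * (u * G⁻¹) * ρ⁻¹⁻¹ := by simp only [v]; group
          rw [e1, permLength_conj, e2, permLength_conj] at h2
          rw [permLength_conj]
          exact h2
        have h3 := nCLe_interval_left.2 ⟨hle, h1⟩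
        exact ⟨(h.subst_nCLe_iff _ _).1 h3.2, h3.1⟩
      · intro σ _
        rw [moebiusNC_viaEmbedding]
  have h1 := key (ρ⁻¹ (G y))
  simp only [v, Perm.mul_apply] at h1
  rw [perm_apply_inv, perm_inv_apply, hinv, hinv, hu] at h1
  exact h1.symm

end GraftLabels

end TensorFree

namespace TensorialProbabilitySpace

set_option linter.unusedSectionVars false

variable {D : ℕ} (𝒜 : TensorialProbabilitySpace D)

/-! ### Multiplicativity of the product of moments. -/

section Components

variable {ι ι' : Type} {k : ι → Deg D}

theorem moment_component_copy {e : ι' → ι} (he : Function.Injective e)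
    {f' : Graph fun i => k (e i)} {f : Graph k} (hcopy : IsCopy (k := k) e f' f)
    (q' : Quotient (conn f')) (q : Quotient (conn f))
    (hq : ∀ i, Quotient.mk (conn f') i = q' ↔ Quotient.mk (conn f) (e i) = q)
    (hr : ∀ i, Quotient.mk (conn f) i = q → i ∈ Set.range e) (h : ∀ i, 𝒜.A (k i)) :
    𝒜.moment (component f' q') (fun i => h (e i.1)) = 𝒜.moment (component f q) fun i => h i.1 := by
  let E : {i // Quotient.mk (conn f') i = q'} → {i // Quotient.mk (conn f) i = q} := fun i =>
    ⟨e i.1, (hq i.1).1 i.2⟩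
  have hE : Function.Bijective E := by
    constructor
    · intro i j hij
      exact Subtype.ext (he (congrArg Subtype.val hij))
    · rintro ⟨i, hi⟩
      obtain ⟨j, rfl⟩ := hr i hi
      exact ⟨⟨j, (hq j).2 hi⟩, rfl⟩
  have hc : IsCopy (k := k) (fun i : {i // Quotient.mk (conn f') i = q'} => e i.1)
      (component f' q') f :=
    hcopy.comp (isCopy_restrict f' _ (conn_edge f' q'))
  exact 𝒜.moment_copy (k := fun i : {i // Quotient.mk (conn f) i = q} => k i.1) (e := E) hE
    (IsCopy.of_comp (k := k) Subtype.val_injective (isCopy_restrict f _ (conn_edge f q)) hc)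
    fun i => h i.1

theorem momentProd_eq [Fintype ι] {g : Graph k} [Fintype (Quotient (conn g))]
    (h : ∀ i, 𝒜.A (k i)) :
    𝒜.momentProd g h = ∏ b : Quotient (conn g), 𝒜.moment (component g b) fun i => h i.1 := by
  rw [momentProd]
  congr!

theorem momentProd_copy [Fintype ι] [Fintype ι'] {e : ι' → ι} (he : Function.Bijective e)
    {f' : Graph fun i => k (e i)} {f : Graph k} (hcopy : IsCopy (k := k) e f' f)
    (h : ∀ i, 𝒜.A (k i)) : 𝒜.momentProd f' (fun i => h (e i)) = 𝒜.momentProd f h := by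
  classical
  rw [momentProd_eq, momentProd_eq]
  have hconn := fun i j => hcopy.conn_iff he.1 (i := i) (j := j)
  refine Fintype.prod_bijective
    (Quotient.map (sa := conn f') (sb := conn f) e fun i j => (hconn i j).1) ⟨?_, ?_⟩ _ _ ?_
  · intro a b hab
    obtain ⟨i, rfl⟩ := Quotient.exists_rep a
    obtain ⟨j, rfl⟩ := Quotient.exists_rep b
    exact Quotient.sound ((hconn i j).2 (Quotient.exact hab))
  · intro b
    obtain ⟨j, rfl⟩ := Quotient.exists_rep b
    obtain ⟨i, rfl⟩ := he.2 j
    exact ⟨Quotient.mk _ i, rfl⟩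
  · intro q
    obtain ⟨j, rfl⟩ := Quotient.exists_rep q
    refine 𝒜.moment_component_copy he.1 hcopy _ _ (fun i => ?_) (fun i _ => he.2 i) h
    exact ⟨fun hi => Quotient.sound ((hconn i j).1 (Quotient.exact hi)),
      fun hi => Quotient.sound ((hconn i j).2 (Quotient.exact hi))⟩

theorem momentProd_glue [Fintype ι] {p : ι → Prop} [Fintype {i // p i}] [Fintype {i // ¬ p i}]
    (f₁ : Graph fun i : {i // p i} => k i.1) (f₂ : Graph fun i : {i // ¬ p i} => k i.1)
    (h : ∀ i, 𝒜.A (k i)) :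
    𝒜.momentProd (glue p f₁ f₂) h =
      𝒜.momentProd f₁ (fun i => h i.1) * 𝒜.momentProd f₂ (fun i => h i.1) := by
  classical
  rw [momentProd_eq, momentProd_eq, momentProd_eq,
    ← Fintype.prod_bijective _ (conn_glue_bijective f₁ f₂) _ _ (fun _ => rfl), Fintype.prod_sum_type]
  have hp : ∀ c x, p (glue p f₁ f₂ c x).1 ↔ p x.1 := by
    intro c x
    have := (isCopy_glue_left f₁ f₂).fst_mem_range c x
    simpa using this
  congr 1
  · refine Finset.prod_congr rfl fun q _ => ?_
    obtain ⟨j, rfl⟩ := Quotient.exists_rep q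
    have hc := isCopy_glue_left f₁ f₂
    refine (𝒜.moment_component_copy Subtype.val_injective hc _ _ (fun i => ?_)
      (fun i hi => ?_) h).symm
    · exact ⟨fun hi => Quotient.sound ((hc.conn_iff Subtype.val_injective).1 (Quotient.exact hi)),
        fun hi => Quotient.sound ((hc.conn_iff Subtype.val_injective).2 (Quotient.exact hi))⟩
    · have := (conn_invariant hp (Quotient.exact hi : conn _ i j.1)).2 j.2
      exact ⟨⟨i, this⟩, rfl⟩
  · refine Finset.prod_congr rfl fun q _ => ?_
    obtain ⟨j, rfl⟩ := Quotient.exists_rep q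
    have hc := isCopy_glue_right f₁ f₂
    refine (𝒜.moment_component_copy Subtype.val_injective hc _ _ (fun i => ?_)
      (fun i hi => ?_) h).symm
    · exact ⟨fun hi => Quotient.sound ((hc.conn_iff Subtype.val_injective).1 (Quotient.exact hi)),
        fun hi => Quotient.sound ((hc.conn_iff Subtype.val_injective).2 (Quotient.exact hi))⟩
    · have := mt (conn_invariant hp (Quotient.exact hi : conn _ i j.1)).1 j.2
      exact ⟨⟨i, this⟩, rfl⟩

theorem momentProd_of_conn [Fintype ι] [Nonempty ι] {g : Graph k} (hg : ∀ i j, conn g i j)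
    (h : ∀ i, 𝒜.A (k i)) : 𝒜.momentProd g h = 𝒜.moment g h := by
  classical
  obtain ⟨i₀⟩ := ‹Nonempty ι›
  have hall : ∀ i, Quotient.mk (conn g) i = Quotient.mk (conn g) i₀ := fun i =>
    Quotient.sound (hg i i₀)
  rw [momentProd_eq, Fintype.prod_eq_single (Quotient.mk (conn g) i₀)]
  · refine 𝒜.moment_copy (k := k) (e := Subtype.val) ⟨Subtype.val_injective, fun i =>
      ⟨⟨i, hall i⟩, rfl⟩⟩ (isCopy_restrict g _ (conn_edge g _)) h
  · intro b hb
    obtain ⟨i, rfl⟩ := Quotient.exists_rep b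
    exact absurd (hall i) hb

end Components

/-! ### Products of moments of grafted graphs. -/

section GraftComponents

variable {ι : Type} {κ : ι → Type} {K : ∀ i, κ i → Deg D} {k : ι → Deg D} [Fintype ι]
  [∀ i, Fintype (κ i)]

theorem isCopy_graft_restrict (S : ∀ i, Tree (K i) (k i)) (g : Graph k) (p : ι → Prop)
    (hp : ∀ c x, p (g c x).1 ↔ p x.1) :
    IsCopy (k := fun x : Σ i, κ i => K x.1 x.2)
      (fun x : Σ i : {i // p i}, κ i.1 => (⟨x.1.1, x.2⟩ : Σ i, κ i))
      (graft (restrict g p hp) fun i : {i // p i} => S i.1) (graft g S) := by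
  intro c y
  by_cases hy : y ∈ Set.range (cutEmb (fun i : {i // p i} => S i.1) c)
  · obtain ⟨x, rfl⟩ := hy
    rw [graft, graft, substPerm_emb]
    have := substPerm_emb (ρ := innerPerm S c) (emb := cutEmb S c) (g c) (pairMap Subtype.val x)
    exact this
  · rw [graft, graft, substPerm_of_notMem _ hy, substPerm_of_notMem]
    · rfl
    · rintro ⟨⟨i, r⟩, hr⟩
      have h1 : i = y.1.1.1 := congrArg (fun z => z.1.1) hr
      have hi : p i := h1 ▸ y.1.1.2
      refine hy ⟨⟨⟨i, hi⟩, r⟩, ?_⟩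
      refine pairMap_injective (k := fun x : Σ i, κ i => K x.1 x.2)
        (e := fun x : Σ i : {i // p i}, κ i.1 => (⟨x.1.1, x.2⟩ : Σ i, κ i)) ?_ c hr
      rintro ⟨⟨i, hi⟩, j⟩ ⟨⟨i', hi'⟩, j'⟩ hij
      simp only [Sigma.mk.injEq] at hij
      obtain ⟨rfl, hij⟩ := hij
      rw [eq_of_heq hij]

/-- The components of a graft are the grafts of the components, and associativity applies to each of
them. -/
theorem momentProd_graft (S : ∀ i, Tree (K i) (k i)) (g : Graph k)
    (h : ∀ x : Σ i, κ i, 𝒜.A (K x.1 x.2)) :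
    𝒜.momentProd (graft g S) h = 𝒜.momentProd g fun i => 𝒜.mul (S i) fun j => h ⟨i, j⟩ := by
  classical
  rw [momentProd_eq, momentProd_eq]
  have hconn := conn_graft_iff S g
  have j₀ : ∀ i, κ i := fun i => Classical.choice (S i).melonic.isTreeLike.nonempty
  refine Fintype.prod_bijective (Quotient.map (sa := conn (graft g S)) (sb := conn g) Sigma.fst
    fun x y => (hconn x y).1) ⟨?_, ?_⟩ _ _ ?_
  · intro a b hab
    obtain ⟨x, rfl⟩ := Quotient.exists_rep a
    obtain ⟨y, rfl⟩ := Quotient.exists_rep b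
    exact Quotient.sound ((hconn x y).2 (Quotient.exact hab))
  · intro b
    obtain ⟨i, rfl⟩ := Quotient.exists_rep b
    exact ⟨Quotient.mk _ ⟨i, j₀ i⟩, rfl⟩
  · intro q
    obtain ⟨x, rfl⟩ := Quotient.exists_rep q
    set q : Quotient (conn g) := Quotient.mk (conn g) x.1 with hq
    have hx : ∀ y : Σ i, κ i, Quotient.mk (conn (graft g S)) y = Quotient.mk _ x ↔
        Quotient.mk (conn g) y.1 = q := fun y =>
      ⟨fun hy => Quotient.sound ((hconn y x).1 (Quotient.exact hy)),
        fun hy => Quotient.sound ((hconn y x).2 (Quotient.exact hy))⟩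
    let E : (Σ i : {i // Quotient.mk (conn g) i = q}, κ i.1) →
        {y : Σ i, κ i // Quotient.mk (conn (graft g S)) y = Quotient.mk _ x} := fun y =>
      ⟨⟨y.1.1, y.2⟩, (hx _).2 y.1.2⟩
    have hE : Function.Bijective E := by
      constructor
      · rintro ⟨⟨i, hi⟩, j⟩ ⟨⟨i', hi'⟩, j'⟩ hij
        have hij := congrArg Subtype.val hij
        simp only [E, Sigma.mk.injEq] at hij
        obtain ⟨rfl, hij⟩ := hij
        rw [eq_of_heq hij]
      · rintro ⟨⟨i, j⟩, hi⟩
        exact ⟨⟨⟨i, (hx _).1 hi⟩, j⟩, rfl⟩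
    have hc := isCopy_graft_restrict S g (fun i => Quotient.mk (conn g) i = q) (conn_edge g q)
    have h1 := 𝒜.moment_copy (k := fun y : {y : Σ i, κ i //
        Quotient.mk (conn (graft g S)) y = Quotient.mk _ x} => K y.1.1 y.1.2) (e := E) hE
      (IsCopy.of_comp (k := fun x : Σ i, κ i => K x.1 x.2) Subtype.val_injective
        (isCopy_restrict (graft g S) _ (conn_edge (graft g S) (Quotient.mk _ x))) hc)
      fun y => h y.1
    refine h1.symm.trans ?_
    exact 𝒜.moment_graft (fun i : {i // Quotient.mk (conn g) i = q} => S i.1)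
      (component g q) fun y => h ⟨y.1.1, y.2⟩

end GraftComponents

end TensorialProbabilitySpace

/-! ### Unmixed graphs, and span induction in several arguments. -/

namespace TensorFree

/-- All the edges of the graph join elements with the same label. -/
def IsMono {D : ℕ} {ι : Type} {k : ι → Deg D} {α : Type*} (a : ι → α) (g : Graph k) : Prop :=
  ∀ c x, a (g c x).1 = a x.1

theorem IsMono.conn {D : ℕ} {ι : Type} {k : ι → Deg D} {α : Type*} {a : ι → α} {g : Graph k}
    (h : IsMono a g) {i j : ι} (hij : TensorFree.conn g i j) : a i = a j :=
  conn_map_eq a h hij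

theorem graphLe_one {D : ℕ} {ι : Type} [Finite ι] {k : ι → Deg D} {f : Graph k}
    (h : GraphLe f fun _ => 1) : f = fun _ => 1 :=
  funext fun c => Equiv.ext fun _ => (h c).apply_eq_self rfl

open scoped Classical in
-- Only linearity in each argument separately is asked for, so that cumulants, which are not bundled
-- as multilinear maps, are covered as well as products.
theorem mem_of_forall_mem_span {ι : Type*} [Finite ι] {M : ι → Type*} {N : Type*}
    [∀ i, AddCommGroup (M i)] [∀ i, Module ℂ (M i)] [AddCommGroup N] [Module ℂ N]
    (F : (∀ i, M i) → N) (W : Submodule ℂ N)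
    (hF : ∀ h i, ∃ L : M i →ₗ[ℂ] N, ∀ x, F (Function.update h i x) = L x) (s : ∀ i, Set (M i))
    (h0 : ∀ h, (∀ i, h i ∈ s i) → F h ∈ W) (h : ∀ i, M i)
    (hh : ∀ i, h i ∈ Submodule.span ℂ (s i)) : F h ∈ W := by
  have := Fintype.ofFinite ι
  suffices H : ∀ (t : Finset ι) (h : ∀ i, M i), (∀ i ∈ t, h i ∈ Submodule.span ℂ (s i)) →
      (∀ i ∉ t, h i ∈ s i) → F h ∈ W from
    H Finset.univ h (fun i _ => hh i) fun i hi => absurd (Finset.mem_univ i) hi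
  intro t
  induction t using Finset.induction_on with
  | empty => exact fun h _ h2 => h0 h fun i => h2 i (Finset.notMem_empty i)
  | insert i t hi ih =>
    intro h h1 h2
    obtain ⟨L, hL⟩ := hF h i
    have hker : Submodule.span ℂ (s i) ≤ W.comap L := by
      refine Submodule.span_le.2 fun x hx => ?_
      rw [SetLike.mem_coe, Submodule.mem_comap, ← hL]
      refine ih _ (fun j hj => ?_) fun j hj => ?_
      · rw [Function.update_of_ne (by rintro rfl; exact hi hj)]
        exact h1 j (Finset.mem_insert_of_mem hj)
      · by_cases hji : j = i
        · subst hji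
          rw [Function.update_self]
          exact hx
        · rw [Function.update_of_ne hji]
          exact h2 j fun h => (Finset.mem_insert.1 h).elim hji hj
    rw [← Function.update_eq_self i h, hL]
    exact hker (h1 i (Finset.mem_insert_self i t))

end TensorFree

namespace TensorialProbabilitySpace

set_option linter.unusedSectionVars false

variable {D : ℕ} (𝒜 : TensorialProbabilitySpace D)

open scoped Classical

/-! ### Möbius inversion between moments and cumulants. -/

section Inversion

variable {ι : Type} [Fintype ι] {k : ι → Deg D}

theorem cumulant_eq (g : Graph k) (h : ∀ i, 𝒜.A (k i)) : 𝒜.cumulant g h =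
    ∑ f : Graph k with GraphLe f g, 𝒜.momentProd f h * graphMoebius fun c => f c * (g c)⁻¹ := by
  rw [cumulant]
  refine Finset.sum_congr (Finset.ext fun w => ?_) fun _ _ => rfl
  rw [Finset.mem_filter, Finset.mem_filter]
  rfl

theorem sum_momentProd_eq (g : Graph k) (h : ∀ i, 𝒜.A (k i)) (w : Graph k → ℂ) :
    ∑ f : Graph k with GraphLe f g, 𝒜.cumulant f h * w f =
      ∑ u : Graph k with GraphLe u g, 𝒜.momentProd u h *
        ∑ f : Graph k with GraphLe u f ∧ GraphLe f g,
          graphMoebius (fun c => u c * (f c)⁻¹) * w f := by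
  simp only [cumulant_eq, Finset.mul_sum, Finset.sum_mul]
  rw [Finset.sum_comm' (s' := fun u : Graph k => Finset.univ.filter fun f : Graph k =>
    GraphLe u f ∧ GraphLe f g) (t' := Finset.univ.filter fun u : Graph k => GraphLe u g)]
  · exact Finset.sum_congr rfl fun _ _ => Finset.sum_congr rfl fun _ _ => mul_assoc _ _ _
  · intro f u
    simp only [Finset.mem_filter, Finset.mem_univ, true_and]
    exact ⟨fun h => ⟨⟨h.2, h.1⟩, h.2.trans h.1⟩, fun h => ⟨h.1.2, h.1.1⟩⟩

/-- Möbius inversion. -/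
theorem momentProd_eq_sum (g : Graph k) (h : ∀ i, 𝒜.A (k i)) :
    𝒜.momentProd g h = ∑ f : Graph k with GraphLe f g, 𝒜.cumulant f h := by
  have h1 := 𝒜.sum_momentProd_eq g h fun _ => 1
  simp only [_root_.mul_one] at h1
  rw [h1]
  simp only [sum_interval_graphMoebius]
  rw [Finset.sum_eq_single g]
  · rw [if_pos rfl, _root_.mul_one]
  · intro u _ hu
    rw [if_neg hu, mul_zero]
  · intro hg
    simp [GraphLe.refl] at hg

theorem momentProd_eq_cumulant (g : Graph k) (h : ∀ i, 𝒜.A (k i))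
    (h0 : ∀ f, GraphLe f g → f ≠ g → 𝒜.cumulant f h = 0) :
    𝒜.momentProd g h = 𝒜.cumulant g h := by
  rw [momentProd_eq_sum, Finset.sum_eq_single g]
  · intro f hf hne
    exact h0 f (Finset.mem_filter.1 hf).2 hne
  · intro hg
    simp [GraphLe.refl] at hg

theorem momentProd_eq_zero (g : Graph k) (h : ∀ i, 𝒜.A (k i))
    (h0 : ∀ f, GraphLe f g → 𝒜.cumulant f h = 0) : 𝒜.momentProd g h = 0 := by
  rw [momentProd_eq_sum]
  exact Finset.sum_eq_zero fun f hf => h0 f (Finset.mem_filter.1 hf).2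

end Inversion

/-! ### Multilinearity. -/

section Linearity

variable {ι : Type} {k : ι → Deg D}

theorem exists_moment_update (g : Graph k) (h : ∀ i, 𝒜.A (k i)) (i : ι) :
    ∃ L : 𝒜.A (k i) →ₗ[ℂ] ℂ, ∀ x, 𝒜.moment g (Function.update h i x) = L x := by
  by_cases hg : IsMelonic g
  · obtain ⟨k', T, rfl⟩ := hg.exists_tree
    refine ⟨(𝒜.φ k').comp ((𝒜.mul T).toLinearMap h i), fun x => ?_⟩
    rw [moment_graph]
    rfl
  · exact ⟨0, fun x => 𝒜.moment_of_not_isTreeLike (fun h => hg h.isMelonic) _⟩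

variable [Fintype ι]

/-- The element `i` belongs to exactly one component, so only one factor depends on it. -/
theorem exists_momentProd_update (g : Graph k) (h : ∀ i, 𝒜.A (k i)) (i : ι) :
    ∃ L : 𝒜.A (k i) →ₗ[ℂ] ℂ, ∀ x, 𝒜.momentProd g (Function.update h i x) = L x := by
  obtain ⟨L, hL⟩ := 𝒜.exists_moment_update (component g (Quotient.mk _ i)) (fun j => h j.1)
    ⟨i, rfl⟩
  refine ⟨(∏ b ∈ Finset.univ.erase (Quotient.mk (conn g) i),
    𝒜.moment (component g b) fun j => h j.1) • L, fun x => ?_⟩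
  rw [momentProd_eq, ← Finset.prod_erase_mul _ _ (Finset.mem_univ (Quotient.mk (conn g) i)),
    LinearMap.smul_apply, smul_eq_mul, ← hL]
  congr 1
  · refine Finset.prod_congr rfl fun b hb => ?_
    congr 1
    funext j
    refine Function.update_of_ne (fun hj => ?_) _ _
    exact (Finset.mem_erase.1 hb).1 (by rw [← j.2, hj])
  · congr 1
    funext j
    obtain ⟨j, hj⟩ := j
    by_cases hji : j = i
    · subst hji
      simp
    · simp [Function.update, hji]

theorem exists_cumulant_update (g : Graph k) (h : ∀ i, 𝒜.A (k i)) (i : ι) :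
    ∃ L : 𝒜.A (k i) →ₗ[ℂ] ℂ, ∀ x, 𝒜.cumulant g (Function.update h i x) = L x := by
  choose L hL using fun f => 𝒜.exists_momentProd_update (k := k) f h i
  refine ⟨∑ f : Graph k with GraphLe f g, (graphMoebius fun c => f c * (g c)⁻¹) • L f,
    fun x => ?_⟩
  rw [cumulant_eq, LinearMap.sum_apply]
  exact Finset.sum_congr rfl fun f _ => by rw [hL, LinearMap.smul_apply, smul_eq_mul, mul_comm]

theorem cumulant_sub_smul (g : Graph k) (h : ∀ i, 𝒜.A (k i)) (i : ι) (x y : 𝒜.A (k i)) (z : ℂ) :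
    𝒜.cumulant g (Function.update h i (x - z • y)) =
      𝒜.cumulant g (Function.update h i x) - z * 𝒜.cumulant g (Function.update h i y) := by
  obtain ⟨L, hL⟩ := 𝒜.exists_cumulant_update g h i
  rw [hL, hL, hL, map_sub, map_smul, smul_eq_mul]

theorem cumulant_eq_zero_of_apply_eq_zero (g : Graph k) (h : ∀ i, 𝒜.A (k i)) (i : ι)
    (hi : h i = 0) : 𝒜.cumulant g h = 0 := by
  obtain ⟨L, hL⟩ := 𝒜.exists_cumulant_update g h i
  rw [← Function.update_eq_self i h, hL, hi, map_zero]

/-- A cumulant vanishes on a product of spans if it vanishes on the generators. -/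
theorem cumulant_eq_zero_of_span (g : Graph k) (s : ∀ i, Set (𝒜.A (k i)))
    (h0 : ∀ h : ∀ i, 𝒜.A (k i), (∀ i, h i ∈ s i) → 𝒜.cumulant g h = 0) (h : ∀ i, 𝒜.A (k i))
    (hh : ∀ i, h i ∈ Submodule.span ℂ (s i)) : 𝒜.cumulant g h = 0 :=
  (Submodule.mem_bot ℂ).1 (mem_of_forall_mem_span (𝒜.cumulant g) ⊥ (𝒜.exists_cumulant_update g) s
    (fun h hs => (Submodule.mem_bot ℂ).2 (h0 h hs)) h hh)

end Linearity

/-! ### Cumulants of copies and of disjoint unions. -/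

section Copies

variable {ι ι' : Type} [Fintype ι] [Fintype ι'] {k : ι → Deg D}

theorem cumulant_copy {e : ι' → ι} (he : Function.Bijective e)
    {g' : Graph fun i => k (e i)} {g : Graph k} (hcopy : IsCopy (k := k) e g' g)
    (h : ∀ i, 𝒜.A (k i)) : 𝒜.cumulant g' (fun i => h (e i)) = 𝒜.cumulant g h := by
  let E : ∀ c, (Σ i, Fin (k (e i) c)) ≃ Σ i, Fin (k i c) := fun c =>
    Equiv.ofBijective _ (pairMap_bijective (k := k) he c)
  have hE : ∀ f' : Graph fun i => k (e i),
      IsCopy (k := k) e f' fun c => (E c).permCongr (f' c) := fun f' c x => by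
    have h1 : (E c).symm (pairMap (k := k) e x) = x := by
      rw [Equiv.symm_apply_eq]; rfl
    rw [Equiv.permCongr_apply, h1]
    rfl
  have hg : g = fun c => (E c).permCongr (g' c) := funext fun c => Equiv.ext fun x => by
    obtain ⟨x, rfl⟩ := (pairMap_bijective (k := k) he c).2 x
    rw [hcopy, hE]
  have hmul : ∀ (f' : Graph fun i => k (e i)) c, (E c).permCongr (f' c) * (g c)⁻¹ =
      (E c).permCongr (f' c * (g' c)⁻¹) := fun f' c => by
    rw [hg]
    ext1 x
    obtain ⟨x, rfl⟩ := (E c).surjective x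
    simp only [Equiv.permCongr_apply, Perm.mul_apply, Perm.inv_def, Equiv.symm_apply_apply]
    congr 2
    rw [Equiv.symm_apply_eq, Equiv.symm_apply_eq]
    simp [Equiv.permCongr_apply]
  rw [cumulant_eq, cumulant_eq]
  refine Finset.sum_bij' (fun f' _ => fun c => (E c).permCongr (f' c))
    (fun f _ => fun c => (E c).symm.permCongr (f c)) ?_ ?_ ?_ ?_ ?_
  · intro f' hf'
    simp only [Finset.mem_filter, Finset.mem_univ, true_and] at hf' ⊢
    intro c
    have := hf' c
    unfold NCLe at this ⊢
    rw [hmul, permLength_permCongr, permLength_permCongr, this, hg, permLength_permCongr]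
  · intro f hf
    simp only [Finset.mem_filter, Finset.mem_univ, true_and] at hf ⊢
    intro c
    have := hf c
    have h1 : f c = (E c).permCongr ((E c).symm.permCongr (f c)) := by ext1 x; simp
    unfold NCLe at this ⊢
    have h2 := hmul (fun c => (E c).symm.permCongr (f c)) c
    rw [h1, h2, permLength_permCongr, permLength_permCongr, permLength_permCongr, hg] at this
    simp only [permLength_permCongr] at this ⊢
    exact this
  · intro f' _
    funext c
    ext1 x
    simp
  · intro f _
    funext c
    ext1 x
    simp
  · intro f' _
    rw [𝒜.momentProd_copy he (hE f') h]
    congr 1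
    refine Finset.prod_congr rfl fun c _ => ?_
    simp only
    rw [hmul, moebiusNC_permCongr]

/-- A graph below a disjoint union cannot join the two parts, so the interval below it is a product,
over which moments and Möbius function are multiplicative. -/
theorem cumulant_glue {p : ι → Prop} [Fintype {i // p i}] [Fintype {i // ¬ p i}] (g₁ : Graph fun i : {i // p i} => k i.1)
    (g₂ : Graph fun i : {i // ¬ p i} => k i.1) (h : ∀ i, 𝒜.A (k i)) :
    𝒜.cumulant (glue p g₁ g₂) h =
      𝒜.cumulant g₁ (fun i => h i.1) * 𝒜.cumulant g₂ (fun i => h i.1) := by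
  rw [cumulant_eq, cumulant_eq, cumulant_eq, Finset.sum_mul_sum, ← Finset.sum_product']
  symm
  refine Finset.sum_bij (fun f _ => glue p f.1 f.2) ?_ ?_ ?_ ?_
  · intro f hf
    simp only [Finset.mem_product, Finset.mem_filter, Finset.mem_univ, true_and] at hf ⊢
    exact graphLe_glue.2 hf
  · intro f _ f' _ hff
    exact Prod.ext (glue_injective hff).1 (glue_injective hff).2
  · intro f hf
    simp only [Finset.mem_filter, Finset.mem_univ, true_and] at hf
    have hp : ∀ c x, p (f c x).1 ↔ p x.1 := fun c x => by
      refine (conn_invariant (g := glue p g₁ g₂) (fun c x => ?_) (hf.conn (conn_apply f c x))).symm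
      simpa using (isCopy_glue_left g₁ g₂).fst_mem_range c x
    refine ⟨(restrict f p hp, restrict f (fun i => ¬ p i) fun c x => not_congr (hp c x)), ?_,
      glue_restrict f hp⟩
    simp only [Finset.mem_product, Finset.mem_filter, Finset.mem_univ, true_and]
    rw [← graphLe_glue, glue_restrict]
    exact hf
  · intro f _
    rw [momentProd_glue]
    simp only [graphMoebius, moebiusNC_glue_mul_inv, Finset.prod_mul_distrib]
    ring

theorem cumulant_eq_zero_of_component {g : Graph k} (b : Quotient (conn g))
    [Fintype {i // Quotient.mk (conn g) i = b}]
    (h : ∀ i, 𝒜.A (k i)) (h0 : 𝒜.cumulant (component g b) (fun i => h i.1) = 0) :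
    𝒜.cumulant g h = 0 := by
  rw [← glue_restrict g (p := fun i => Quotient.mk _ i = b) (conn_edge g b), cumulant_glue]
  exact mul_eq_zero_of_left h0 _

theorem moment_of_unique [Unique ι] (h : ∀ i, 𝒜.A (k i)) :
    𝒜.moment (fun _ => 1 : Graph k) h = 𝒜.φ (k default) (h default) := by
  let T : Tree (fun _ : Unit => k default) (k default) :=
    { graph := fun _ => 1
      melonic := IsMelonic.single _
      cut := fun c r => ⟨(), r⟩
      cut_spec := fun c x => ⟨x.2, (Perm.SameCycle.refl _ _), fun r hr => by
        have hr := Perm.sameCycle_one.1 hr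
        rw [← hr]⟩ }
  have h1 := 𝒜.moment_copy (k := k) (e := fun _ : Unit => default) (g' := T.graph)
    (g := fun _ => 1) ⟨fun _ _ _ => rfl, fun i => ⟨(), (Subsingleton.elim _ _)⟩⟩
    (fun c x => rfl) h
  rw [← h1, moment_graph, 𝒜.mul_single T fun _ _ => rfl]

theorem cumulant_of_unique [Unique ι] (h : ∀ i, 𝒜.A (k i)) :
    𝒜.cumulant (fun _ => 1 : Graph k) h = 𝒜.φ (k default) (h default) := by
  rw [← momentProd_eq_cumulant, momentProd_of_conn, moment_of_unique]
  · intro i j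
    rw [Subsingleton.elim i j]
  · exact fun f hf hne => absurd (graphLe_one hf) hne

theorem cumulant_eq_zero_of_isolated {g : Graph k} (l : ι) (hl : ∀ c r, g c ⟨l, r⟩ = ⟨l, r⟩)
    (h : ∀ i, 𝒜.A (k i)) (h0 : 𝒜.φ (k l) (h l) = 0) : 𝒜.cumulant g h = 0 := by
  have hp : ∀ c x, (g c x).1 = l ↔ x.1 = l := by
    intro c x
    constructor
    · intro hx
      generalize hy : g c x = y at hx
      obtain ⟨i, r⟩ := y
      subst hx
      exact congrArg Sigma.fst ((g c).injective (hy.trans (hl c r).symm))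
    · obtain ⟨i, r⟩ := x
      rintro rfl
      rw [hl]
  rw [← glue_restrict g (p := (· = l)) hp, cumulant_glue]
  refine mul_eq_zero_of_left ?_ _
  have h1 : restrict g (· = l) hp = fun _ => 1 := by
    funext c
    ext1 x
    refine pairMap_injective (k := k) Subtype.val_injective c ?_
    rw [← isCopy_restrict g (· = l) hp]
    obtain ⟨⟨i, rfl⟩, r⟩ := x
    exact hl c r
  rw [h1, cumulant_of_unique]
  exact h0

end Copies

/-! ### Cumulants of products. -/

section Graft

variable {ι : Type} {κ : ι → Type} {K : ∀ i, κ i → Deg D} {k : ι → Deg D} [Fintype ι]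
  [∀ i, Fintype (κ i)]

theorem graphLe_graft (S : ∀ i, Tree (K i) (k i)) (f g : Graph k) :
    GraphLe (graft f S) (graft g S) ↔ GraphLe f g :=
  forall_congr' fun c => (isTransversal_innerPerm S c).subst_nCLe_iff _ _

/-- The cumulant of products as a combination of cumulants of the factors. -/
theorem cumulant_graft_eq_sum (S : ∀ i, Tree (K i) (k i)) (g : Graph k)
    (h : ∀ x : Σ i, κ i, 𝒜.A (K x.1 x.2)) :
    𝒜.cumulant g (fun i => 𝒜.mul (S i) fun j => h ⟨i, j⟩) =
      ∑ u : Graph fun x : Σ i, κ i => K x.1 x.2 with GraphLe u (graft g S),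
        (∑ f : Graph k with GraphLe f g ∧ GraphLe u (graft f S),
          graphMoebius fun c => f c * (g c)⁻¹) * 𝒜.cumulant u h := by
  have h1 : ∀ f : Graph k, 𝒜.momentProd f (fun i => 𝒜.mul (S i) fun j => h ⟨i, j⟩) =
      ∑ u : Graph fun x : Σ i, κ i => K x.1 x.2 with GraphLe u (graft f S), 𝒜.cumulant u h :=
    fun f => by
      rw [← momentProd_graft, momentProd_eq_sum]
      congr!
  rw [cumulant_eq]
  simp only [h1, Finset.sum_mul]
  rw [Finset.sum_comm' (s' := fun u => Finset.univ.filter fun f : Graph k =>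
    GraphLe f g ∧ GraphLe u (graft f S)) (t' := Finset.univ.filter fun u => GraphLe u (graft g S))]
  rotate_left
  · intro f u
    simp only [Finset.mem_filter, Finset.mem_univ, true_and]
    exact ⟨fun h => ⟨⟨h.1, h.2⟩, h.2.trans ((graphLe_graft S f g).2 h.1)⟩, fun h => h.1⟩
  · exact Finset.sum_congr rfl fun _ _ => Finset.sum_congr rfl fun _ _ => mul_comm _ _

/-- The sum factorizes over the colours, and each factor is the situation of
`IsTransversal.label_subst_eq`, a factor of a product carrying the label of the product. -/
theorem isMono_of_sum_ne_zero {α : Type*} {a : ι → α} (S : ∀ i, Tree (K i) (k i)) (g : Graph k)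
    {u : Graph fun x : Σ i, κ i => K x.1 x.2} (hle : GraphLe u (graft g S))
    (hu : IsMono (fun x : Σ i, κ i => a x.1) u)
    (hne : ∑ f : Graph k with GraphLe f g ∧ GraphLe u (graft f S),
      graphMoebius (fun c => f c * (g c)⁻¹) ≠ 0) : IsMono a g := by
  have h1 : ∑ f : Graph k with GraphLe f g ∧ GraphLe u (graft f S),
      graphMoebius (fun c => f c * (g c)⁻¹) = ∏ c, ∑ σ : Perm (Σ i, Fin (k i c)) with
        NCLe σ (g c) ∧ NCLe (u c) (substPerm (innerPerm S c) (cutEmb S c) σ),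
          moebiusNC (σ * (g c)⁻¹) := by
    have h2 := sum_graph_eq_prod (fun c σ => NCLe σ (g c) ∧
      NCLe (u c) (substPerm (innerPerm S c) (cutEmb S c) σ)) fun c σ => moebiusNC (σ * (g c)⁻¹)
    refine Eq.trans ?_ (h2.trans (Finset.prod_congr rfl fun c _ => by congr!))
    refine Finset.sum_congr (Finset.ext fun w => ?_) fun _ _ => rfl
    simp only [Finset.mem_filter, Finset.mem_univ, true_and]
    exact forall_and.symm
  rw [h1] at hne
  intro c x
  have h2 := (isTransversal_innerPerm S c).label_subst_eq (fun y => a y.1.1) (fun y => rfl) (u c)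
    (fun y => hu c y) (g c) (hle c) (by
      have := Finset.prod_ne_zero_iff.1 hne c (Finset.mem_univ c)
      convert this) (cutEmb S c x)
  rw [substPerm_emb] at h2
  exact h2

/-- Unmixed `u` have coefficient zero because `g` is mixed, and proper mixed `u` have cumulant zero
by `h0`. The top term has coefficient one, as only `f = g` occurs in it. -/
theorem cumulant_graft_of_not_isMono {α : Type*} {a : ι → α} (S : ∀ i, Tree (K i) (k i))
    (g : Graph k) (hg : ¬ IsMono a g) (h : ∀ x : Σ i, κ i, 𝒜.A (K x.1 x.2))
    (h0 : ∀ u, GraphLe u (graft g S) → u ≠ graft g S → ¬ IsMono (fun x : Σ i, κ i => a x.1) u →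
      𝒜.cumulant u h = 0) :
    𝒜.cumulant g (fun i => 𝒜.mul (S i) fun j => h ⟨i, j⟩) = 𝒜.cumulant (graft g S) h := by
  rw [cumulant_graft_eq_sum, Finset.sum_eq_single (graft g S)]
  · have h1 : (Finset.univ.filter fun f : Graph k =>
        GraphLe f g ∧ GraphLe (graft g S) (graft f S)) = {g} := by
      ext f
      simp only [Finset.mem_filter, Finset.mem_univ, true_and, Finset.mem_singleton, graphLe_graft]
      exact ⟨fun h => h.1.antisymm h.2, fun h => h ▸ ⟨GraphLe.refl _, GraphLe.refl _⟩⟩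
    rw [h1, Finset.sum_singleton]
    simp [graphMoebius, moebiusNC_one]
  · intro u hu hne
    have hu := (Finset.mem_filter.1 hu).2
    by_cases hm : IsMono (fun x : Σ i, κ i => a x.1) u
    · refine mul_eq_zero_of_left ?_ _
      by_contra hs
      exact hg (isMono_of_sum_ne_zero S g hu hm hs)
    · rw [h0 u hu hne hm, mul_zero]
  · intro hg
    simp [GraphLe.refl] at hg

end Graft

end TensorialProbabilitySpace

namespace TensorFree

set_option linter.unusedSectionVars false

/-! ### Contracting components. -/

section Contraction

variable {D : ℕ} {ι : Type} {k : ι → Deg D}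

theorem classMap_bijective (s : Setoid ι) :
    Function.Bijective fun x : Σ b : Quotient s, {i // Quotient.mk s i = b} => x.2.1 := by
  constructor
  · rintro ⟨b, i, rfl⟩ ⟨b', i', rfl⟩ h
    obtain rfl : i = i' := h
    rfl
  · exact fun i => ⟨⟨Quotient.mk s i, i, rfl⟩, rfl⟩

/-- If `e` has melonic components and `f` differs from `e` only at the points of a transversal of
the cycles of `e`, then `f` is obtained by grafting the components of `e` onto a graph of these
components. -/
theorem exists_graft [Finite ι] {e f : Graph k} (he : IsForest e)
    (C : ∀ c, Set (Σ i, Fin (k i c)))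
    (hC : ∀ c x, ∃ y ∈ C c, (e c).SameCycle y x)
    (hC' : ∀ c, ∀ x ∈ C c, ∀ y ∈ C c, (e c).SameCycle x y → x = y)
    (hf : ∀ c, ∀ x ∉ C c, f c x = e c x) :
    ∃ (k' : Quotient (conn e) → Deg D)
      (S : ∀ b, Tree (fun i : {i // Quotient.mk (conn e) i = b} => k i.1) (k' b)) (g : Graph k'),
      (∀ b, (S b).graph = component e b) ∧
      (∀ b c x, (S b).IsCut c x ↔ pairMap (k := k) Subtype.val x ∈ C c) ∧
      IsCopy (k := k) (fun x : Σ b, {i // Quotient.mk (conn e) i = b} => x.2.1) (graft g S) f := by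
  have hcomp : ∀ b, IsCopy (k := k) Subtype.val (component e b) e := fun b =>
    isCopy_restrict e _ (conn_edge e b)
  have h1 : ∀ b c (q : Quotient (Perm.SameCycle.setoid (component e b c))),
      ∃ x, Quotient.mk _ x = q ∧ pairMap (k := k) Subtype.val x ∈ C c := by
    intro b c q
    obtain ⟨x, rfl⟩ := Quotient.exists_rep q
    obtain ⟨y, hy, hyx⟩ := hC c (pairMap Subtype.val x)
    have hyb : Quotient.mk (conn e) y.1 = b :=
      (Quotient.sound (conn_of_sameCycle hyx)).trans x.1.2
    refine ⟨⟨⟨y.1, hyb⟩, y.2⟩, Quotient.sound (s := Perm.SameCycle.setoid _)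
      (show (component e b c).SameCycle _ _ from ?_), hy⟩
    exact ((hcomp b).sameCycle_iff Subtype.val_injective _ _).2 hyx
  choose rep hrep hrepC using h1
  have h2 : ∀ b, ∃ (k' : Deg D) (T : Tree (fun i : {i // Quotient.mk (conn e) i = b} => k i.1) k'),
      T.graph = component e b ∧
        ∀ c x, T.IsCut c x ↔ pairMap (k := k) Subtype.val x ∈ C c := by
    intro b
    obtain ⟨k', T, hT, hcut⟩ := exists_tree (he.component b).isMelonic (rep b) (hrep b)
    refine ⟨k', T, hT, fun c x => (hcut c x).trans ⟨?_, fun hx => ?_⟩⟩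
    · rintro ⟨q, rfl⟩
      exact hrepC b c q
    · refine ⟨Quotient.mk _ x, pairMap_injective (k := k) Subtype.val_injective c
        (hC' c _ (hrepC b c _) _ hx ?_)⟩
      exact ((hcomp b).sameCycle_iff Subtype.val_injective _ _).1
        (Quotient.exact (s := Perm.SameCycle.setoid _) (hrep b c (Quotient.mk _ x)))
  choose k' S hS hcut using h2
  have : Finite (Quotient (conn e)) := inferInstance
  let E : ∀ c, (Σ x : Σ b, {i // Quotient.mk (conn e) i = b}, Fin (k x.2.1 c)) ≃
      Σ i, Fin (k i c) := fun c => Equiv.ofBijective _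
    (pairMap_bijective (k := k) (classMap_bijective (conn e)) c)
  have hE : ∀ c y, E c (innerPerm S c y) = e c (E c y) := by
    intro c y
    obtain ⟨b, y, rfl⟩ := exists_ungroup
      (K := fun b (j : {i // Quotient.mk (conn e) i = b}) => k j.1) y
    rw [innerPerm_apply, hS]
    rfl
  have hmem : ∀ c y, y ∉ Set.range (cutEmb S c) → E c y ∉ C c := by
    intro c y hy hC
    obtain ⟨b, y, rfl⟩ := exists_ungroup
      (K := fun b (j : {i // Quotient.mk (conn e) i = b}) => k j.1) y
    obtain ⟨r, hr⟩ := (hcut b c y).2 hC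
    exact hy ⟨⟨b, r⟩, by rw [← hr]; rfl⟩
  -- Up to relabelling, `e⁻¹ f` fixes all points off the transversal, so it comes from a permutation
  -- of the cut points, which is the required graph of components.
  have h3 : ∀ c, ∃ σ : Perm (Σ b, Fin (k' b c)),
      σ.viaEmbedding (cutEmb S c) = (innerPerm S c)⁻¹ * (E c).symm.permCongr (f c) := by
    intro c
    refine exists_viaEmbedding_eq _ _ fun y hy => ?_
    rw [Perm.mul_apply, Perm.inv_eq_iff_eq, ← (E c).apply_eq_iff_eq, hE, ← hf c _ (hmem c y hy)]
    simp [Equiv.permCongr_apply]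
  choose g hg using h3
  refine ⟨k', S, g, hS, hcut, fun c y => ?_⟩
  have h4 : graft g S c y = (E c).symm.permCongr (f c) y := by
    rw [graft, substPerm, hg, mul_inv_cancel_left]
  rw [h4]
  exact ((E c).apply_symm_apply _).symm

theorem exists_isCopy {ι' : Type} {e : ι' → ι} (he : Function.Bijective e) (g : Graph k) :
    ∃ g' : Graph fun i => k (e i), IsCopy (k := k) e g' g := by
  refine ⟨fun c => (Equiv.ofBijective _ (pairMap_bijective (k := k) he c)).symm.permCongr (g c),
    fun c x => ?_⟩
  exact ((Equiv.ofBijective _ (pairMap_bijective (k := k) he c)).apply_symm_apply _).symm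

/-- If one component contained everything, `f` would be connected, hence tree-like of the same
length as `g`; but a proper `f` is strictly shorter. All inductions on the number of elements rest
on this. -/
theorem GraphLe.component_card_lt [Finite ι] {f g : Graph k} (hg : IsTreeLike g) (h : GraphLe f g)
    (hne : f ≠ g) (b : Quotient (TensorFree.conn f)) :
    Nat.card {i // Quotient.mk (TensorFree.conn f) i = b} < Nat.card ι := by
  by_contra hlt
  have h1 : ∀ i, Quotient.mk (TensorFree.conn f) i = b := by
    have h2 : Function.Bijective (Subtype.val : {i // Quotient.mk (TensorFree.conn f) i = b} → ι) := by
      refine (Nat.bijective_iff_injective_and_card _).2 ⟨Subtype.val_injective, ?_⟩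
      exact le_antisymm (Nat.card_le_card_of_injective _ Subtype.val_injective) (not_lt.1 hlt)
    intro i
    obtain ⟨j, rfl⟩ := h2.2 i
    exact j.2
  have := hg.nonempty
  have h3 : IsTreeLike f := (hg.isForest.of_le h).isTreeLike fun i j =>
    Quotient.exact ((h1 i).trans (h1 j).symm)
  have h4 := h.length_lt hne
  have h5 := h3.length
  have h6 := hg.length
  omega

theorem exists_component_not_isMono {α : Type*} {a : ι → α} {f : Graph k} (hf : ¬ IsMono a f) :
    ∃ b, ¬ IsMono (fun i => a i.1) (component f b) := by
  simp only [IsMono, not_forall] at hf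
  obtain ⟨c, x, hx⟩ := hf
  exact ⟨Quotient.mk _ x.1, fun h => hx (h c ⟨⟨x.1, rfl⟩, x.2⟩)⟩

end Contraction

/-! ### Isolating an element. -/

section Isolation

variable {X : Type} [Finite X]

/-- Deleting from the cycles of a permutation the points of a set that meets each cycle at most
once. -/
theorem exists_isolate [DecidableEq X] (σ : Perm X) (s : Finset X)
    (hs : ∀ x ∈ s, ∀ y ∈ s, σ.SameCycle x y → x = y) :
    ∃ τ : Perm X, (∀ w, NCLe w τ ↔ NCLe w σ ∧ ∀ x ∈ s, w x = x) ∧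
      ∀ y ∉ s, τ y = if σ y ∈ s then σ (σ y) else σ y := by
  induction s using Finset.induction_on with
  | empty => exact ⟨σ, by simp, by simp⟩
  | insert x s hx ih =>
    obtain ⟨τ, h1, h2⟩ := ih fun y hy z hz =>
      hs y (Finset.mem_insert_of_mem hy) z (Finset.mem_insert_of_mem hz)
    refine ⟨skip τ x, fun w => ?_, fun y hy => ?_⟩
    · rw [nCLe_skip_iff, h1, Finset.forall_mem_insert]
      tauto
    · rw [Finset.mem_insert, not_or] at hy
      have hne : ∀ z ∈ s, ¬ σ.SameCycle x z := fun z hz hxz => hx (by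
        rwa [hs x (Finset.mem_insert_self x s) z (Finset.mem_insert_of_mem hz) hxz])
      have hσ : σ x ∉ s := fun h => hne _ h (Perm.sameCycle_apply_right.2 (Perm.SameCycle.refl σ x))
      rw [skip_apply _ _ _ hy.1, h2 y hy.2, h2 x hx, if_neg hσ]
      simp only [Finset.mem_insert]
      by_cases h3 : σ y ∈ s
      · have h4 : σ (σ y) ≠ x := fun h => hne _ h3
          (h ▸ Perm.sameCycle_apply_left.2 (Perm.SameCycle.refl σ (σ y)))
        simp [h3, h4]
      · by_cases h4 : σ y = x
        · simp [h4, hx]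
        · simp [h3, h4]

variable {D : ℕ} {ι : Type} {k : ι → Deg D}

open scoped Classical in
-- In a forest, `l` meets each cycle at most once, so its pairs can be skipped independently and a
-- bypass never lands on `l` again.
theorem exists_isolate_graph [Finite ι] {g : Graph k} (hg : IsForest g) (l : ι) :
    ∃ e : Graph k, (∀ f, GraphLe f e ↔ GraphLe f g ∧ ∀ c r, f c ⟨l, r⟩ = ⟨l, r⟩) ∧
      ∀ c x, x.1 ≠ l → e c x = if (g c x).1 = l then g c (g c x) else g c x := by
  have := Fintype.ofFinite ι
  have h := fun c => exists_isolate (g c) (Finset.univ.filter fun x => x.1 = l) (by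
    intro x hx y hy hxy
    simp only [Finset.mem_filter, Finset.mem_univ, true_and] at hx hy
    exact hg.eq_of_sameCycle hxy (hx.trans hy.symm))
  choose e he1 he2 using h
  refine ⟨e, fun f => ?_, fun c x hx => ?_⟩
  · have h3 : ∀ c, (∀ x ∈ Finset.univ.filter fun x : Σ i, Fin (k i c) => x.1 = l, f c x = x) ↔
        ∀ r, f c ⟨l, r⟩ = ⟨l, r⟩ := by
      intro c
      constructor
      · exact fun h r => h ⟨l, r⟩ (by simp)
      · rintro h ⟨i, r⟩ hi
        obtain rfl : i = l := by simpa using hi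
        exact h r
    simp only [GraphLe, he1, h3]
    exact forall_and
  · have := he2 c x (by simpa using hx)
    simpa using this

end Isolation

end TensorFree

/-! ### Identities and the vanishing of their cumulants. -/

namespace TensorialProbabilitySpace

set_option linter.unusedSectionVars false

variable {D : ℕ} (𝒜 : TensorialProbabilitySpace D)

open scoped Classical

/-- The axiom on products with an identity, for an empty family of factors. -/
theorem φ_one (k : Deg D) [Nontrivial (𝒜.A k)] : 𝒜.φ k (𝒜.one k) = 1 := by
  obtain ⟨k', T, hT⟩ := (IsMelonic.single (ι := Option Empty) fun _ => k).exists_tree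
  have h1 := 𝒜.trace_one_mul T ‹_› (Or.inl fun i => i.elim) (fun _ => 𝒜.one k) rfl
  rw [← moment_graph, hT, moment_of_unique] at h1
  simpa using h1

theorem moment_of_isolated {ι : Type} {k : ι → Deg D} (l : ι) (hl : ∀ i, i = l) (g : Graph k)
    (hg : IsTreeLike g) (h : ∀ i, 𝒜.A (k i)) : 𝒜.moment g h = 𝒜.φ (k l) (h l) := by
  have := hg.finite
  let _ : Unique ι := ⟨⟨l⟩, hl⟩
  have := Fintype.ofFinite ι
  have h1 := hg.length
  rw [Nat.card_unique] at h1
  have h2 : g = fun _ => 1 := graphLength_eq_zero.1 (by omega)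
  rw [h2, moment_of_unique]
  rfl

section Constants

variable {ι : Type} [Fintype ι] {k : ι → Deg D}

/-- An identity can be isolated in a graph without changing the moment. -/
theorem moment_eq_momentProd_of_one {g e : Graph k} (hg : IsTreeLike g) (l : ι)
    (hle : GraphLe e g) (hfix : ∀ c r, e c ⟨l, r⟩ = ⟨l, r⟩)
    (he : ∀ c x, x.1 ≠ l → e c x = if (g c x).1 = l then g c (g c x) else g c x)
    (h : ∀ i, 𝒜.A (k i)) [Nontrivial (𝒜.A (k l))] (hl : h l = 𝒜.one (k l)) :
    𝒜.moment g h = 𝒜.momentProd e h := by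
  have heF : IsForest e := hg.isForest.of_le hle
  have hfix' : ∀ c x, x.1 = l → e c x = x := by
    rintro c ⟨i, r⟩ rfl
    exact hfix c r
  -- the transversal
  have h1 : ∀ c (q : Quotient (Perm.SameCycle.setoid (e c))), ∃ x, Quotient.mk _ x = q ∧
      ∀ y, Quotient.mk _ y = q → y.1 ≠ l → (g c y).1 = l → x = y := by
    intro c q
    by_cases hq : ∃ y, Quotient.mk _ y = q ∧ (g c y).1 = l
    · obtain ⟨y, hy, hyl⟩ := hq
      refine ⟨y, hy, fun y' hy' _ hyl' => ?_⟩
      have h2 : (e c).SameCycle y y' :=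
        Quotient.exact (s := Perm.SameCycle.setoid (e c)) (hy.trans hy'.symm)
      have h3 : (g c).SameCycle (g c y) (g c y') :=
        Perm.sameCycle_apply_left.2 (Perm.sameCycle_apply_right.2 ((hle c).sameCycle h2))
      exact (g c).injective (hg.isForest.eq_of_sameCycle h3 (hyl.trans hyl'.symm))
    · obtain ⟨x, hx⟩ := Quotient.exists_rep q
      exact ⟨x, hx, fun y hy _ hyl => absurd ⟨y, hy, hyl⟩ hq⟩
  choose rep hrep hrep' using h1
  let C : ∀ c, Set (Σ i, Fin (k i c)) := fun c => Set.range (rep c)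
  have hsame : ∀ c x, (e c).SameCycle (rep c (Quotient.mk _ x)) x := fun c x =>
    Quotient.exact (s := Perm.SameCycle.setoid (e c)) (hrep c _)
  have hCl : ∀ c x, x.1 = l → x ∈ C c := fun c x hx => by
    refine ⟨Quotient.mk _ x, ?_⟩
    obtain ⟨n, hn⟩ := (hsame c x).symm
    rw [← hn, Perm.zpow_apply_eq_self_of_apply_eq_self (hfix' c x hx)]
  have hCg : ∀ c x, x.1 ≠ l → (g c x).1 = l → x ∈ C c := fun c x hx hgx =>
    ⟨Quotient.mk _ x, hrep' c _ x rfl hx hgx⟩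
  -- `g` differs from `e` only at pairs of `l` and at pairs from which `g` enters `l`, and all of
  -- these are cut points. So `g` is a graft of the components of `e`, one of which is the identity
  -- alone.
  obtain ⟨k', S, G, hS, hcut, hcopy⟩ := exists_graft (f := g) heF C
    (fun c x => ⟨_, ⟨_, rfl⟩, hsame c x⟩)
    (by
      rintro c _ ⟨q, rfl⟩ _ ⟨q', rfl⟩ h
      have h2 := Quotient.sound (s := Perm.SameCycle.setoid (e c)) h
      rw [hrep, hrep] at h2
      rw [h2])
    (fun c x hx => by
      rw [he c x fun h => hx (hCl c x h), if_neg fun h =>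
        hx (hCg c x (fun h' => hx (hCl c x h')) h)])
  have hbij := classMap_bijective (conn e)
  set ĥ : ∀ b, 𝒜.A (k' b) := fun b => 𝒜.mul (S b) fun j => h j.1 with hĥ
  have hmoment : 𝒜.moment g h = 𝒜.moment G ĥ := by
    rw [← 𝒜.moment_copy hbij hcopy h]
    exact 𝒜.moment_graft S G fun x => h x.2.1
  have hGtree : IsTreeLike G :=
    (isTreeLike_graft_iff (S := S) G).1 ((hcopy.isTreeLike_iff hbij).2 hg)
  -- the component of `l`
  let L : Quotient (conn e) := Quotient.mk _ l
  have hL : ∀ i, Quotient.mk (conn e) i = L ↔ i = l := by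
    intro i
    constructor
    · intro hi
      have := conn_map_eq (g := e) (· = l) (fun c x => ?_) (Quotient.exact hi)
      · simpa using this
      · by_cases hx : x.1 = l
        · rw [hfix' c x hx]
        · refine propext ⟨fun h => absurd ?_ hx, fun h => absurd h hx⟩
          have := (e c).injective (hfix' c _ h)
          rw [← this]
          exact h
    · rintro rfl
      rfl
  have hLone : ĥ L = 𝒜.one (k' L) := by
    have h2 : (fun j : {j // Quotient.mk (conn e) j = L} => h j.1) =
        fun j : {j // Quotient.mk (conn e) j = L} => 𝒜.one (k j.1) := by
      funext j
      obtain ⟨j, hj⟩ := j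
      obtain rfl := (hL j).1 hj
      exact hl
    rw [hĥ]
    simp only [h2]
    refine 𝒜.mul_one (S L) fun (j : {j // Quotient.mk (conn e) j = L}) => ?_
    obtain ⟨j, hj⟩ := j
    obtain rfl := (hL j).1 hj
    assumption
  have hφL : 𝒜.φ (k' L) (ĥ L) = 1 := by
    rw [hĥ]
    simp only
    rw [← moment_graph, 𝒜.moment_of_isolated (⟨l, rfl⟩ : {j // Quotient.mk (conn e) j = L})
      (fun (j : {j // Quotient.mk (conn e) j = L}) => Subtype.ext ((hL j.1).1 j.2)) _ (S L).melonic.isTreeLike, hl, φ_one]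
  have hnt : Nontrivial (𝒜.A (k' L)) := by
    refine ⟨⟨ĥ L, 0, fun h0 => ?_⟩⟩
    rw [h0, map_zero] at hφL
    exact zero_ne_one hφL
  -- an edge from each other component to `L`
  have hedge : ∀ b, b ≠ L → ∃ c r s, G c ⟨b, r⟩ = ⟨L, s⟩ := by
    intro b hb
    obtain ⟨c, x, hxb, hx⟩ : ∃ c x, Quotient.mk (conn e) x.1 = b ∧ (g c x).1 = l := by
      by_contra! hno
      obtain ⟨i, rfl⟩ := Quotient.exists_rep b
      have hclosed : ∀ c x, Quotient.mk (conn e) x.1 = Quotient.mk _ i →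
          Quotient.mk (conn e) (g c x).1 = Quotient.mk _ i := by
        intro c x hx
        have hxl : x.1 ≠ l := fun h => hb (hx.symm.trans ((hL _).2 h))
        have h3 := he c x hxl
        rw [if_neg (hno c x hx)] at h3
        rw [← h3, ← hx]
        exact Quotient.sound ((conn e).symm (conn_apply e c x))
      have := conn_map_eq (g := g) (fun j => Quotient.mk (conn e) j = Quotient.mk _ i)
        (fun c x => propext ⟨fun hx => ?_, hclosed c x⟩) (hg.conn i l)
      · exact hb (Eq.symm (cast this rfl))
      -- An injective map of a finite set into itself is onto, so a class that `g c` maps into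
      -- itself is not entered from outside either.
      · let s : Set (Σ i, Fin (k i c)) := {x | Quotient.mk (conn e) x.1 = Quotient.mk _ i}
        have h4 : Set.MapsTo (g c) s s := fun x hx => hclosed c x hx
        have h5 := Finite.surjective_of_injective (f := h4.restrict (g c) s s)
          (h4.restrict_inj.2 (g c).injective.injOn)
        obtain ⟨y, hy⟩ := h5 ⟨_, hx⟩
        have h6 : g c y.1 = g c x := congrArg Subtype.val hy
        rw [← (g c).injective h6]
        exact y.2
    have hxl : x.1 ≠ l := fun h => hb (hxb.symm.trans ((hL _).2 h))
    obtain ⟨r, hr⟩ := (hcut b c ⟨⟨x.1, hxb⟩, x.2⟩).2 (hCg c x hxl hx)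
    have h3 := hcopy c (cutEmb S c (⟨b, r⟩ : Σ b, Fin (k' b c)))
    have h4 : pairMap (k := k) (fun x : Σ b, {i // Quotient.mk (conn e) i = b} => x.2.1)
        (cutEmb S c (⟨b, r⟩ : Σ b, Fin (k' b c))) = x := by
      exact congrArg (pairMap (k := k) Subtype.val) hr
    rw [h4, graft, substPerm_emb] at h3
    have h5 : (G c ⟨b, r⟩).1 = L := by
      rw [h3] at hx
      have h6 : Quotient.mk (conn e) (innerPerm S c (cutEmb S c (G c ⟨b, r⟩))).1.2.1 =
        (G c ⟨b, r⟩).1 := (innerPerm S c (cutEmb S c (G c ⟨b, r⟩))).1.2.2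
      rw [← h6]
      exact (hL _).2 hx
    generalize hz : G c ⟨b, r⟩ = z at h5
    obtain ⟨z, s⟩ := z
    obtain rfl : z = L := h5
    exact ⟨c, r, s, hz⟩
  -- the star around `L`
  let eO : Option {b // b ≠ L} → Quotient (conn e) := fun o => o.elim L Subtype.val
  have heO : Function.Bijective eO := by
    constructor
    · rintro (_ | b) (_ | b') hbb
      · rfl
      · exact absurd hbb.symm b'.2
      · exact absurd hbb b.2
      · exact congrArg some (Subtype.ext hbb)
    · intro b
      by_cases hb : b = L
      · exact ⟨none, hb.symm⟩
      · exact ⟨some ⟨b, hb⟩, rfl⟩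
  obtain ⟨G', hG'⟩ := exists_isCopy (k := k') heO G
  have hG'tree : IsTreeLike G' := (hG'.isTreeLike_iff heO).2 hGtree
  -- A cycle through the identity is cut right after a pair of the identity, so the edges that enter
  -- the identity from the other factors survive in the tree, as the trace axiom demands.
  have h2 : ∀ c (q : Quotient (Perm.SameCycle.setoid (G' c))), ∃ x, Quotient.mk _ x = q ∧
      ((∃ y, Quotient.mk _ y = q ∧ y.1 = none) → x.1 = none) := by
    intro c q
    by_cases hq : ∃ y, Quotient.mk _ y = q ∧ y.1 = none
    · obtain ⟨y, hy, hyn⟩ := hq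
      exact ⟨y, hy, fun _ => hyn⟩
    · obtain ⟨x, hx⟩ := Quotient.exists_rep q
      exact ⟨x, hx, fun h => absurd h hq⟩
  choose rep' hrep1 hrep2 using h2
  obtain ⟨k'', T, hT, hTcut⟩ := exists_tree hG'tree.isMelonic rep' hrep1
  have htr := 𝒜.trace_one_mul T hnt (Or.inl fun b => ?_) (fun o => ĥ (eO o)) hLone
  · rw [hmoment, ← 𝒜.moment_copy heO hG' ĥ, ← hT, moment_graph, htr, momentProd_eq]
    have h3 : ∀ b, 𝒜.moment (component e b) (fun i => h i.1) = 𝒜.φ (k' b) (ĥ b) := fun b => by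
      rw [← hS, moment_graph]
    simp only [h3]
    rw [← Fintype.prod_bijective eO heO (fun o => 𝒜.φ _ (ĥ (eO o))) _ fun _ => rfl,
      Fintype.prod_option]
    have h4 : 𝒜.φ (k' (eO none)) (ĥ (eO none)) = 1 := hφL
    rw [h4, _root_.one_mul]
  · obtain ⟨c, r, s, hrs⟩ := hedge b.1 b.2
    have h3 : G' c ⟨some b, r⟩ = ⟨none, s⟩ :=
      pairMap_injective (k := k') heO.1 c ((hG' c ⟨some b, r⟩).symm.trans hrs)
    refine ⟨c, r, s, hT ▸ h3, fun hc => ?_⟩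
    obtain ⟨q, hq⟩ := (hTcut c _).1 hc
    have h4 := hrep2 c q ⟨⟨none, s⟩, ?_, rfl⟩
    · rw [hq] at h4
      exact absurd h4 (by simp)
    · rw [← hrep1 c q, hq, ← h3]
      exact Quotient.sound (s := Perm.SameCycle.setoid (G' c))
        (show (G' c).SameCycle _ _ from Perm.sameCycle_apply_left.2 (Perm.SameCycle.refl _ _))

end Constants

/-- The cumulants of a graph with an identity among its elements vanish. -/
theorem cumulant_eq_zero_of_one {ι : Type} [Fintype ι] {k : ι → Deg D} {g : Graph k}
    (hg : IsTreeLike g) (hcard : 2 ≤ Nat.card ι) (h : ∀ i, 𝒜.A (k i)) (l : ι)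
    [Nontrivial (𝒜.A (k l))] (hl : h l = 𝒜.one (k l)) : 𝒜.cumulant g h = 0 := by
  induction hn : Nat.card ι using Nat.strong_induction_on generalizing ι with
  | _ n ih =>
  subst hn
  obtain ⟨e, he1, he2⟩ := exists_isolate_graph hg.isForest l
  obtain ⟨hle, hfix⟩ := (he1 e).1 (GraphLe.refl e)
  have h1 := 𝒜.moment_eq_momentProd_of_one hg l hle hfix he2 h hl
  have := hg.nonempty
  rw [← 𝒜.momentProd_of_conn hg.conn, momentProd_eq_sum, momentProd_eq_sum] at h1
  have hnot : ¬ GraphLe g e := by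
    intro hge
    have hgfix := ((he1 g).1 hge).2
    have h2 : ∀ i, i = l := by
      intro i
      have := conn_map_eq (g := g) (· = l) (fun c x => ?_) (hg.conn i l)
      · simpa using this
      · by_cases hx : x.1 = l
        · obtain ⟨j, r⟩ := x
          obtain rfl : j = l := hx
          rw [hgfix]
        · refine propext ⟨fun h => absurd ?_ hx, fun h => absurd h hx⟩
          generalize hy : g c x = y at h
          obtain ⟨j, r⟩ := y
          obtain rfl : j = l := h
          exact congrArg Sigma.fst ((g c).injective (hy.trans (hgfix c r).symm))
    have : Nat.card ι ≤ 1 := by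
      have : Subsingleton ι := ⟨fun i j => (h2 i).trans (h2 j).symm⟩
      exact Finite.card_le_one_iff_subsingleton.2 this
    omega
  have hsub : (Finset.univ.filter fun f => GraphLe f e) ⊆ Finset.univ.filter fun f => GraphLe f g :=
    fun f hf => Finset.mem_filter.2 ⟨Finset.mem_univ _,
      ((he1 f).1 (Finset.mem_filter.1 hf).2).1⟩
  -- The graphs below `e` are those below `g` that isolate `l`, so the cumulants of the others add
  -- up to zero. For each of these except `g`, the component of `l` is smaller than `g` and has at
  -- least two elements, so its cumulant vanishes by induction; only that of `g` remains.
  rw [← Finset.sum_sdiff hsub, add_eq_right, Finset.sum_eq_single g] at h1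
  · exact h1
  · intro f hf hne
    simp only [Finset.mem_sdiff, Finset.mem_filter, Finset.mem_univ, true_and] at hf
    have hfF := hg.isForest.of_le hf.1
    have h2 : ¬ ∀ c r, f c ⟨l, r⟩ = ⟨l, r⟩ := fun h => hf.2 ((he1 f).2 ⟨hf.1, h⟩)
    simp only [not_forall] at h2
    obtain ⟨c, r, hr⟩ := h2
    refine 𝒜.cumulant_eq_zero_of_component (Quotient.mk _ l) h ?_
    have : Nontrivial (𝒜.A (k (⟨l, rfl⟩ : {i // Quotient.mk (conn f) i = Quotient.mk _ l}).1)) := ‹_›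
    refine ih _ (hf.1.component_card_lt hg hne _) (hfF.component _) ?_ (fun i => h i.1) ⟨l, rfl⟩ hl
      rfl
    have hc := conn_apply f c ⟨l, r⟩
    have h3 : (⟨l, rfl⟩ : {i // Quotient.mk (conn f) i = Quotient.mk _ l}) ≠
        ⟨(f c ⟨l, r⟩).1, (Quotient.sound hc).symm⟩ := fun h3 => hr
      (hfF.eq_of_sameCycle (Perm.sameCycle_apply_right.2 (Perm.SameCycle.refl _ _))
        (congrArg Subtype.val h3)).symm
    have : Nontrivial {i // Quotient.mk (conn f) i = Quotient.mk _ l} := ⟨⟨_, _, h3⟩⟩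
    exact Finite.one_lt_card
  · intro hg'
    simp [GraphLe.refl, hnot] at hg'

end TensorialProbabilitySpace

namespace TensorFree

set_option linter.unusedSectionVars false

/-! ### Unmixed graphs below an almost alternating one. -/

section Labels

variable {D : ℕ} {ι : Type} {k : ι → Deg D} {α : Type*} {a : ι → α}

theorem IsTreeLike.not_isMono_iff {g : Graph k} (hg : IsTreeLike g) :
    ¬ IsMono a g ↔ ∃ i j, a i ≠ a j := by
  refine ⟨fun h => ?_, fun ⟨i, j, hij⟩ h => hij (h.conn (hg.conn i j))⟩
  by_contra! h'
  exact h fun c x => h' _ _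

theorem two_le_card_of_ne [Finite ι] {i j : ι} (h : a i ≠ a j) : 2 ≤ Nat.card ι := by
  have : Nontrivial ι := ⟨⟨i, j, fun hij => h (congrArg a hij)⟩⟩
  exact Finite.one_lt_card

/-- If at most one edge of a melonic graph `g` joins two different elements with the same label,
then every `f ≤ g` without edges between different labels has an isolated element. -/
theorem exists_isolated_of_isMono {f g : Graph k} (hg : IsTreeLike g)
    (hbad : {e : Σ c : Fin D, Σ i : ι, Fin (k i c) |
      e.2.1 ≠ (g e.1 e.2).1 ∧ a e.2.1 = a (g e.1 e.2).1}.Subsingleton)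
    (hle : GraphLe f g) (hf : IsMono a f) : ∃ l, ∀ c r, f c ⟨l, r⟩ = ⟨l, r⟩ := by
  classical
  have := hg.finite
  have := Fintype.ofFinite ι
  -- Let `n` be the number of elements and `N` the set of moved pairs. Without isolated elements, `n
  -- ≤ |N f|`. At a pair moved by `g`, either `f` differs from `g`, or the edge of `g` joins
  -- distinct elements with equal labels, which happens at most once; so `|N g| ≤ |N (g⁻¹ f)| + 1`.
  -- Adding up, `n + |N g| ≤ 2 |f| + 2 |g⁻¹ f| + 1 = 2 |g| + 1 = 2 n - 1`, whereas `|N g| > |g| = n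
  -- - 1`.
  by_contra! hno
  choose c r hcr using hno
  let N : (∀ c, Perm (Σ i, Fin (k i c))) → Finset (Σ c : Fin D, Σ i : ι, Fin (k i c)) := fun u =>
    Finset.univ.sigma fun c => (u c).support
  have hN : ∀ u : Graph k, (N u).card ≤ 2 * graphLength u := fun u => by
    rw [Finset.card_sigma, graphLength, Finset.mul_sum]
    exact Finset.sum_le_sum fun c _ => card_support_le _
  have h1 : Nat.card ι ≤ (N f).card := by
    rw [Nat.card_eq_fintype_card, ← Finset.card_univ]
    refine Finset.card_le_card_of_injOn (fun l => ⟨c l, l, r l⟩) (fun l _ => ?_) fun l _ l' _ h => ?_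
    · simp [N, hcr]
    · exact congrArg (fun e : Σ c : Fin D, Σ i : ι, Fin (k i c) => e.2.1) h
  have h2 : (N g).card ≤ (N fun c => (g c)⁻¹ * f c).card + 1 := by
    let B := Finset.univ.filter fun e : Σ c : Fin D, Σ i : ι, Fin (k i c) =>
      e.2.1 ≠ (g e.1 e.2).1 ∧ a e.2.1 = a (g e.1 e.2).1
    have hB : B.card ≤ 1 := Finset.card_le_one.2 fun e he e' he' =>
      hbad (by simpa [B] using he) (by simpa [B] using he')
    refine (Finset.card_le_card (t := (N fun c => (g c)⁻¹ * f c) ∪ B) fun e he => ?_).trans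
      ((Finset.card_union_le _ _).trans (by omega))
    obtain ⟨c, x⟩ := e
    simp only [N, Finset.mem_sigma, Finset.mem_univ, true_and, Perm.mem_support, Finset.mem_union,
      Perm.mul_apply, B, Finset.mem_filter, ne_eq, Perm.inv_eq_iff_eq] at he ⊢
    by_cases hx : f c x = g c x
    · refine Or.inr ⟨fun h => he ?_, ?_⟩
      · exact hg.isForest.eq_of_sameCycle
          (Perm.sameCycle_apply_left.2 (Perm.SameCycle.refl _ _)) h.symm
      · rw [← hx]
        exact (hf c x).symm
    · exact Or.inl hx
  have h3 := hN f
  have h4 := hN fun c => (g c)⁻¹ * f c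
  have h5 := hle.length_add
  have h6 : graphLength (fun c => f c * (g c)⁻¹) = graphLength fun c => (g c)⁻¹ * f c :=
    Finset.sum_congr rfl fun c _ => permLength_mul_comm _ _
  have h7 := hg.length
  have h8 : graphLength g < (N g).card := by
    have hne : ∃ c, g c ≠ 1 := by
      by_contra! h
      obtain ⟨l⟩ := hg.nonempty
      refine hcr l ((hle (c l)).apply_eq_self ?_)
      rw [h]
      rfl
    obtain ⟨c, hc⟩ := hne
    rw [Finset.card_sigma, graphLength]
    refine Finset.sum_lt_sum (fun c _ => ?_) ⟨c, Finset.mem_univ c, permLength_lt_card_support hc⟩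
    by_cases h : g c = 1
    · rw [h, permLength_one]
      exact Nat.zero_le _
    · exact (permLength_lt_card_support h).le
  omega

end Labels

/-! ### Contracting an edge. -/

section Merge

variable {D : ℕ} {ι : Type} {k : ι → Deg D}

open scoped Classical in
/-- The graph with a single cycle that is not a fixed point, the transposition of two points. -/
noncomputable def swapGraph (c₀ : Fin D) (x y : Σ i, Fin (k i c₀)) : Graph k :=
  Function.update (fun _ => 1) c₀ (swap x y)

theorem swapGraph_self (c₀ : Fin D) (x y : Σ i, Fin (k i c₀)) [DecidableEq (Σ i, Fin (k i c₀))] :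
    swapGraph (k := k) c₀ x y c₀ = swap x y := by
  rw [swapGraph, Function.update_self]
  congr!

theorem swapGraph_of_ne {c₀ c : Fin D} (hc : c ≠ c₀) (x y : Σ i, Fin (k i c₀)) :
    swapGraph (k := k) c₀ x y c = 1 := by
  rw [swapGraph, Function.update_of_ne hc]

theorem swapGraph_le [Finite ι] {g : Graph k} {c₀ : Fin D} {x y : Σ i, Fin (k i c₀)}
    (h : (g c₀).SameCycle x y) : GraphLe (swapGraph c₀ x y) g := by
  classical
  intro c
  by_cases hc : c = c₀
  · subst hc
    rw [swapGraph_self]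
    exact swap_nCLe h
  · rw [swapGraph_of_ne hc]
    exact NCLe.one_le _

theorem swapGraph_isMono {α : Type*} {a : ι → α} {c₀ : Fin D} {x y : Σ i, Fin (k i c₀)}
    (h : a x.1 = a y.1) : IsMono a (swapGraph c₀ x y) := by
  classical
  intro c z
  by_cases hc : c = c₀
  · subst hc
    rw [swapGraph_self, swap_apply_def]
    split_ifs with h1 h2
    · rw [h1, h]
    · rw [h2, h]
    · rfl
  · rw [swapGraph_of_ne hc]
    rfl

/-- Contraction of an edge of a melonic graph. -/
theorem exists_graft_swap [Finite ι] {g : Graph k} (hg : IsTreeLike g) (c₀ : Fin D)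
    (x : Σ i, Fin (k i c₀)) (hx : g c₀ x ≠ x) :
    ∃ (k' : Quotient (conn (swapGraph (k := k) c₀ x (g c₀ x))) → Deg D)
      (S : ∀ b, Tree (fun i : {i // Quotient.mk (conn (swapGraph (k := k) c₀ x (g c₀ x))) i = b} =>
        k i.1) (k' b)) (G : Graph k'),
      IsCopy (k := k) (fun x : Σ b,
        {i // Quotient.mk (conn (swapGraph (k := k) c₀ x (g c₀ x))) i = b} => x.2.1)
        (graft G S) g := by
  classical
  have hle : GraphLe (swapGraph c₀ x (g c₀ x)) g :=
    swapGraph_le (Perm.sameCycle_apply_right.2 (Perm.SameCycle.refl _ _))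
  -- All pairs except `x`: the only nontrivial cycle of the swap graph is represented by `g c₀ x`.
  -- At the excluded pair both graphs take the value `g c₀ x`.
  let C : ∀ c, Set (Σ i, Fin (k i c)) := fun c =>
    {y | (⟨c, y⟩ : Σ c, Σ i, Fin (k i c)) ≠ ⟨c₀, x⟩}
  have h1 : ∀ c y, ∃ z ∈ C c, (swapGraph (k := k) c₀ x (g c₀ x) c).SameCycle z y := by
    intro c y
    by_cases hy : (⟨c, y⟩ : Σ c, Σ i, Fin (k i c)) = ⟨c₀, x⟩
    · obtain ⟨rfl, hy⟩ := Sigma.mk.inj_iff.1 hy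
      obtain rfl := eq_of_heq hy
      refine ⟨g c y, fun h => hx (eq_of_heq (Sigma.mk.inj_iff.1 h).2), ?_⟩
      rw [swapGraph_self]
      exact ⟨1, by simp⟩
    · exact ⟨y, hy, Perm.SameCycle.refl _ _⟩
  have h2 : ∀ c, ∀ y ∈ C c, ∀ z ∈ C c,
      (swapGraph (k := k) c₀ x (g c₀ x) c).SameCycle y z → y = z := by
    intro c y hy y' hy' h
    by_cases hc : c = c₀
    · subst hc
      rw [swapGraph_self] at h
      have hy : y ≠ x := fun h => hy (by rw [h])
      have hy' : y' ≠ x := fun h => hy' (by rw [h])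
      have := SameCycle.map_eq (fun w => if w = x then g c x else w) (fun w => ?_) h
      · simpa [hy, hy'] using this
      · rw [swap_apply_def]
        split_ifs
        all_goals simp_all
    · rw [swapGraph_of_ne hc] at h
      exact Perm.sameCycle_one.1 h
  have h3 : ∀ c, ∀ y ∉ C c, g c y = swapGraph (k := k) c₀ x (g c₀ x) c y := by
    intro c y hy
    have hy : (⟨c, y⟩ : Σ c, Σ i, Fin (k i c)) = ⟨c₀, x⟩ := not_not.1 hy
    obtain ⟨rfl, hy⟩ := Sigma.mk.inj_iff.1 hy
    obtain rfl := eq_of_heq hy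
    rw [swapGraph_self, swap_apply_left]
  obtain ⟨k', S, G, -, -, h⟩ := exists_graft (hg.isForest.of_le hle) C h1 h2 h3
  exact ⟨k', S, G, h⟩

end Merge

end TensorFree

/-! ### Vanishing cumulants against vanishing moments. -/

namespace TensorialProbabilitySpace

set_option linter.unusedSectionVars false

variable {D : ℕ} (𝒜 : TensorialProbabilitySpace D) {α : Type*}

open scoped Classical

/-- The cumulants of melonic graphs of elements of the subspaces `V a` vanish unless all the
elements have the same label. -/
def VanishingCumulants (V : α → ∀ k, Submodule ℂ (𝒜.A k)) : Prop :=
  ∀ {ι : Type} [Fintype ι] {k : ι → Deg D} (a : ι → α) (h : ∀ l, 𝒜.A (k l)),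
    (∀ l, h l ∈ V (a l) (k l)) → ∀ g : Graph k, IsTreeLike g → ¬ IsMono a g → 𝒜.cumulant g h = 0

/-- The moments of almost alternating graphs of elements with trace zero of the subspaces `V a`
vanish. -/
def VanishingMoments (V : α → ∀ k, Submodule ℂ (𝒜.A k)) : Prop :=
  ∀ {ι : Type} [Fintype ι] {k : ι → Deg D} (a : ι → α) (h : ∀ l, 𝒜.A (k l)),
    (∀ l, h l ∈ V (a l) (k l)) → ∀ g : Graph k, IsTreeLike g → AlmostAlternating g a →
      (∀ l, 𝒜.φ (k l) (h l) = 0) → 𝒜.moment g h = 0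

variable {𝒜} {V : α → ∀ k, Submodule ℂ (𝒜.A k)}

/-- Each `f` below `g` contributes zero: a mixed one through a mixed component, an unmixed one
through an isolated element of trace zero. -/
theorem VanishingCumulants.vanishingMoments (hV : 𝒜.VanishingCumulants V) :
    𝒜.VanishingMoments V := by
  intro ι _ k a h hh g hg halt hφ
  have := hg.nonempty
  rw [← 𝒜.momentProd_of_conn hg.conn]
  refine 𝒜.momentProd_eq_zero g h fun f hf => ?_
  by_cases hm : IsMono a f
  · obtain ⟨l, hl⟩ := exists_isolated_of_isMono hg halt.2 hf hm
    exact 𝒜.cumulant_eq_zero_of_isolated l hl h (hφ l)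
  · obtain ⟨b, hb⟩ := exists_component_not_isMono hm
    exact 𝒜.cumulant_eq_zero_of_component b h
      (hV _ _ (fun i => hh i.1) _ ((hg.isForest.of_le hf).component b) hb)

/-- Centering the elements does not change the cumulants. -/
theorem cumulant_center {ι : Type} [Fintype ι] {k : ι → Deg D} {g : Graph k} (hg : IsTreeLike g)
    (hcard : 2 ≤ Nat.card ι) (hnt : ∀ l, Nontrivial (𝒜.A (k l))) (h : ∀ l, 𝒜.A (k l))
    (z : ι → ℂ) : 𝒜.cumulant g (fun l => h l - z l • 𝒜.one (k l)) = 𝒜.cumulant g h := by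
  suffices H : ∀ t : Finset ι,
      𝒜.cumulant g (fun l => if l ∈ t then h l - z l • 𝒜.one (k l) else h l) = 𝒜.cumulant g h by
    simpa using H Finset.univ
  intro t
  induction t using Finset.induction_on with
  | empty => simp
  | insert i t hi ih =>
    set h' : ∀ l, 𝒜.A (k l) := fun l => if l ∈ t then h l - z l • 𝒜.one (k l) else h l with hh'
    have h1 : (fun l => if l ∈ insert i t then h l - z l • 𝒜.one (k l) else h l) =
        Function.update h' i (h i - z i • 𝒜.one (k i)) := by
      funext l
      by_cases hl : l = i
      · subst hl
        simp
      · simp [hl, hh']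
    have h2 : Function.update h' i (h i) = h' := by
      rw [Function.update_eq_self_iff]
      simp [hh', hi]
    have := hnt i
    rw [h1, cumulant_sub_smul, h2, ih,
      𝒜.cumulant_eq_zero_of_one hg hcard _ i (Function.update_self _ _ _), mul_zero, sub_zero]

/-- Strong induction on the number of elements. Edges between distinct elements with equal labels
are contracted, `hmul` keeping the product in its subspace. Without such edges the elements can be
centered, by `hone`, and the cumulant is then a moment, all lower cumulants being zero. -/
theorem VanishingMoments.vanishingCumulants (hV : 𝒜.VanishingMoments V)
    (hone : ∀ a k, ∀ x ∈ V a k, x ≠ 0 → 𝒜.one k ∈ V a k)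
    (hmul : ∀ (a : α) {κ : Type} {K : κ → Deg D} {k : Deg D} (T : Tree K k) (h : ∀ j, 𝒜.A (K j)),
      (∀ j, h j ∈ V a (K j)) → 𝒜.mul T h ∈ V a k) : 𝒜.VanishingCumulants V := by
  intro ι _ k a h hh g hg hmono
  induction hn : Nat.card ι using Nat.strong_induction_on generalizing ι with
  | _ n ih =>
  subst hn
  obtain ⟨i, j, hij⟩ := hg.not_isMono_iff.1 hmono
  have hcard := two_le_card_of_ne hij
  by_cases hbad : ∃ (c₀ : Fin D) (x : Σ i, Fin (k i c₀)),
      x.1 ≠ (g c₀ x).1 ∧ a x.1 = a (g c₀ x).1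
  · obtain ⟨c₀, x, hx, hax⟩ := hbad
    have hgx : g c₀ x ≠ x := fun h => hx (congrArg Sigma.fst h).symm
    obtain ⟨k', S, G, hcopy⟩ := exists_graft_swap hg c₀ x hgx
    set e := swapGraph (k := k) c₀ x (g c₀ x) with he
    have hbij := classMap_bijective (conn e)
    have hle : GraphLe e g := swapGraph_le (Perm.sameCycle_apply_right.2 (Perm.SameCycle.refl _ _))
    let a' : Quotient (conn e) → α := Quotient.lift a fun i j hij =>
      (swapGraph_isMono hax).conn hij
    have ha' : ∀ y : Σ b, {i // Quotient.mk (conn e) i = b}, a y.2.1 = a' y.1 := by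
      rintro ⟨b, i, rfl⟩
      rfl
    have hlt : Nat.card (Quotient (conn e)) < Nat.card ι := by
      have h1 : numComp e + graphLength e = Nat.card ι := hg.isForest.of_le hle
      have h2 : graphLength e ≠ 0 := fun h0 => hgx (by
        have h3 := congrFun (graphLength_eq_zero.1 h0) c₀
        rw [he, swapGraph_self] at h3
        have h4 := congrArg (fun w : Perm _ => w x) h3
        simpa using h4)
      have h3 : numComp e = Nat.card (Quotient (conn e)) := rfl
      omega
    have hcardS : Nat.card (Σ b, {i // Quotient.mk (conn e) i = b}) = Nat.card ι :=
      Nat.card_congr (Equiv.ofBijective _ hbij)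
    have hSg : IsTreeLike (graft G S) := (hcopy.isTreeLike_iff hbij).2 hg
    have hG : IsTreeLike G := (isTreeLike_graft_iff (S := S) G).1 hSg
    have hGm : ¬ IsMono a' G := hG.not_isMono_iff.2 ⟨Quotient.mk _ i, Quotient.mk _ j, hij⟩
    have hHV : ∀ y : Σ b, {i // Quotient.mk (conn e) i = b}, h y.2.1 ∈ V (a' y.1) (k y.2.1) :=
      fun y => ha' y ▸ hh y.2.1
    -- The formula identifies the cumulant of `g` with that of the contracted graph, which has fewer
    -- elements and is still mixed. The proper mixed `u` in it vanish by induction as well, applied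
    -- to a mixed component.
    have h1 := 𝒜.cumulant_graft_of_not_isMono (a := a') S G hGm (fun y => h y.2.1)
      fun u hu hne hum => ?_
    · rw [← 𝒜.cumulant_copy hbij hcopy h]
      refine Eq.trans ?_ (h1.symm.trans ?_)
      · congr!
      · exact ih _ hlt a' _ (fun b => hmul _ (S b) _ fun i => hHV ⟨b, i⟩) G hG hGm rfl
    · obtain ⟨b, hb⟩ := exists_component_not_isMono hum
      refine 𝒜.cumulant_eq_zero_of_component b _ ?_
      exact ih _ ((hu.component_card_lt hSg hne b).trans_eq hcardS) _ _ (fun i => hHV i.1) _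
        ((hSg.isForest.of_le hu).component b) hb rfl
  -- Centering needs `φ (one) = 1`, hence nontrivial spaces, and `hone` needs nonzero elements; a
  -- zero element makes the cumulant vanish anyway.
  · by_cases h0 : ∃ l, h l = 0
    · obtain ⟨l, hl⟩ := h0
      exact 𝒜.cumulant_eq_zero_of_apply_eq_zero g h l hl
    push Not at h0
    have hnt : ∀ l, Nontrivial (𝒜.A (k l)) := fun l => ⟨⟨_, _, h0 l⟩⟩
    rw [← cumulant_center hg hcard hnt h fun l => 𝒜.φ (k l) (h l)]
    set h' : ∀ l, 𝒜.A (k l) := fun l => h l - 𝒜.φ (k l) (h l) • 𝒜.one (k l) with hh'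
    have hV' : ∀ l, h' l ∈ V (a l) (k l) := fun l =>
      Submodule.sub_mem _ (hh l) (Submodule.smul_mem _ _ (hone _ _ _ (hh l) (h0 l)))
    have hφ : ∀ l, 𝒜.φ (k l) (h' l) = 0 := fun l => by
      have := hnt l
      rw [hh']
      simp only
      rw [map_sub, map_smul, φ_one, smul_eq_mul, _root_.mul_one, sub_self]
    have hsub : {e : Σ c : Fin D, Σ i : ι, Fin (k i c) |
        e.2.1 ≠ (g e.1 e.2).1 ∧ a e.2.1 = a (g e.1 e.2).1}.Subsingleton := fun e he =>
      absurd ⟨e.1, e.2, he⟩ hbad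
    have halt : AlmostAlternating g a := by
      refine ⟨?_, hsub⟩
      simp only [IsMono, not_forall] at hmono
      obtain ⟨c, x, hx⟩ := hmono
      exact ⟨c, x, Ne.symm hx⟩
    have := hg.nonempty
    rw [← 𝒜.momentProd_eq_cumulant, 𝒜.momentProd_of_conn hg.conn]
    · exact hV a h' hV' g hg halt hφ
    · intro f hf hne
      by_cases hm : IsMono a f
      · obtain ⟨l, hl⟩ := exists_isolated_of_isMono hg hsub hf hm
        exact 𝒜.cumulant_eq_zero_of_isolated l hl _ (hφ l)
      · obtain ⟨b, hb⟩ := exists_component_not_isMono hm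
        refine 𝒜.cumulant_eq_zero_of_component b _ ?_
        exact ih _ (hf.component_card_lt hg hne b) _ _ (fun i => hV' i.1) _
          ((hg.isForest.of_le hf).component b) hb rfl

end TensorialProbabilitySpace

namespace TensorFree

set_option linter.unusedSectionVars false

/-! ### Pure invariants as graphs of elements of degree `(1, …, 1)`. -/

section Pure

variable {D : ℕ} {ι : Type}

theorem pureGraph_apply (σ : Fin D → Perm ι) (c : Fin D) (x : Σ _ : ι, Fin (unitDeg D c)) :
    (pureGraph σ c x).1 = σ c x.1 := rfl

theorem sigma_unitDeg_ext {c : Fin D} {x y : Σ _ : ι, Fin (unitDeg D c)} (h : x.1 = y.1) :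
    x = y := by
  obtain ⟨i, r⟩ := x
  obtain ⟨j, s⟩ := y
  obtain rfl : i = j := h
  rw [show r = s from Subsingleton.elim (α := Fin 1) r s]

theorem exists_eq_pureGraph (g : Graph fun _ : ι => unitDeg D) : ∃ σ, g = pureGraph σ := by
  refine ⟨fun c => (Equiv.sigmaUnique ι fun _ => Fin 1).permCongr (g c), ?_⟩
  funext c
  ext1 x
  refine sigma_unitDeg_ext ?_
  rw [pureGraph_apply, Equiv.permCongr_apply]
  have : (Equiv.sigmaUnique ι fun _ => Fin 1).symm x.1 = x := sigma_unitDeg_ext rfl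
  rw [this]
  rfl

theorem conn_pureGraph_iff (σ : Fin D → Perm ι) (i j : ι) :
    conn (pureGraph σ) i j ↔ pureConn σ i j := by
  have h : ∀ i j, (∃ (c : Fin D) (r s : Fin (unitDeg D c)), pureGraph σ c ⟨i, r⟩ = ⟨j, s⟩) ↔
      ∃ c, σ c i = j := by
    intro i j
    constructor
    · rintro ⟨c, r, s, hrs⟩
      exact ⟨c, congrArg Sigma.fst hrs⟩
    · rintro ⟨c, rfl⟩
      exact ⟨c, 0, 0, rfl⟩
  show Relation.EqvGen _ i j ↔ Relation.EqvGen _ i j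
  simp only [h]

theorem isCopy_pureComponent (σ : Fin D → Perm ι) (B : Quotient (pureConn σ)) :
    IsCopy (k := fun _ : ι => unitDeg D) Subtype.val (pureGraph (pureComponent σ B))
      (pureGraph σ) := fun _ _ => rfl

theorem IsPureMelonic.isMelonic {σ : Fin D → Perm ι} (h : IsPureMelonic σ) :
    IsMelonic (pureGraph σ) := by
  induction h with
  | @single ι _ σ =>
    have : pureGraph σ = fun _ => 1 := by
      funext c
      ext1 x
      exact sigma_unitDeg_ext (Subsingleton.elim _ _)
    rw [this]
    exact IsMelonic.single _
  | insert σ v c₀ hself hopen σ' hkeep hjoin _ ih =>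
    refine IsMelonic.insert (k := fun _ => unitDeg D) (pureGraph σ) v c₀ 0 (fun c r hr => ?_)
      (fun h => hopen (congrArg Sigma.fst h)) (pureGraph σ') (fun c x hx => ?_) (fun c x hx => ?_) ih
    · refine sigma_unitDeg_ext (hself c ?_)
      rintro rfl
      exact hr (by rw [show r = 0 from Subsingleton.elim (α := Fin 1) _ _])
    · exact sigma_unitDeg_ext (hkeep c x.1 hx)
    · refine sigma_unitDeg_ext ((hjoin c x.1 hx).trans ?_)
      rw [pureGraph_apply]
      exact congrArg (σ c) hx.symm

/-- The degrees are kept variable and `σ` is tied to `g` only through first components, so that the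
induction on `IsMelonic` applies. -/
theorem IsMelonic.isPureMelonic_of {k : ι → Deg D} {g : Graph k} (hg : IsMelonic g)
    (hk : ∀ i c, k i c = 1) (σ : Fin D → Perm ι) (hσ : ∀ c x, (g c x).1 = σ c x.1) :
    IsPureMelonic σ := by
  induction hg with
  | single k => exact IsPureMelonic.single σ
  | @insert ι k g v c₀ r₀ hself hopen g' hkeep hjoin _ ih =>
    have hsub : ∀ i c (r s : Fin (k i c)), r = s := fun i c r s => by
      have h1 := r.2
      have h2 := s.2
      have h3 := hk i c
      exact Fin.ext (by omega)
    let r : ∀ i c, Fin (k i c) := fun i c => ⟨0, by rw [hk]; exact one_pos⟩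
    have hext : ∀ (c : Fin D) (x y : Σ i, Fin (k i c)), x.1 = y.1 → x = y := by
      rintro c ⟨i, r⟩ ⟨j, s⟩ h
      obtain rfl : i = j := h
      rw [hsub i c r s]
    have hbij : ∀ c, Function.Bijective
        (Sigma.fst : (Σ i : {i // i ≠ v}, Fin (k i.1 c)) → {i // i ≠ v}) := by
      intro c
      constructor
      · rintro ⟨i, r⟩ ⟨j, s⟩ h
        obtain rfl : i = j := h
        rw [hsub i.1 c r s]
      · exact fun i => ⟨⟨i, r i.1 c⟩, rfl⟩
    let E := fun c => Equiv.ofBijective _ (hbij c)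
    have hE : ∀ c x, (E c).symm x = ⟨x, r x.1 c⟩ := fun c x => by
      rw [Equiv.symm_apply_eq]
      rfl
    refine IsPureMelonic.insert σ v c₀ (fun c hc => ?_) (fun h => hopen ?_)
      (fun c => (E c).permCongr (g' c)) (fun c x hx => ?_) (fun c x hx => ?_)
      (ih (fun i c => hk i.1 c) _ fun c x => ?_)
    · have h1 := hself c (r v c) fun h => hc (congrArg Sigma.fst h)
      have h2 := hσ c ⟨v, r v c⟩
      rw [h1] at h2
      exact h2.symm
    · exact hext _ _ _ ((hσ _ _).trans h)
    · rw [Equiv.permCongr_apply, hE]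
      have h1 := hkeep c ⟨x, r x.1 c⟩ (by rw [hσ]; exact hx)
      have h2 := congrArg Sigma.fst h1
      rw [hσ] at h2
      exact h2
    · rw [Equiv.permCongr_apply, hE]
      have h1 := hjoin c ⟨x, r x.1 c⟩ (by rw [hσ]; exact hx)
      have h2 := congrArg Sigma.fst h1
      rw [hσ, hσ] at h2
      exact h2.trans (congrArg (σ c) hx)
    · rw [Equiv.permCongr_apply]
      exact congrArg (fun y => (g' c y).1) ((E c).symm_apply_apply x).symm

theorem isPureMelonic_iff {σ : Fin D → Perm ι} : IsPureMelonic σ ↔ IsTreeLike (pureGraph σ) :=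
  ⟨fun h => h.isMelonic.isTreeLike, fun h =>
    h.isMelonic.isPureMelonic_of (fun _ _ => rfl) σ fun _ _ => rfl⟩

theorem exists_pure_copy [Finite ι] (g : Graph fun _ : ι => unitDeg D) (hg : IsTreeLike g) :
    ∃ (e : Fin (Nat.card ι) → ι) (σ : Fin D → Perm (Fin (Nat.card ι))), Function.Bijective e ∧
      IsPureMelonic σ ∧ IsCopy (k := fun _ : ι => unitDeg D) e (pureGraph σ) g := by
  have e := (Finite.equivFin ι).symm
  obtain ⟨g', hg'⟩ := exists_isCopy (k := fun _ : ι => unitDeg D) e.bijective g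
  obtain ⟨σ, rfl⟩ := exists_eq_pureGraph g'
  exact ⟨e, σ, e.bijective, isPureMelonic_iff.2 ((hg'.isTreeLike_iff e.bijective).2 hg), hg'⟩

end Pure

theorem IsCopy.almostAlternating {D : ℕ} {ι ι' : Type} {k : ι → Deg D} {α : Type*} {a : ι → α}
    {e : ι' → ι} (he : Function.Bijective e) {g' : Graph fun i => k (e i)} {g : Graph k}
    (hcopy : IsCopy (k := k) e g' g) (h : AlmostAlternating g a) :
    AlmostAlternating g' fun i => a (e i) := by
  obtain ⟨⟨c, x, hx⟩, h2⟩ := h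
  refine ⟨?_, ?_⟩
  · obtain ⟨y, rfl⟩ := (pairMap_bijective (k := k) he c).2 x
    rw [hcopy] at hx
    exact ⟨c, y, hx⟩
  · have key : ∀ (c : Fin D) (x : Σ i : ι', Fin (k (e i) c)),
        x.1 ≠ (g' c x).1 ∧ a (e x.1) = a (e (g' c x).1) →
        (pairMap (k := k) e x).1 ≠ (g c (pairMap e x)).1 ∧
          a (pairMap (k := k) e x).1 = a (g c (pairMap e x)).1 := by
      rintro c x ⟨h3, h4⟩
      rw [hcopy]
      exact ⟨fun h => h3 (he.1 h), h4⟩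
    rintro ⟨c, x⟩ hx ⟨c', x'⟩ hx'
    have h3 := @h2 ⟨c, pairMap e x⟩ (key c x hx) ⟨c', pairMap e x'⟩ (key c' x' hx')
    obtain ⟨rfl, h3⟩ := Sigma.mk.inj_iff.1 h3
    rw [pairMap_injective he.1 c (eq_of_heq h3)]

end TensorFree

namespace TensorialProbabilitySpace

set_option linter.unusedSectionVars false

variable {D : ℕ} (𝒜 : TensorialProbabilitySpace D) {α : Type*} (gen : α → α → 𝒜.A (unitDeg D))

open scoped Classical

/-! ### Pure moments and cumulants. -/

section Pure

variable {ι : Type} [Fintype ι]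

theorem pureMomentProd_eq (σ : Fin D → Perm ι) (a b : ι → α) :
    𝒜.pureMomentProd gen σ a b = 𝒜.momentProd (pureGraph σ) fun i => gen (a i) (b i) := by
  rw [pureMomentProd, momentProd_eq]
  refine Fintype.prod_bijective
    (Quotient.map (sa := pureConn σ) (sb := conn (pureGraph σ)) id fun i j hij =>
      (conn_pureGraph_iff σ i j).2 hij) ⟨?_, ?_⟩ _ _ ?_
  · intro B B' h
    obtain ⟨i, rfl⟩ := Quotient.exists_rep B
    obtain ⟨j, rfl⟩ := Quotient.exists_rep B'
    exact Quotient.sound ((conn_pureGraph_iff σ i j).1 (Quotient.exact h))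
  · intro B
    obtain ⟨i, rfl⟩ := Quotient.exists_rep B
    exact ⟨Quotient.mk _ i, rfl⟩
  · intro B
    obtain ⟨j, rfl⟩ := Quotient.exists_rep B
    have hiff : ∀ i, Quotient.mk (pureConn σ) i = Quotient.mk _ j ↔
        Quotient.mk (conn (pureGraph σ)) i = Quotient.mk _ j := fun i =>
      ⟨fun h => Quotient.sound ((conn_pureGraph_iff σ i j).2 (Quotient.exact h)),
        fun h => Quotient.sound ((conn_pureGraph_iff σ i j).1 (Quotient.exact h))⟩
    let E : {i // Quotient.mk (pureConn σ) i = Quotient.mk _ j} →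
        {i // Quotient.mk (conn (pureGraph σ)) i = Quotient.mk _ j} := fun i =>
      ⟨i.1, (hiff i.1).1 i.2⟩
    have hE : Function.Bijective E := by
      constructor
      · intro x y h
        have h' := congrArg Subtype.val h
        exact Subtype.ext h'
      · exact fun i => ⟨⟨i.1, (hiff i.1).2 i.2⟩, rfl⟩
    exact 𝒜.moment_copy (k := fun _ => unitDeg D) hE
      (IsCopy.of_comp (k := fun _ => unitDeg D) Subtype.val_injective
        (isCopy_restrict (pureGraph σ) _ (conn_edge (pureGraph σ) (Quotient.mk _ j)))
        (isCopy_pureComponent σ (Quotient.mk _ j)))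
      fun i => gen (a i.1) (b i.1)

theorem pureCumulant_eq (σ : Fin D → Perm ι) (a b : ι → α) :
    𝒜.pureCumulant gen σ a b = 𝒜.cumulant (pureGraph σ) fun i => gen (a i) (b i) := by
  have hmul : ∀ (τ : Fin D → Perm ι) c, pureGraph τ c * (pureGraph σ c)⁻¹ =
      (Equiv.sigmaUnique ι fun _ => Fin 1).symm.permCongr (τ c * (σ c)⁻¹) := fun τ c => rfl
  have hlen : ∀ (τ : Perm ι), permLength
      ((Equiv.sigmaUnique ι fun _ => Fin 1).symm.permCongr τ) = permLength τ := fun τ =>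
    permLength_permCongr _ τ
  rw [pureCumulant, cumulant_eq]
  refine Finset.sum_bij (fun τ _ => pureGraph τ) ?_ ?_ ?_ ?_
  · intro τ hτ
    simp only [Finset.mem_filter, Finset.mem_univ, true_and] at hτ ⊢
    intro c
    have := hτ c
    unfold NCLe at this ⊢
    rw [hmul, hlen]
    exact (congrArg₂ _ (hlen _) rfl).trans (this.trans (hlen _).symm)
  · intro τ _ τ' _ h
    funext c
    exact (Equiv.sigmaUnique ι fun _ => Fin 1).symm.permCongr.injective (congrFun h c)
  · intro f hf
    obtain ⟨τ, rfl⟩ := exists_eq_pureGraph f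
    refine ⟨τ, ?_, rfl⟩
    simp only [Finset.mem_filter, Finset.mem_univ, true_and] at hf ⊢
    intro c
    have := hf c
    unfold NCLe at this ⊢
    rw [hmul, hlen] at this
    exact (congrArg₂ _ (hlen _) rfl).symm.trans (this.trans (hlen _))
  · intro τ _
    rw [pureMomentProd_eq]
    congr 1
    refine Finset.prod_congr rfl fun c _ => ?_
    refine Eq.trans ?_ (moebiusNC_permCongr (τ c * (σ c)⁻¹)
      (Equiv.sigmaUnique ι fun _ => Fin 1).symm).symm
    -- The pure cumulant is written with `σ τ⁻¹`, the cumulant of elements with `τ σ⁻¹`; the Möbius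
    -- function takes the same value on inverses.
    rw [← moebiusNC_inv, mul_inv_rev, inv_inv]

variable {𝒜 gen}

theorem moment_eq_zero_of_pure {P : α → α → Prop}
    (h : ∀ n : ℕ, 1 ≤ n → ∀ σ : Fin D → Equiv.Perm (Fin n), IsPureMelonic σ →
      ∀ a b : Fin n → α, (∃ i, P (a i) (b i)) → 𝒜.pureMoment gen σ a b = 0)
    {g : Graph fun _ : ι => unitDeg D} (hg : IsTreeLike g) (a b : ι → α) (hP : ∃ i, P (a i) (b i)) :
    𝒜.moment g (fun i => gen (a i) (b i)) = 0 := by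
  obtain ⟨e, σ, he, hσ, hcopy⟩ := exists_pure_copy g hg
  have := hg.nonempty
  rw [← 𝒜.moment_copy (k := fun _ : ι => unitDeg D) he hcopy]
  refine h _ Nat.card_pos σ hσ (fun i => a (e i)) (fun i => b (e i)) ?_
  obtain ⟨i, hi⟩ := hP
  obtain ⟨j, rfl⟩ := he.2 i
  exact ⟨j, hi⟩

theorem cumulant_eq_pureCumulant {g : Graph fun _ : ι => unitDeg D} {n : ℕ} {e : Fin n → ι}
    (he : Function.Bijective e) {σ : Fin D → Perm (Fin n)}
    (hcopy : IsCopy (k := fun _ : ι => unitDeg D) e (pureGraph σ) g) (a b : ι → α) :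
    𝒜.cumulant g (fun i => gen (a i) (b i)) =
      𝒜.pureCumulant gen σ (fun i => a (e i)) fun i => b (e i) := by
  rw [pureCumulant_eq, ← 𝒜.cumulant_copy (k := fun _ : ι => unitDeg D) he hcopy]

theorem cumulant_eq_zero_of_pure {P : α → α → Prop}
    (h : ∀ n : ℕ, 1 ≤ n → ∀ σ : Fin D → Equiv.Perm (Fin n), IsPureMelonic σ →
      ∀ a b : Fin n → α, (∃ i, P (a i) (b i)) → 𝒜.pureCumulant gen σ a b = 0)
    {g : Graph fun _ : ι => unitDeg D} (hg : IsTreeLike g) (a b : ι → α) (hP : ∃ i, P (a i) (b i)) :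
    𝒜.cumulant g (fun i => gen (a i) (b i)) = 0 := by
  obtain ⟨e, σ, he, hσ, hcopy⟩ := exists_pure_copy g hg
  have := hg.nonempty
  rw [cumulant_eq_pureCumulant he hcopy]
  refine h _ Nat.card_pos σ hσ (fun i => a (e i)) (fun i => b (e i)) ?_
  obtain ⟨i, hi⟩ := hP
  obtain ⟨j, rfl⟩ := he.2 i
  exact ⟨j, hi⟩

/-- In the expansion into cumulants, every `f` has a component that contains the label satisfying
`P`, and this component contributes a zero factor. -/
theorem pureMoment_eq_zero_of_pureCumulant {P : α → α → Prop}
    (h : ∀ n : ℕ, 1 ≤ n → ∀ σ : Fin D → Equiv.Perm (Fin n), IsPureMelonic σ →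
      ∀ a b : Fin n → α, (∃ i, P (a i) (b i)) → 𝒜.pureCumulant gen σ a b = 0)
    {σ : Fin D → Perm ι} (hσ : IsPureMelonic σ) (a b : ι → α) (hP : ∃ i, P (a i) (b i)) :
    𝒜.pureMoment gen σ a b = 0 := by
  have hg := isPureMelonic_iff.1 hσ
  have := hg.nonempty
  rw [pureMoment, ← 𝒜.momentProd_of_conn hg.conn]
  refine 𝒜.momentProd_eq_zero _ _ fun f hf => ?_
  obtain ⟨i, hi⟩ := hP
  refine 𝒜.cumulant_eq_zero_of_component (Quotient.mk _ i) _ ?_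
  exact cumulant_eq_zero_of_pure h ((hg.isForest.of_le hf).component _) (fun i => a i.1)
    (fun i => b i.1) ⟨⟨i, rfl⟩, hi⟩

theorem pureCumulant_eq_zero_of_pureMoment {P : α → α → Prop}
    (h : ∀ n : ℕ, 1 ≤ n → ∀ σ : Fin D → Equiv.Perm (Fin n), IsPureMelonic σ →
      ∀ a b : Fin n → α, (∃ i, P (a i) (b i)) → 𝒜.pureMoment gen σ a b = 0)
    {σ : Fin D → Perm ι} (hσ : IsPureMelonic σ) (a b : ι → α) (hP : ∃ i, P (a i) (b i)) :
    𝒜.pureCumulant gen σ a b = 0 := by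
  have hg := isPureMelonic_iff.1 hσ
  rw [pureCumulant_eq, cumulant_eq]
  refine Finset.sum_eq_zero fun f hf => mul_eq_zero_of_left ?_ _
  have hf := (Finset.mem_filter.1 hf).2
  obtain ⟨i, hi⟩ := hP
  rw [momentProd_eq]
  refine Finset.prod_eq_zero (Finset.mem_univ (Quotient.mk _ i)) ?_
  exact moment_eq_zero_of_pure h ((hg.isForest.of_le hf).component _) (fun i => a i.1)
    (fun i => b i.1) ⟨⟨i, rfl⟩, hi⟩

end Pure

/-! ### The subspaces spanned by products. -/

section Generated

variable {𝒜} {s : Set (𝒜.A (unitDeg D))}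

/-- A nonzero element yields a nonzero product of generators. The same tree filled with identities
has `1_k` as its product, and the nonvanishing supplies the nontriviality that `mul_one` requires.
-/
theorem one_mem_generated (hs : 𝒜.one (unitDeg D) ∈ s) {k : Deg D} {x : 𝒜.A k}
    (hx : x ∈ 𝒜.generated s k) (hx0 : x ≠ 0) : 𝒜.one k ∈ 𝒜.generated s k := by
  have h1 : ∃ z ∈ {z | ∃ (n : ℕ) (T : Tree (fun _ : Fin n => unitDeg D) k)
      (w : Fin n → 𝒜.A (unitDeg D)), (∀ i, w i ∈ s) ∧ 𝒜.mul T w = z}, z ≠ 0 := by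
    by_contra! h
    exact hx0 ((Submodule.mem_bot ℂ).1 (Submodule.span_le.2 (fun z hz => h z hz) hx))
  obtain ⟨_, ⟨n, T, w, -, rfl⟩, hz⟩ := h1
  have h2 : ∀ _ : Fin n, Nontrivial (𝒜.A (unitDeg D)) := fun i =>
    ⟨⟨w i, 0, fun h => hz ((𝒜.mul T).map_coord_zero i h)⟩⟩
  exact Submodule.subset_span ⟨n, T, fun _ => 𝒜.one _, fun _ => hs, 𝒜.mul_one T h2⟩

theorem subset_generated {x : 𝒜.A (unitDeg D)} (hx : x ∈ s) : x ∈ 𝒜.generated s (unitDeg D) := by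
  let T : Tree (fun _ : Unit => unitDeg D) (unitDeg D) :=
    { graph := fun _ => 1
      melonic := IsMelonic.single _
      cut := fun c r => ⟨(), r⟩
      cut_spec := fun c x => ⟨x.2, (Perm.SameCycle.refl _ _), fun r hr => by
        have hr := Perm.sameCycle_one.1 hr
        rw [← hr]⟩ }
  have he : Function.Bijective fun _ : Fin 1 => () :=
    ⟨fun _ _ _ => Subsingleton.elim _ _, fun _ => ⟨0, rfl⟩⟩
  obtain ⟨g', hg'⟩ := exists_isCopy (k := fun _ : Unit => unitDeg D) he T.graph
  obtain ⟨T', -, hT'⟩ := exists_renaming he T hg'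
  refine Submodule.subset_span ⟨1, T', fun _ => x, fun _ => hx, ?_⟩
  rw [← 𝒜.mul_rename _ T' T hT' fun _ => x, 𝒜.mul_single T fun _ _ => rfl]

/-- By multilinearity the factors may be taken to be products of generators, and associativity makes
their product a single product along the grafted tree. -/
theorem mul_mem_generated {κ : Type} {K : κ → Deg D} {k : Deg D} (T : Tree K k)
    (h : ∀ j, 𝒜.A (K j)) (hh : ∀ j, h j ∈ 𝒜.generated s (K j)) :
    𝒜.mul T h ∈ 𝒜.generated s k := by
  have := T.melonic.isTreeLike.finite
  refine mem_of_forall_mem_span (fun h => 𝒜.mul T h) (𝒜.generated s k)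
    (fun h i => ⟨(𝒜.mul T).toLinearMap h i, fun x => rfl⟩) _ (fun h hs => ?_) h hh
  choose n S w hw hS using hs
  obtain rfl : (fun j => 𝒜.mul (S j) (w j)) = h := funext hS
  let U := graftTree S T
  have e := (Finite.equivFin (Σ j, Fin (n j))).symm
  obtain ⟨g', hg'⟩ := exists_isCopy (k := fun _ : Σ j, Fin (n j) => unitDeg D) e.bijective U.graph
  obtain ⟨U', -, hU'⟩ := exists_renaming e.bijective U hg'
  refine Submodule.subset_span ⟨_, U', fun i => w (e i).1 (e i).2, fun i => hw _ _, ?_⟩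
  exact (𝒜.mul_rename _ U' U hU' fun x => w x.1 x.2).symm.trans
    (𝒜.mul_graft T S U (isGraft_graftTree S T) fun x => w x.1 x.2)

end Generated

end TensorialProbabilitySpace

namespace TensorialProbabilitySpace

set_option linter.unusedSectionVars false

open scoped Classical

/-! ### From arbitrary finite index types to `Fin q`. -/

section Transfer

variable {D : ℕ} {𝒜 : TensorialProbabilitySpace D} {α : Type*} {V : α → ∀ k, Submodule ℂ (𝒜.A k)}

/-- The inductions pass to components and quotients, which forces arbitrary index types; a copy on
`Fin q` brings them back. Two different labels already give `2 ≤ q`. -/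
theorem vanishingCumulants_iff : 𝒜.VanishingCumulants V ↔
    ∀ q : ℕ, 2 ≤ q → ∀ (k : Fin q → Deg D) (a : Fin q → α) (h : ∀ l, 𝒜.A (k l)),
      (∀ l, h l ∈ V (a l) (k l)) → ∀ g : Graph k, IsMelonic g → (∃ l l', a l ≠ a l') →
        𝒜.cumulant g h = 0 := by
  constructor
  · intro H q _ k a h hh g hg ha
    exact H a h hh g hg.isTreeLike (hg.isTreeLike.not_isMono_iff.2 ha)
  · intro H ι _ k a h hh g hg hm
    obtain ⟨i, j, hij⟩ := hg.not_isMono_iff.1 hm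
    have e := (Finite.equivFin ι).symm
    obtain ⟨g', hg'⟩ := exists_isCopy e.bijective g
    rw [← 𝒜.cumulant_copy e.bijective hg' h]
    exact H _ (two_le_card_of_ne hij) (fun l => k (e l)) (fun l => a (e l)) _ (fun l => hh (e l)) g'
      ((hg'.isTreeLike_iff e.bijective).2 hg).isMelonic
      ⟨e.symm i, e.symm j, by simpa using hij⟩

theorem vanishingMoments_iff : 𝒜.VanishingMoments V ↔
    ∀ q : ℕ, 2 ≤ q → ∀ (k : Fin q → Deg D) (a : Fin q → α) (h : ∀ l, 𝒜.A (k l)),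
      (∀ l, h l ∈ V (a l) (k l)) → ∀ g : Graph k, IsMelonic g → AlmostAlternating g a →
        (∀ l, 𝒜.φ (k l) (h l) = 0) → 𝒜.moment g h = 0 := by
  constructor
  · intro H q _ k a h hh g hg halt hφ
    exact H a h hh g hg.isTreeLike halt hφ
  · intro H ι _ k a h hh g hg halt hφ
    obtain ⟨c, x, hx⟩ := halt.1
    have e := (Finite.equivFin ι).symm
    obtain ⟨g', hg'⟩ := exists_isCopy e.bijective g
    rw [← 𝒜.moment_copy e.bijective hg' h]
    exact H _ (two_le_card_of_ne hx) (fun l => k (e l)) (fun l => a (e l)) _ (fun l => hh (e l)) g'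
      ((hg'.isTreeLike_iff e.bijective).2 hg).isMelonic (hg'.almostAlternating e.bijective halt)
      fun l => hφ (e l)

end Transfer

/-! ### The equivalences for pure tensor freeness. -/

section Freeness

variable {D : ℕ} {𝒜 : TensorialProbabilitySpace D} {α : Type*} {gen : α → α → 𝒜.A (unitDeg D)}

theorem pureSubspace_vanishingCumulants_iff_vanishingMoments :
    𝒜.VanishingCumulants (𝒜.pureSubspace gen) ↔ 𝒜.VanishingMoments (𝒜.pureSubspace gen) :=
  ⟨fun h => h.vanishingMoments, fun h => h.vanishingCumulants
    (fun _ _ _ hx hx0 => one_mem_generated (Or.inr rfl) hx hx0)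
    fun _ _ _ _ T h hh => mul_mem_generated T h hh⟩

/-- Vanishing of the cumulants of the generators, the identity included. -/
theorem cumulant_generators_eq_zero
    (H : ∀ n : ℕ, 2 ≤ n → ∀ σ : Fin D → Equiv.Perm (Fin n), IsPureMelonic σ →
      ∀ a : Fin n → α, (∃ i j, a i ≠ a j) → 𝒜.pureCumulant gen σ a a = 0)
    {ι : Type} [Fintype ι] (a : ι → α) (h : ι → 𝒜.A (unitDeg D))
    (hh : ∀ i, h i ∈ ({gen (a i) (a i), 𝒜.one (unitDeg D)} : Set (𝒜.A (unitDeg D))))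
    (g : Graph fun _ : ι => unitDeg D) (hg : IsForest g) (hm : ¬ IsMono a g) :
    𝒜.cumulant g h = 0 := by
  obtain ⟨b, hb⟩ := exists_component_not_isMono hm
  refine 𝒜.cumulant_eq_zero_of_component b h ?_
  have hgb := hg.component b
  obtain ⟨i, j, hij⟩ := hgb.not_isMono_iff.1 hb
  have hcard : 2 ≤ Nat.card {i // Quotient.mk (conn g) i = b} :=
    two_le_card_of_ne (a := fun i : {i // Quotient.mk (conn g) i = b} => a i.1) hij
  -- Discarding this case makes the space of degree `(1, …, 1)` nontrivial, as the vanishing for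
  -- identities requires.
  by_cases h0 : h i.1 = 0
  · exact 𝒜.cumulant_eq_zero_of_apply_eq_zero _ _ i h0
  have hnt : Nontrivial (𝒜.A (unitDeg D)) := ⟨⟨_, _, h0⟩⟩
  by_cases h1 : ∃ l : {l // Quotient.mk (conn g) l = b}, h l.1 = 𝒜.one (unitDeg D)
  · obtain ⟨l, hl⟩ := h1
    exact 𝒜.cumulant_eq_zero_of_one (k := fun _ => unitDeg D) hgb hcard (fun i => h i.1) l hl
  · push Not at h1
    have h2 : (fun l : {l // Quotient.mk (conn g) l = b} => h l.1) =
        fun l => gen (a l.1) (a l.1) := by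
      funext l
      exact (hh l.1).resolve_right (h1 l)
    obtain ⟨e, σ, he, hσ, hcopy⟩ := exists_pure_copy (component g b) hgb
    have h3 := cumulant_eq_pureCumulant (gen := gen) he hcopy (fun i => a i.1) fun i => a i.1
    rw [h2]
    refine h3.trans (H _ hcard σ hσ (fun i => a (e i).1) ?_)
    obtain ⟨i', rfl⟩ := he.2 i
    obtain ⟨j', rfl⟩ := he.2 j
    exact ⟨i', j', hij⟩

/-- Generators belong to their subspaces. Conversely, multilinearity reduces to products of
generators and identities, and the product formula reduces these to mixed cumulants of the factors.
-/
theorem vanishingCumulants_pureSubspace_iff : 𝒜.VanishingCumulants (𝒜.pureSubspace gen) ↔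
    ∀ n : ℕ, 2 ≤ n → ∀ σ : Fin D → Equiv.Perm (Fin n), IsPureMelonic σ →
      ∀ a : Fin n → α, (∃ i j, a i ≠ a j) → 𝒜.pureCumulant gen σ a a = 0 := by
  constructor
  · intro H n _ σ hσ a ha
    have hg := isPureMelonic_iff.1 hσ
    rw [pureCumulant_eq]
    exact H (k := fun _ => unitDeg D) a _ (fun l => subset_generated (Or.inl rfl)) _ hg
      (hg.not_isMono_iff.2 ha)
  · intro H ι _ k a h hh g hg hm
    refine 𝒜.cumulant_eq_zero_of_span g _ (fun h hs => ?_) h hh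
    choose n S w hw hS using hs
    obtain rfl : (fun j => 𝒜.mul (S j) (w j)) = h := funext hS
    have hSg : IsTreeLike (graft g S) := (isTreeLike_graft_iff (S := S) g).2 hg
    have hgen : ∀ u, GraphLe u (graft g S) →
        ¬ IsMono (fun x : Σ i, Fin (n i) => a x.1) u →
        𝒜.cumulant u (fun x : Σ i, Fin (n i) => w x.1 x.2) = 0 := fun u hu hum =>
      cumulant_generators_eq_zero H _ _ (fun x => hw x.1 x.2) u (hSg.isForest.of_le hu) hum
    refine (𝒜.cumulant_graft_of_not_isMono (a := a) S g hm (fun x => w x.1 x.2)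
      fun u hu _ hum => hgen u hu hum).trans (hgen _ (GraphLe.refl _) fun hmono => ?_)
    obtain ⟨i, j, hij⟩ := hg.not_isMono_iff.1 hm
    obtain ⟨i'⟩ := (S i).melonic.isTreeLike.nonempty
    obtain ⟨j'⟩ := (S j).melonic.isTreeLike.nonempty
    exact hij (hmono.conn (hSg.conn ⟨i, i'⟩ ⟨j, j'⟩))

end Freeness

end TensorialProbabilitySpace

theorem mainTheorem12 {D : ℕ} (hD : 3 ≤ D) (𝒜 : TensorialProbabilitySpace D) {α : Type*}
    (gen : α → α → 𝒜.A (unitDeg D)) :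
    -- conditions 1, 2, 3 for matched pairs, i.e. all generators of the form `t_a ⊗ t̄_a`
    [∀ n : ℕ, 2 ≤ n → ∀ σ : Fin D → Equiv.Perm (Fin n), IsPureMelonic σ →
        ∀ a : Fin n → α, (∃ i j, a i ≠ a j) → 𝒜.pureCumulant gen σ a a = 0,
      ∀ q : ℕ, 2 ≤ q → ∀ (k : Fin q → Deg D) (a : Fin q → α) (h : ∀ l, 𝒜.A (k l)),
        (∀ l, h l ∈ 𝒜.pureSubspace gen (a l) (k l)) →
        ∀ g : Graph k, IsMelonic g → (∃ l l', a l ≠ a l') → 𝒜.cumulant g h = 0,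
      ∀ q : ℕ, 2 ≤ q → ∀ (k : Fin q → Deg D) (a : Fin q → α) (h : ∀ l, 𝒜.A (k l)),
        (∀ l, h l ∈ 𝒜.pureSubspace gen (a l) (k l)) →
        ∀ g : Graph k, IsMelonic g → AlmostAlternating g a →
        (∀ l, 𝒜.φ (k l) (h l) = 0) → 𝒜.moment g h = 0].TFAE ∧
    -- the same with arbitrary generators `t_a ⊗ t̄_b` in condition 1
    [∀ n : ℕ, 1 ≤ n → ∀ σ : Fin D → Equiv.Perm (Fin n), IsPureMelonic σ →
        ∀ a b : Fin n → α, (∃ i j, a i ≠ a j ∨ b i ≠ b j ∨ a i ≠ b j) →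
        𝒜.pureCumulant gen σ a b = 0,
      (∀ n : ℕ, 1 ≤ n → ∀ σ : Fin D → Equiv.Perm (Fin n), IsPureMelonic σ →
        ∀ a b : Fin n → α, (∃ i, a i ≠ b i) → 𝒜.pureCumulant gen σ a b = 0) ∧
      ∀ q : ℕ, 2 ≤ q → ∀ (k : Fin q → Deg D) (a : Fin q → α) (h : ∀ l, 𝒜.A (k l)),
        (∀ l, h l ∈ 𝒜.pureSubspace gen (a l) (k l)) →
        ∀ g : Graph k, IsMelonic g → (∃ l l', a l ≠ a l') → 𝒜.cumulant g h = 0,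
      (∀ n : ℕ, 1 ≤ n → ∀ σ : Fin D → Equiv.Perm (Fin n), IsPureMelonic σ →
        ∀ a b : Fin n → α, (∃ i, a i ≠ b i) → 𝒜.pureMoment gen σ a b = 0) ∧
      ∀ q : ℕ, 2 ≤ q → ∀ (k : Fin q → Deg D) (a : Fin q → α) (h : ∀ l, 𝒜.A (k l)),
        (∀ l, h l ∈ 𝒜.pureSubspace gen (a l) (k l)) →
        ∀ g : Graph k, IsMelonic g → AlmostAlternating g a →
        (∀ l, 𝒜.φ (k l) (h l) = 0) → 𝒜.moment g h = 0].TFAE := by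
  have h12 := TensorialProbabilitySpace.vanishingCumulants_pureSubspace_iff (𝒜 := 𝒜) (gen := gen)
  have h23 :=
    TensorialProbabilitySpace.pureSubspace_vanishingCumulants_iff_vanishingMoments
      (𝒜 := 𝒜) (gen := gen)
  have h2 := TensorialProbabilitySpace.vanishingCumulants_iff (𝒜 := 𝒜) (V := 𝒜.pureSubspace gen)
  have h3 := TensorialProbabilitySpace.vanishingMoments_iff (𝒜 := 𝒜) (V := 𝒜.pureSubspace gen)
  have hpure : (∀ n : ℕ, 1 ≤ n → ∀ σ : Fin D → Equiv.Perm (Fin n), IsPureMelonic σ →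
        ∀ a b : Fin n → α, (∃ i, a i ≠ b i) → 𝒜.pureCumulant gen σ a b = 0) ↔
      ∀ n : ℕ, 1 ≤ n → ∀ σ : Fin D → Equiv.Perm (Fin n), IsPureMelonic σ →
        ∀ a b : Fin n → α, (∃ i, a i ≠ b i) → 𝒜.pureMoment gen σ a b = 0 :=
    ⟨fun H n _ σ hσ a b hab =>
        TensorialProbabilitySpace.pureMoment_eq_zero_of_pureCumulant H hσ a b hab,
      fun H n _ σ hσ a b hab =>
        TensorialProbabilitySpace.pureCumulant_eq_zero_of_pureMoment H hσ a b hab⟩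
  -- After these rewrites the three statements of the first list coincide, and so do the last two of
  -- the second list.
  rw [← h2, ← h3, ← h12, ← h23, ← hpure]
  refine ⟨?_, ?_⟩
  · tfae_have 1 ↔ 2 := Iff.rfl
    tfae_have 2 ↔ 3 := Iff.rfl
    tfae_finish
  · tfae_have 1 → 2 := fun H =>
      ⟨fun n hn σ hσ a b ⟨i, hi⟩ => H n hn σ hσ a b ⟨i, i, Or.inr (Or.inr hi)⟩,
        h12.2 fun n hn σ hσ a ⟨i, j, hij⟩ =>
          H n (one_le_two.trans hn) σ hσ a a ⟨i, j, Or.inl hij⟩⟩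
    tfae_have 2 → 1 := by
      rintro ⟨H1, H2⟩ n hn σ hσ a b ⟨i, j, hij⟩
      -- If no label is mismatched, all pairs are matched and two of their labels differ, which also
      -- forces `2 ≤ n`.
      by_cases hab : ∃ i, a i ≠ b i
      · exact H1 n hn σ hσ a b hab
      · push Not at hab
        obtain rfl : a = b := funext hab
        have haij : a i ≠ a j := by tauto
        have hcard := two_le_card_of_ne haij
        rw [Nat.card_fin] at hcard
        exact h12.1 H2 n hcard σ hσ a ⟨i, j, haij⟩
    tfae_have 2 ↔ 3 := Iff.rfl
    tfae_finish
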